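/- Let $n\in\mathbb N$ and $\frac13<\alpha<\beta<\frac12$. **Norms.** For functions on $[0,1]$ write $|f|_{0}=\sup_x|f(x)|$, $|f|_{C^\gamma}=|f|_0+\sup_{x\ne y}\frac{|f(y)-f(x)|}{|x-y|^\gamma}$, $|f|_{C^1}=|f|_0+|\partial_xf|_0$, and for $R$ on $[0,1]^2$ write $|R|_{\gamma}=\sup_{x\neq y}\frac{|R(x,y)|}{|x-y|^{\gamma}}$; $\Omega C^{\gamma}$ is the space of continuous $R$ on $[0,1]^2$ that vanish on the diagonal and have $|R|_\gamma<\infty$. Write $\delta f(x,y)=f(y)-f(x)$, $C^\gamma_T=C([0,T],C^\gamma)$, $\Omega C^\gamma_T=C([0,T],\Omega C^\gamma)$, $C^1_T=C([0,T],C^1[0,1])$, each with the supremum over $t\in[0,T]$ of the spatial norm, and $\|v\|_{C^{1/2}([0,T],C^0)}=\sup_t|v(t)|_0+\sup_{s\ne t}\frac{|v(t)-v(s)|_0}{|t-s|^{1/2}}$. **Data.** A set of data on $[0,T]$ consists of $X\in C^\alpha_T$ with values in $\mathbb R^n$ and $\mathbf X\in\Omega C^{2\alpha}_T$ with values in $\mathbb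 R^n\otimes\mathbb R^n$ such that for every $t$, all $x\le y\le z$ in $[0,1]$ and all $i,j$ $$\mathbf X^{ij}(t,x,z)-\mathbf X^{ij}(t,x,y)-\mathbf X^{ij}(t,y,z)=\delta X^i(t,x,y)\,\delta X^j(t,y,z);$$ of $\Psi\in C^\alpha_T$ with values in $\mathbb R^n$, $\Psi'\in C^\alpha_T$ with values in $\mathbb R^{n\times n}$ and $R_\Psi\in\Omega C^{2\alpha}_T$ such that $\delta\Psi(t,x,y)=\Psi'(t,x)\,\delta X(t,x,y)+R_\Psi(t,x,y)$ for all $t$ and $x\le y$; and of $u_0\in C^\beta([0,1],\mathbb R^n)$ with $u_0(0)=u_0(1)$. The data are bounded by $M$ if $\sup_t(|X(t)|_{C^\alpha}+|\mathbf X(t)|_{2\alpha})\le M$, $\sup_t(|\Psi(t)|_{C^\alpha}+|\Psi'(t)|_{C^\alpha}+|R_\Psi(t)|_{2\alpha})\le M$ and $|u_0|_{C^\beta}\le M$. **The map.** Let $g\colon\mathbb R^n\to\mathbb R^{n\times n}$ be of class $C^3$, bounded with bounded derivatives up to order $3$, and let $|g|_{C^3}$ be the sum of the suprema of $g$ and these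 derivatives. Let $\hat p_t(x)=\sum_{k\in\mathbb Z}(4\pi t)^{-1/2}e^{-(x-k)^2/4t}$, let $S(t)f(x)=\int_0^1\hat p_t(x-y)f(y)\,dy$ be the periodic heat semigroup and $U(t)=S(t)u_0$. For $v\in C^1_T$ put $u=U+\Psi+v$ and $$G_T(v)(t,x)=\int_0^tS(t-s)\big[g(u(s))\,\partial_x(v(s)+U(s))\big](x)\,ds+\int_0^t\!\int_0^1\hat p_{t-s}(x-y)\,g(u(s,y))\,d_y\Psi(s,y)\,ds .$$ The spatial integral in the second term is a rough integral: with $Y(y)=\hat p_{t-s}(x-y)g(u(s,y))$ and $Y'(y)=\hat p_{t-s}(x-y)\,Dg(u(s,y))\,\Psi'(s,y)$ it is the limit of $$\sum_iY(x_i)\,\delta\Psi(s,x_i,x_{i+1})+Y'(x_i)\,\mathbf X(s,x_i,x_{i+1})\,\Psi'(s,x_i)^T$$ as the mesh of the partition $0=x_0\le\dots\le x_m=1$ tends to $0$. Let $B_K=\{v\in C^1_T:\|v\|_{C^1_T}\le K\}$. **Proposition.** For all $K>0$ and $M,L\ge0$ there is $T_{\max}>0$, depending only on $n,\alpha,\beta,K,M,L$,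 such that the following holds for every $T\in(0,T_{\max}]$. 1. For every $g$ as above with $|g|_{C^3}\le L$ and all data on $[0,T]$ bounded by $M$: for every $v\in B_K$ all integrals in the definition of $G_T(v)$ exist (in particular the Riemann sums converge and the integrands in $s$ are integrable); $G_T$ maps $B_K$ into $B_K$ and is a contraction there, that is, there is $q<1$ with $\|G_T(v)-G_T(w)\|_{C^1_T}\le q\|v-w\|_{C^1_T}$ for all $v,w\in B_K$; and $G_T$ has a unique fixed point in $B_K$. 2. There is a constant $C$, depending only on $T,n,\alpha,\beta,K,M,L$, such that for every $g$ as above with $|g|_{C^3}\le L$ and any two sets of data $(X,\mathbf X,\Psi,\Psi',R_\Psi,u_0)$ and $(\bar X,\bar{\mathbf X},\bar\Psi,\bar\Psi',R_{\bar\Psi},\bar u_0)$ on $[0,T]$, both bounded by $M$, the corresponding fixed points $v,\bar v\in B_K$ satisfy $$\|v-\bar v\|_{C^1_T}\le C\Delta,\qquad \|v-\bar v\|_{C^{1/2}([0,T],C^0)}\le C\Delta,$$ where $$\Delta=\|X-\bar X\|_{C^\alpha_T}+\|\mathbf X-\bar{\mathbf X}\|_{\Omega C^{2\alpha}_T}+\|\Psi-\bar\Psi\|_{C^\alpha_T}+\|\Psi'-\bar\Psi'\|_{C^\alpha_T}+\|R_\Psi-R_{\bar\Psi}\|_{\Omega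 C^{2\alpha}_T}+|u_0-\bar u_0|_{C^\beta}.$$ -/

import Mathlib

open Set Filter Topology MeasureTheory
open scoped NNReal ENNReal

namespace RoughBurgers

noncomputable section

/-! ### Function spaces on `[0,1]`

Functions of space are total functions on `ℝ` of which only the restriction to `[0,1]` is used;
functions of time are used on `[0,T]` only. Norms take values in `[0,∞]`. -/

section Norms

variable {F : Type*} [NormedAddCommGroup F]

/-- Supremum norm on `[0,1]`. -/
def supNorm (f : ℝ → F) : ℝ≥0∞ := ⨆ x ∈ Icc (0 : ℝ) 1, ‖f x‖ₑ

/-- Increment `δ f (x,y) = f y - f x`. -/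
def incr (f : ℝ → F) (x y : ℝ) : F := f y - f x

/-- `sup_{x ≠ y} |R(x,y)| / |x-y|^γ` over `x, y ∈ [0,1]`. -/
def holderTwo (γ : ℝ) (R : ℝ → ℝ → F) : ℝ≥0∞ :=
  ⨆ x ∈ Icc (0 : ℝ) 1, ⨆ y ∈ Icc (0 : ℝ) 1, ⨆ _ : x ≠ y,
    ‖R x y‖ₑ / ENNReal.ofReal (|x - y| ^ γ)

/-- The norm of `C^γ`: supremum norm plus Hölder seminorm. -/
def holderNorm (γ : ℝ) (f : ℝ → F) : ℝ≥0∞ := supNorm f + holderTwo γ (incr f)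

/-- The space `ΩC^γ`: continuous functions on `[0,1]²` that vanish on the diagonal and have finite
`γ`-seminorm. -/
structure MemOmega (γ : ℝ) (R : ℝ → ℝ → F) : Prop where
  continuousOn : ContinuousOn (fun z : ℝ × ℝ => R z.1 z.2) (Icc (0 : ℝ) 1 ×ˢ Icc (0 : ℝ) 1)
  diag : ∀ x ∈ Icc (0 : ℝ) 1, R x x = 0
  finite : holderTwo γ R < ⊤

/-- Continuity on `[0,T]` of a path `f` with respect to the norm `N`. -/
def ContinuousPath {V : Type*} [Sub V] (T : ℝ) (N : V → ℝ≥0∞) (f : ℝ → V) : Prop :=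
  ∀ t ∈ Icc (0 : ℝ) T, Tendsto (fun s => N (f s - f t)) (𝓝[Icc (0 : ℝ) T] t) (𝓝 0)

/-- The space `C([0,T], C^γ)`. -/
structure HolderPath (T γ : ℝ) (f : ℝ → ℝ → F) : Prop where
  mem : ∀ t ∈ Icc (0 : ℝ) T, holderNorm γ (f t) < ⊤
  continuous : ContinuousPath T (holderNorm γ) f

/-- The space `C([0,T], ΩC^γ)`. -/
structure OmegaPath (T γ : ℝ) (R : ℝ → ℝ → ℝ → F) : Prop where
  mem : ∀ t ∈ Icc (0 : ℝ) T, MemOmega γ (R t)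
  continuous : ContinuousPath T (holderTwo γ) R

/-- Supremum over `t ∈ [0,T]` of the norm `N`. -/
def supTime {V : Type*} (T : ℝ) (N : V → ℝ≥0∞) (f : ℝ → V) : ℝ≥0∞ :=
  ⨆ t ∈ Icc (0 : ℝ) T, N (f t)

variable [NormedSpace ℝ F]

/-- The norm of `C^1[0,1]`. -/
def c1Norm (f : ℝ → F) : ℝ≥0∞ :=
  supNorm f + supNorm (fun x => derivWithin f (Icc (0 : ℝ) 1) x)

/-- The space `C([0,T], C^1[0,1])`. -/
structure C1Path (T : ℝ) (v : ℝ → ℝ → F) : Prop where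
  mem : ∀ t ∈ Icc (0 : ℝ) T, ContDiffOn ℝ 1 (v t) (Icc (0 : ℝ) 1)
  continuous : ContinuousPath T c1Norm v

/-- The closed ball of radius `K` in `C([0,T], C^1[0,1])`. -/
def c1Ball (T : ℝ) (K : ℝ≥0) : Set (ℝ → ℝ → F) :=
  {v | C1Path T v ∧ supTime T c1Norm v ≤ K}

/-- The norm of `C^{1/2}([0,T], C^0[0,1])`. -/
def timeHolderHalfNorm (T : ℝ) (v : ℝ → ℝ → F) : ℝ≥0∞ :=
  supTime T supNorm v +
    ⨆ s ∈ Icc (0 : ℝ) T, ⨆ t ∈ Icc (0 : ℝ) T, ⨆ _ : s ≠ t,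
      supNorm (v t - v s) / ENNReal.ofReal (|t - s| ^ (1 / 2 : ℝ))

end Norms

/-- `ℝⁿ`. -/
abbrev Vec (n : ℕ) := EuclideanSpace ℝ (Fin n)

/-- `ℝⁿ ⊗ ℝⁿ`, with the Hilbert–Schmidt norm. -/
abbrev Tens (n : ℕ) := EuclideanSpace ℝ (Fin n × Fin n)

/-- The linear maps `ℝⁿ → ℝⁿ`, that is, the `n × n` matrices. -/
abbrev Mat (n : ℕ) := Vec n →L[ℝ] Vec n

/-- The `C^3` norm of a matrix-valued function on `ℝⁿ`. -/
def c3Norm {n : ℕ} (g : Vec n → Mat n) : ℝ≥0∞ :=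
  ∑ k ∈ Finset.range 4, ⨆ x : Vec n, ‖iteratedFDeriv ℝ k g x‖ₑ

/-! ### Rough integrals -/

/-- `p 0 ≤ … ≤ p m` is a partition of `[0,1]` with mesh smaller than `δ`. -/
structure IsPartition (δ : ℝ) (m : ℕ) (p : ℕ → ℝ) : Prop where
  left : p 0 = 0
  right : p m = 1
  mono : ∀ i < m, p i ≤ p (i + 1)
  mesh : ∀ i < m, p (i + 1) - p i < δ

/-- The second order approximation `Y(x) δZ(x,y) + Y'(x) 𝐗(x,y) Z'(x)ᵀ`; in coordinates
`∑_j Y_{ij} δZ_j + ∑_{j,k,l} Y'_{ij,k} 𝐗^{kl} Z'_{jl}`. -/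
def secondOrder {n : ℕ} (XX : ℝ → ℝ → Tens n) (Y : ℝ → Mat n) (Y' : ℝ → Vec n →L[ℝ] Mat n)
    (Z : ℝ → Vec n) (Z' : ℝ → Mat n) (x y : ℝ) : Vec n :=
  Y x (incr Z x y) +
    ∑ k : Fin n, ∑ l : Fin n,
      XX x y (k, l) • (Y' x (EuclideanSpace.single k 1)) (Z' x (EuclideanSpace.single l 1))

/-- `I` is the limit of the second order Riemann sums as the mesh of the partition of `[0,1]`
tends to zero. -/
def IsRoughIntegral {n : ℕ} (XX : ℝ → ℝ → Tens n) (Y : ℝ → Mat n) (Y' : ℝ → Vec n →L[ℝ] Mat n)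
    (Z : ℝ → Vec n) (Z' : ℝ → Mat n) (I : Vec n) : Prop :=
  ∀ ε > 0, ∃ δ > 0, ∀ (m : ℕ) (p : ℕ → ℝ), IsPartition δ m p →
    ‖(∑ i ∈ Finset.range m, secondOrder XX Y Y' Z Z' (p i) (p (i + 1))) - I‖ < ε

open Classical in
/-- The rough integral `∫₀¹ Y dZ` (zero if the Riemann sums do not converge). -/
def roughIntegral {n : ℕ} (XX : ℝ → ℝ → Tens n) (Y : ℝ → Mat n) (Y' : ℝ → Vec n →L[ℝ] Mat n)
    (Z : ℝ → Vec n) (Z' : ℝ → Mat n) : Vec n :=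
  if h : ∃ I, IsRoughIntegral XX Y Y' Z Z' I then h.choose else 0

/-! ### The periodic heat semigroup -/

/-- Gaussian heat kernel on the line. -/
def gaussKernel (t x : ℝ) : ℝ := (Real.sqrt (4 * Real.pi * t))⁻¹ * Real.exp (-x ^ 2 / (4 * t))

/-- Heat kernel on `[0,1]` with periodic boundary conditions. -/
def heatKernel (t x : ℝ) : ℝ := ∑' k : ℤ, gaussKernel t (x - k)

/-- Heat semigroup on `[0,1]` with periodic boundary conditions. -/
def heatSemigroup {n : ℕ} (t : ℝ) (f : ℝ → Vec n) (x : ℝ) : Vec n :=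
  if t = 0 then f x else ∫ y in (0 : ℝ)..1, heatKernel t (x - y) • f y

/-! ### The data and the fixed point map -/

/-- The data of the problem: a path `(X, 𝐗)` of rough paths in space, a path `(Ψ, Ψ', R)` of
controlled rough paths, and an initial condition. The conditions are in `Data.Admissible`. -/
structure Data (n : ℕ) where
  X : ℝ → ℝ → Vec n
  XX : ℝ → ℝ → ℝ → Tens n
  Ψ : ℝ → ℝ → Vec n
  Ψ' : ℝ → ℝ → Mat n
  R : ℝ → ℝ → ℝ → Vec n
  u₀ : ℝ → Vec n

namespace Data

variable {n : ℕ}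

/-- `(X, 𝐗)` is a continuous path on `[0,T]` of `α`-rough paths in space, `(Ψ, Ψ')` is a continuous
path of `X`-controlled rough paths with remainder `R`, and `u₀` is a periodic `C^β` function. -/
structure Admissible (α β T : ℝ) (D : Data n) : Prop where
  X_mem : HolderPath T α D.X
  XX_mem : OmegaPath T (2 * α) D.XX
  chen : ∀ t ∈ Icc (0 : ℝ) T, ∀ x y z : ℝ, 0 ≤ x → x ≤ y → y ≤ z → z ≤ 1 → ∀ i j : Fin n,
    D.XX t x z (i, j) - D.XX t x y (i, j) - D.XX t y z (i, j) =
      incr (D.X t) x y i * incr (D.X t) y z j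
  Ψ_mem : HolderPath T α D.Ψ
  Ψ'_mem : HolderPath T α D.Ψ'
  R_mem : OmegaPath T (2 * α) D.R
  controlled : ∀ t ∈ Icc (0 : ℝ) T, ∀ x y : ℝ, 0 ≤ x → x ≤ y → y ≤ 1 →
    incr (D.Ψ t) x y = D.Ψ' t x (incr (D.X t) x y) + D.R t x y
  u₀_mem : holderNorm β D.u₀ < ⊤
  u₀_periodic : D.u₀ 0 = D.u₀ 1

/-- `sup_{t ≤ T} ( |X(t)|_{C^α} + |𝐗(t)|_{2α} )`. -/
def roughNorm (α T : ℝ) (D : Data n) : ℝ≥0∞ :=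
  ⨆ t ∈ Icc (0 : ℝ) T, (holderNorm α (D.X t) + holderTwo (2 * α) (D.XX t))

/-- `sup_{t ≤ T} ( |Ψ(t)|_{C^α} + |Ψ'(t)|_{C^α} + |R(t)|_{2α} )`. -/
def controlledNorm (α T : ℝ) (D : Data n) : ℝ≥0∞ :=
  ⨆ t ∈ Icc (0 : ℝ) T,
    (holderNorm α (D.Ψ t) + holderNorm α (D.Ψ' t) + holderTwo (2 * α) (D.R t))

/-- All norms of the data are at most `M`. -/
structure BoundedBy (α β T : ℝ) (M : ℝ≥0) (D : Data n) : Prop where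
  rough : D.roughNorm α T ≤ M
  controlled : D.controlledNorm α T ≤ M
  initial : holderNorm β D.u₀ ≤ M

/-- The distance `Δ` between two sets of data. -/
def dist (α β T : ℝ) (D D₂ : Data n) : ℝ≥0∞ :=
  supTime T (holderNorm α) (D.X - D₂.X) + supTime T (holderTwo (2 * α)) (D.XX - D₂.XX) +
    supTime T (holderNorm α) (D.Ψ - D₂.Ψ) + supTime T (holderNorm α) (D.Ψ' - D₂.Ψ') +
    supTime T (holderTwo (2 * α)) (D.R - D₂.R) + holderNorm β (D.u₀ - D₂.u₀)

/-- `U(t) = S(t) u₀`. -/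
def U (D : Data n) (t x : ℝ) : Vec n := heatSemigroup t D.u₀ x

/-- `u = U + Ψ + v`. -/
def u (D : Data n) (v : ℝ → ℝ → Vec n) (t x : ℝ) : Vec n := D.U t x + D.Ψ t x + v t x

/-- `g(u(s)) ∂ₓ (v(s) + U(s))`. -/
def drift (D : Data n) (g : Vec n → Mat n) (v : ℝ → ℝ → Vec n) (s y : ℝ) : Vec n :=
  g (D.u v s y) (derivWithin (fun z => v s z + D.U s z) (Icc (0 : ℝ) 1) y)

/-- The integrand `y ↦ p̂_r(x-y) g(u(s,y))` of the rough integral. -/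
def integrand (D : Data n) (g : Vec n → Mat n) (v : ℝ → ℝ → Vec n) (r s x y : ℝ) : Mat n :=
  heatKernel r (x - y) • g (D.u v s y)

/-- The derivative `y ↦ p̂_r(x-y) Dg(u(s,y)) Ψ'(s,y)` of the integrand with respect to `X(s)`. -/
def integrand' (D : Data n) (g : Vec n → Mat n) (v : ℝ → ℝ → Vec n) (r s x y : ℝ) :
    Vec n →L[ℝ] Mat n :=
  heatKernel r (x - y) • (fderiv ℝ g (D.u v s y)).comp (D.Ψ' s y)

/-- `∫₀¹ p̂_r(x-y) g(u(s,y)) d_yΨ(s,y)`, a rough integral with reference rough path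
`(X(s), 𝐗(s))`. -/
def roughTerm (D : Data n) (g : Vec n → Mat n) (v : ℝ → ℝ → Vec n) (r s x : ℝ) : Vec n :=
  roughIntegral (D.XX s) (D.integrand g v r s x) (D.integrand' g v r s x) (D.Ψ s) (D.Ψ' s)

/-- The fixed point map. -/
def G (D : Data n) (g : Vec n → Mat n) (v : ℝ → ℝ → Vec n) (t x : ℝ) : Vec n :=
  (∫ s in (0 : ℝ)..t, heatSemigroup (t - s) (D.drift g v s) x) +
    ∫ s in (0 : ℝ)..t, D.roughTerm g v (t - s) s x

/-- All integrals in the definition of `G(v)` on `[0,T] × [0,1]` exist: the spatial Lebesgue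
integrals, the rough integrals (as limits of Riemann sums), and the two integrals in time. -/
structure WellDefined (D : Data n) (g : Vec n → Mat n) (T : ℝ) (v : ℝ → ℝ → Vec n) : Prop where
  diff : ∀ s ∈ Ioc (0 : ℝ) T, ContDiffOn ℝ 1 (D.U s) (Icc (0 : ℝ) 1)
  drift_integrable : ∀ t ∈ Icc (0 : ℝ) T, ∀ x ∈ Icc (0 : ℝ) 1, ∀ s ∈ Ioo (0 : ℝ) t,
    IntervalIntegrable (fun y => heatKernel (t - s) (x - y) • D.drift g v s y) volume 0 1
  rough_converges : ∀ t ∈ Icc (0 : ℝ) T, ∀ x ∈ Icc (0 : ℝ) 1, ∀ s ∈ Ioo (0 : ℝ) t,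
    ∃ I, IsRoughIntegral (D.XX s) (D.integrand g v (t - s) s x) (D.integrand' g v (t - s) s x)
      (D.Ψ s) (D.Ψ' s) I
  time_drift : ∀ t ∈ Icc (0 : ℝ) T, ∀ x ∈ Icc (0 : ℝ) 1,
    IntervalIntegrable (fun s => heatSemigroup (t - s) (D.drift g v s) x) volume 0 t
  time_rough : ∀ t ∈ Icc (0 : ℝ) T, ∀ x ∈ Icc (0 : ℝ) 1,
    IntervalIntegrable (fun s => D.roughTerm g v (t - s) s x) volume 0 t

/-- `G(v) = v` on `[0,T] × [0,1]`. -/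
def IsFixed (D : Data n) (g : Vec n → Mat n) (T : ℝ) (v : ℝ → ℝ → Vec n) : Prop :=
  ∀ t ∈ Icc (0 : ℝ) T, ∀ x ∈ Icc (0 : ℝ) 1, D.G g v t x = v t x

end Data

end

end RoughBurgers

open RoughBurgers

/-! For small T the map is a small perturbation of zero. Both of its terms are time convolutions ∫₀ᵗ
q(t-s, s, x) ds, where q(r, s, ·) is a source at time s smoothed by the heat flow for a time r. If q
is of size r^{(p-1)/2} s^{-σ} with σ < p/2, then the convolution is small in C¹, of order T^κ with κ
= p/2 - σ, and it is 1/2-Hölder in time (`Source.duhamelBounds`). For the drift p = 1-α and σ =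
(1-β)/2, the latter because of the blow-up of ∂ₓU(s) for a β-Hölder initial value. For the rough
term p = α and σ = (2α-β)/2. In both cases κ = (β-α)/2 > 0.

The rough term rests on keeping the heat kernel out of the rough integration. The germ g(u) δΨ +
Dg(u)Ψ' 𝐗 Ψ'ᵀ has a defect of order 3α > 1, by Chen's relation and the expansions of Ψ and g(u) in X
(`Slice.germ_defect`). Sewing it yields J(y) = ∫₀^y g(u) dΨ, an α-Hölder function. The kernel is
smooth in y for r > 0, so the kernel-weighted Riemann sums converge to the Stieltjes integral of the
kernel against J (`riemann_stieltjes`), which equals ∂ₓS(r)[J - y J(1)] + J(1) (`heat_stieltjes`)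
and is of size r^{(α-1)/2}. The regular part U + v of u enters the remainder of g(u) through its
2α-Hölder constant, which for U(s) is of order s^{-(2α-β)/2}. The defect is affine in this constant,
so the singularity in s stays integrable.

Bounds, contraction and stability are one estimate. `Near δ A a b` says that a and b are bounded by
A and differ by at most Aδ, and this relation passes through all multilinear and Taylor expressions
involved. `Data.Setup` runs the argument for two data sets and two arguments v, w whose distances
are at most δ: the difference of the images is then at most Cδ T^κ (`Data.Setup.bounds_sub`). Equal
data give the contraction. For two fixed points, taking δ as the maximum of the data distance and
‖v-w‖ and absorbing gives Lipschitz dependence. The fixed point is the limit of Picard iterates, and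
the bounds on time convolutions survive this limit. -/

namespace RoughBurgers

noncomputable section

open ProbabilityTheory

set_option linter.unusedSectionVars false
set_option maxSynthPendingDepth 3

/-! ### The heat flow on bounded measurable functions of the line -/

section Heat

variable {E : Type*} [NormedAddCommGroup E] [NormedSpace ℝ E]

/-- A strongly measurable function bounded by `B`. -/
structure BddMeas (B : ℝ) (F : ℝ → E) : Prop where
  meas : StronglyMeasurable F
  bound : ∀ x, ‖F x‖ ≤ B

/-- Heat flow on the line. -/
def heat (r : ℝ) (F : ℝ → E) (x : ℝ) : E :=
  ∫ z, F (x + √(2 * r) * z) ∂(gaussianReal 0 1)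

/-- Spatial derivative of the heat flow on the line. -/
def heatD (r : ℝ) (F : ℝ → E) (x : ℝ) : E :=
  (√(2 * r))⁻¹ • ∫ z, z • F (x + √(2 * r) * z) ∂(gaussianReal 0 1)

/-- Derivative of the Gaussian heat kernel. -/
def gaussKernelD (t x : ℝ) : ℝ := -(x / (2 * t)) * gaussKernel t x

lemma gaussKernel_nonneg (t x : ℝ) : 0 ≤ gaussKernel t x := by
  unfold gaussKernel; positivity

lemma hasDerivAt_gaussKernel {t : ℝ} (ht : 0 < t) (x : ℝ) :
    HasDerivAt (gaussKernel t) (gaussKernelD t x) x := by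
  unfold gaussKernelD
  have h : HasDerivAt (fun x : ℝ => -x ^ 2 / (4 * t)) (-(x / (2 * t))) x := by
    have := ((hasDerivAt_pow 2 x).neg).div_const (4 * t)
    refine this.congr_deriv ?_
    push_cast
    field_simp
    ring
  have := (h.exp).const_mul (√(4 * Real.pi * t))⁻¹
  unfold gaussKernel
  refine this.congr_deriv ?_
  ring

lemma continuous_gaussKernel {t : ℝ} (ht : 0 < t) : Continuous (gaussKernel t) :=
  continuous_iff_continuousAt.2 fun x => (hasDerivAt_gaussKernel ht x).continuousAt

lemma continuous_gaussKernelD {t : ℝ} (ht : 0 < t) : Continuous (gaussKernelD t) := by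
  have := continuous_gaussKernel ht
  unfold gaussKernelD; fun_prop

lemma sqrt_mul_gaussKernel {r : ℝ} (hr : 0 < r) (z : ℝ) :
    √(2 * r) * gaussKernel r (-(√(2 * r) * z)) = gaussianPDFReal 0 1 z := by
  have h2 : √(2 * r) ≠ 0 := by positivity
  have e1 : √(4 * Real.pi * r) = √(2 * r) * √(2 * Real.pi * 1) := by
    rw [← Real.sqrt_mul (by positivity)]; congr 1; ring
  have e2 : -(-(√(2 * r) * z)) ^ 2 / (4 * r) = -(z - 0) ^ 2 / (2 * 1) := by
    rw [neg_sq, mul_pow, Real.sq_sqrt (by positivity)]; field_simp; ring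
  simp only [gaussKernel, gaussianPDFReal, NNReal.coe_one]
  rw [e1, e2, mul_inv, ← mul_assoc, ← mul_assoc, mul_inv_cancel₀ h2, one_mul]

lemma integral_eq_integral_scaled {r : ℝ} (hr : 0 < r) (G : ℝ → E) (x : ℝ) :
    ∫ y, G y = ∫ z, √(2 * r) • G (x + √(2 * r) * z) := by
  have h2 : 0 < √(2 * r) := by positivity
  rw [integral_smul, Measure.integral_comp_mul_left (fun y => G (x + y)),
    integral_add_left_eq_self, smul_smul, abs_of_pos (inv_pos.2 h2), mul_inv_cancel₀ h2.ne',
    one_smul]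

lemma heat_eq_kernel {r : ℝ} (hr : 0 < r) (F : ℝ → E) (x : ℝ) :
    heat r F x = ∫ y, gaussKernel r (x - y) • F y := by
  rw [heat, integral_gaussianReal_eq_integral_smul one_ne_zero,
    integral_eq_integral_scaled hr (fun y => gaussKernel r (x - y) • F y) x]
  refine integral_congr_ae (Eventually.of_forall fun z => ?_)
  simp only
  rw [← sqrt_mul_gaussKernel hr, smul_smul, sub_add_cancel_left]

lemma heatD_eq_kernel {r : ℝ} (hr : 0 < r) (F : ℝ → E) (x : ℝ) :
    heatD r F x = ∫ y, gaussKernelD r (x - y) • F y := by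
  have h2 : √(2 * r) ≠ 0 := by positivity
  rw [heatD, integral_gaussianReal_eq_integral_smul one_ne_zero,
    integral_eq_integral_scaled hr (fun y => gaussKernelD r (x - y) • F y) x, ← integral_smul]
  refine integral_congr_ae (Eventually.of_forall fun z => ?_)
  simp only
  rw [← sqrt_mul_gaussKernel hr, smul_smul, smul_smul, smul_smul, sub_add_cancel_left, gaussKernelD]
  congr 1
  have h3 : √(2 * r) * √(2 * r) = 2 * r := Real.mul_self_sqrt (by positivity)
  have h4 : 2 * r ≠ 0 := by positivity
  rw [neg_div, neg_neg]
  field_simp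
  rw [sq (√(2 * r)), h3]

lemma integrable_linear_mul_gauss {b : ℝ} (hb : 0 < b) (x : ℝ) :
    Integrable (fun y : ℝ => (|y - x| + 1) * Real.exp (-b * (y - x) ^ 2)) := by
  have h : Integrable (fun y : ℝ => (|y| + 1) * Real.exp (-b * y ^ 2)) := by
    have h1 := (integrable_mul_exp_neg_mul_sq hb).norm
    have h2 := integrable_exp_neg_mul_sq hb
    refine (h1.add h2).congr (Eventually.of_forall fun y => ?_)
    simp [add_mul]
  exact h.comp_sub_right x

/-- Since (w+d)² - w²/2 + d² = (w+2d)²/2 ≥ 0, a bounded shift only costs a constant and half of the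
exponent. One Gaussian thus dominates the kernel on a whole unit ball of base points, as needed for
differentiation under the integral and for locally uniform convergence of the periodized series. -/
lemma gaussKernel_shift_le {r : ℝ} (hr : 0 < r) {d w : ℝ} (hd : |d| ≤ 1) :
    gaussKernel r (w + d) ≤
      (√(4 * Real.pi * r))⁻¹ * Real.exp (1 / (4 * r)) * Real.exp (-(1 / (8 * r)) * w ^ 2) := by
  unfold gaussKernel
  rw [mul_assoc _ (Real.exp _) (Real.exp _), ← Real.exp_add]
  gcongr
  have hd2 : d ^ 2 ≤ 1 := by
    rw [← sq_abs]; exact pow_le_one₀ (abs_nonneg _) hd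
  rw [div_le_iff₀ (by positivity)]
  have : (1 / (4 * r) + -(1 / (8 * r)) * w ^ 2) * (4 * r) = 1 - w ^ 2 / 2 := by
    field_simp; ring
  rw [this]
  nlinarith [sq_nonneg (w + 2 * d)]

lemma norm_gaussKernelD_shift_le {r : ℝ} (hr : 0 < r) {d w : ℝ} (hd : |d| ≤ 1) :
    ‖gaussKernelD r (w + d)‖ ≤ (√(4 * Real.pi * r))⁻¹ * Real.exp (1 / (4 * r)) / (2 * r) *
        ((|w| + 1) * Real.exp (-(1 / (8 * r)) * w ^ 2)) := by
  unfold gaussKernelD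
  rw [norm_mul, Real.norm_of_nonneg (gaussKernel_nonneg _ _), norm_neg, norm_div, Real.norm_eq_abs,
    Real.norm_of_nonneg (by positivity : 0 ≤ 2 * r)]
  have h1 : |w + d| ≤ |w| + 1 := (abs_add_le _ _).trans (by linarith)
  calc |w + d| / (2 * r) * gaussKernel r (w + d) ≤ (|w| + 1) / (2 * r) *
      ((√(4 * Real.pi * r))⁻¹ * Real.exp (1 / (4 * r)) * Real.exp (-(1 / (8 * r)) * w ^ 2)) := by
        gcongr
        · exact gaussKernel_nonneg _ _
        · exact gaussKernel_shift_le hr hd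
    _ = _ := by ring

lemma BddMeas.nonneg {B : ℝ} {F : ℝ → E} (h : BddMeas B F) : 0 ≤ B :=
  (norm_nonneg _).trans (h.bound 0)

lemma integrable_gaussKernel {r : ℝ} (hr : 0 < r) (x : ℝ) :
    Integrable (fun y => gaussKernel r (x - y)) := by
  refine Integrable.mono' ((integrable_linear_mul_gauss (b := 1 / (8 * r)) (by positivity) x).const_mul
    ((√(4 * Real.pi * r))⁻¹ * Real.exp (1 / (4 * r))))
    ((continuous_gaussKernel hr).comp (by fun_prop)).aestronglyMeasurable
    (Eventually.of_forall fun y => ?_)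
  have := gaussKernel_shift_le hr (d := 0) (w := x - y) (by simp)
  rw [add_zero] at this
  rw [Real.norm_of_nonneg (gaussKernel_nonneg _ _)]
  refine this.trans ?_
  rw [← sub_sq_comm y x]
  have h1 : 1 ≤ |y - x| + 1 := by linarith [abs_nonneg (y - x)]
  have h2 := Real.exp_pos (-(1 / (8 * r)) * (y - x) ^ 2)
  gcongr
  nlinarith

lemma integrable_gaussKernelD {r : ℝ} (hr : 0 < r) (x : ℝ) :
    Integrable (fun y => gaussKernelD r (x - y)) := by
  refine Integrable.mono' ((integrable_linear_mul_gauss (b := 1 / (8 * r)) (by positivity) x).const_mul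
    ((√(4 * Real.pi * r))⁻¹ * Real.exp (1 / (4 * r)) / (2 * r)))
    ((continuous_gaussKernelD hr).comp (by fun_prop)).aestronglyMeasurable
    (Eventually.of_forall fun y => ?_)
  have := norm_gaussKernelD_shift_le hr (d := 0) (w := x - y) (by simp)
  rwa [add_zero, abs_sub_comm, ← sub_sq_comm y x] at this

/-- The derivative falls on the kernel, so boundedness and measurability of `F` suffice. Continuity
is not available in general: the periodic extension of the drift may jump at the integers. -/
lemma hasDerivAt_heat {r B : ℝ} (hr : 0 < r) {F : ℝ → E} (hF : BddMeas B F) (x : ℝ) :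
    HasDerivAt (heat r F) (heatD r F x) x := by
  have hB := hF.nonneg
  rw [heatD_eq_kernel hr]
  have e : heat r F = fun x => ∫ y, gaussKernel r (x - y) • F y := funext (heat_eq_kernel hr F)
  rw [e]
  refine (hasDerivAt_integral_of_dominated_loc_of_deriv_le (μ := volume) (x₀ := x)
    (F := fun x y => gaussKernel r (x - y) • F y) (F' := fun x y => gaussKernelD r (x - y) • F y)
    (s := Metric.ball x 1) (bound := fun y => (√(4 * Real.pi * r))⁻¹ * Real.exp (1 / (4 * r)) / (2 * r) *
        ((|y - x| + 1) * Real.exp (-(1 / (8 * r)) * (y - x) ^ 2)) * B)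
    (Metric.ball_mem_nhds _ one_pos) ?_ ?_ ?_ ?_ ?_ ?_).2
  · refine Eventually.of_forall fun x => AEStronglyMeasurable.smul ?_ hF.meas.aestronglyMeasurable
    exact ((continuous_gaussKernel hr).comp (by fun_prop)).aestronglyMeasurable
  · exact (integrable_gaussKernel hr x).smul_bdd B hF.meas.aestronglyMeasurable
      (Eventually.of_forall hF.bound)
  · refine AEStronglyMeasurable.smul ?_ hF.meas.aestronglyMeasurable
    exact ((continuous_gaussKernelD hr).comp (by fun_prop)).aestronglyMeasurable
  · refine Eventually.of_forall fun y x' hx' => ?_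
    rw [norm_smul]
    gcongr
    · have := norm_gaussKernelD_shift_le hr (d := x' - x) (w := x - y)
        (by rw [Metric.mem_ball, Real.dist_eq] at hx'; exact hx'.le)
      rwa [abs_sub_comm, ← sub_sq_comm y x, add_comm, sub_add_sub_cancel] at this
    · exact hF.bound y
  · exact ((integrable_linear_mul_gauss (by positivity) x).const_mul _).mul_const _
  · refine Eventually.of_forall fun y x' _ => ?_
    have := (hasDerivAt_gaussKernel hr (x' - y)).comp x' ((hasDerivAt_id x').sub_const y)
    rw [mul_one] at this
    exact this.smul_const (F y)

lemma stronglyMeasurable_shift {F : ℝ → E} (hF : StronglyMeasurable F) (x a : ℝ) :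
    StronglyMeasurable fun z => F (x + a * z) :=
  hF.comp_measurable (by fun_prop)

lemma BddMeas.integrable {B : ℝ} {F : ℝ → E} (h : BddMeas B F) (x a : ℝ) :
    Integrable (fun z => F (x + a * z)) (gaussianReal 0 1) :=
  Integrable.of_bound (stronglyMeasurable_shift h.meas x a).aestronglyMeasurable B
    (Eventually.of_forall fun _ => h.bound _)

lemma integrable_id_gauss : Integrable (fun z : ℝ => z) (gaussianReal 0 1) := by
  exact (memLp_id_gaussianReal (μ := 0) (v := 1) 1).integrable (by simp)

lemma integrable_sq_gauss : Integrable (fun z : ℝ => z ^ 2) (gaussianReal 0 1) := by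
  simpa using (memLp_id_gaussianReal (μ := 0) (v := 1) 2).integrable_sq

lemma integral_sq_gauss : ∫ z : ℝ, z ^ 2 ∂(gaussianReal 0 1) = 1 := by
  have h := variance_id_gaussianReal (μ := 0) (v := 1)
  rw [variance_eq_sub (memLp_id_gaussianReal (μ := 0) (v := 1) 2)] at h
  simpa using h

lemma integrable_one_add_sq_gauss : Integrable (fun z : ℝ => 1 + z ^ 2) (gaussianReal 0 1) :=
  (integrable_const 1).add integrable_sq_gauss

lemma integral_one_add_sq_gauss : ∫ z : ℝ, 1 + z ^ 2 ∂(gaussianReal 0 1) = 2 := by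
  rw [integral_add (integrable_const 1) integrable_sq_gauss, integral_sq_gauss]
  simp; norm_num

lemma integral_abs_gauss_le : ∫ z : ℝ, |z| ∂(gaussianReal 0 1) ≤ 1 := by
  have h1 : ∫ z : ℝ, |z| ∂(gaussianReal 0 1) ≤ ∫ z : ℝ, (1 + z ^ 2) / 2 ∂(gaussianReal 0 1) := by
    refine integral_mono integrable_id_gauss.abs (integrable_one_add_sq_gauss.div_const 2) fun z => ?_
    simp only
    nlinarith [sq_nonneg (|z| - 1), sq_abs z]
  rw [integral_div, integral_one_add_sq_gauss] at h1
  linarith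

lemma BddMeas.integrable_smul {B : ℝ} {F : ℝ → E} (h : BddMeas B F) (x a : ℝ) :
    Integrable (fun z : ℝ => z • F (x + a * z)) (gaussianReal 0 1) :=
  integrable_id_gauss.smul_bdd B (stronglyMeasurable_shift h.meas x a).aestronglyMeasurable
    (Eventually.of_forall fun _ => h.bound _)

lemma norm_heat_le {B : ℝ} {F : ℝ → E} (hF : ∀ x, ‖F x‖ ≤ B) (r x : ℝ) :
    ‖heat r F x‖ ≤ B := by
  have := norm_integral_le_of_norm_le_const (μ := gaussianReal 0 1)
    (f := fun z => F (x + √(2 * r) * z)) (C := B) (Eventually.of_forall fun z => hF _)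
  rwa [probReal_univ, mul_one] at this

lemma sqrt_two_mul_rpow {r : ℝ} (hr : 0 ≤ r) (p : ℝ) :
    (√(2 * r)) ^ p = 2 ^ (p / 2) * r ^ (p / 2) := by
  rw [Real.sqrt_eq_rpow, ← Real.rpow_mul (by positivity), Real.mul_rpow (by norm_num) hr]
  congr 2 <;> ring

lemma norm_heatD_le {r B : ℝ} (hr : 0 < r) {F : ℝ → E} (hF : ∀ x, ‖F x‖ ≤ B) (x : ℝ) :
    ‖heatD r F x‖ ≤ B * r ^ (-(1 / 2) : ℝ) := by
  have hB : 0 ≤ B := (norm_nonneg _).trans (hF 0)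
  have h1 : ‖∫ z, z • F (x + √(2 * r) * z) ∂(gaussianReal 0 1)‖ ≤ B := by
    calc _ ≤ ∫ z, |z| * B ∂(gaussianReal 0 1) := by
          refine norm_integral_le_of_norm_le (integrable_id_gauss.abs.mul_const B)
            (Eventually.of_forall fun z => ?_)
          rw [norm_smul, Real.norm_eq_abs]
          gcongr; exact hF _
      _ ≤ 1 * B := by rw [integral_mul_const]; gcongr; exact integral_abs_gauss_le
      _ = B := one_mul B
  rw [heatD, norm_smul, norm_inv, Real.norm_of_nonneg (Real.sqrt_nonneg _), ← Real.rpow_neg_one,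
    sqrt_two_mul_rpow hr.le, mul_comm B]
  have h2 : (2 : ℝ) ^ (-1 / 2 : ℝ) ≤ 1 := Real.rpow_le_one_of_one_le_of_nonpos (by norm_num) (by norm_num)
  have h3 : (-1 / 2 : ℝ) = -(1 / 2) := by norm_num
  rw [h3] at h2 ⊢
  gcongr
  · exact mul_le_of_le_one_left (by positivity) h2

/-- The Gaussian weight z has mean zero, so the constant F(x) can be subtracted. The increment
contributes (√(2r)|z|)^p, which improves r^{-1/2} to r^{(p-1)/2}. The moment is controlled by
|z|^{1+p} ≤ 1 + z², whose expectation is 2. -/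
lemma norm_heatD_le_of_holder [CompleteSpace E] {r B A p : ℝ} (hr : 0 < r) (hp : 0 ≤ p) (hp1 : p ≤ 1) {F : ℝ → E}
    (hF : BddMeas B F) (hH : ∀ x y, ‖F x - F y‖ ≤ A * |x - y| ^ p) (x : ℝ) :
    ‖heatD r F x‖ ≤ 2 * A * r ^ ((p - 1) / 2) := by
  have hA : 0 ≤ A := by simpa using (norm_nonneg _).trans (hH 1 0)
  have hs : 0 < √(2 * r) := by positivity
  have e : ∫ z, z • F (x + √(2 * r) * z) ∂(gaussianReal 0 1) =
      ∫ z, z • (F (x + √(2 * r) * z) - F x) ∂(gaussianReal 0 1) := by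
    simp_rw [smul_sub]
    rw [integral_sub (hF.integrable_smul x _) (integrable_id_gauss.smul_const _),
      integral_smul_const, integral_id_gaussianReal, zero_smul, sub_zero]
  have h1 : ‖∫ z, z • F (x + √(2 * r) * z) ∂(gaussianReal 0 1)‖ ≤ A * √(2 * r) ^ p * 2 := by
    rw [e]
    refine le_of_le_of_eq ?_ (congrArg (A * √(2 * r) ^ p * ·) integral_one_add_sq_gauss)
    rw [← integral_const_mul]
    refine norm_integral_le_of_norm_le (integrable_one_add_sq_gauss.const_mul _)
      (Eventually.of_forall fun z => ?_)
    rw [norm_smul, Real.norm_eq_abs]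
    have h2 := hH (x + √(2 * r) * z) x
    rw [add_sub_cancel_left, abs_mul, abs_of_pos hs, Real.mul_rpow hs.le (abs_nonneg _)] at h2
    have h3 : |z| * |z| ^ p ≤ 1 + z ^ 2 := by
      rcases le_total |z| 1 with h | h
      · have : |z| ^ p ≤ 1 := Real.rpow_le_one (abs_nonneg _) h hp
        nlinarith [abs_nonneg z, sq_nonneg z]
      · have : |z| ^ p ≤ |z| := by
          simpa using Real.rpow_le_rpow_of_exponent_le h hp1
        nlinarith [abs_nonneg z, sq_abs z]
    calc |z| * ‖F (x + √(2 * r) * z) - F x‖ ≤ |z| * (A * (√(2 * r) ^ p * |z| ^ p)) := by gcongr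
      _ = A * √(2 * r) ^ p * (|z| * |z| ^ p) := by ring
      _ ≤ _ := by gcongr
  rw [heatD, norm_smul, norm_inv, Real.norm_of_nonneg (Real.sqrt_nonneg _)]
  calc (√(2 * r))⁻¹ * ‖∫ z, z • F (x + √(2 * r) * z) ∂(gaussianReal 0 1)‖
      ≤ (√(2 * r))⁻¹ * (A * √(2 * r) ^ p * 2) := by gcongr
    _ = 2 * A * √(2 * r) ^ (p - 1) := by rw [Real.rpow_sub_one hs.ne']; ring
    _ ≤ 2 * A * r ^ ((p - 1) / 2) := by
      rw [sqrt_two_mul_rpow hr.le]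
      have h2 : (2 : ℝ) ^ ((p - 1) / 2) ≤ 1 :=
        Real.rpow_le_one_of_one_le_of_nonpos (by norm_num) (by linarith)
      gcongr
      exact mul_le_of_le_one_left (by positivity) h2

lemma heat_sub {B B' : ℝ} {F G : ℝ → E} (hF : BddMeas B F) (hG : BddMeas B' G) (r x : ℝ) :
    heat r (fun x => F x - G x) x = heat r F x - heat r G x :=
  integral_sub (hF.integrable x _) (hG.integrable x _)

lemma heatD_sub {B B' : ℝ} {F G : ℝ → E} (hF : BddMeas B F) (hG : BddMeas B' G) (r x : ℝ) :
    heatD r (fun x => F x - G x) x = heatD r F x - heatD r G x := by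
  simp only [heatD, smul_sub]
  rw [integral_sub (hF.integrable_smul x _) (hG.integrable_smul x _), smul_sub]

lemma heat_add_const [CompleteSpace E] {B : ℝ} {F : ℝ → E} (hF : BddMeas B F) (c : E) (r x : ℝ) :
    heat r (fun x => F x + c) x = heat r F x + c := by
  simp only [heat]
  rw [integral_add (hF.integrable x _) (integrable_const c)]
  simp

lemma norm_heat_sub_le {B A p : ℝ} {F : ℝ → E} (hF : BddMeas B F)
    (hH : ∀ x y, ‖F x - F y‖ ≤ A * |x - y| ^ p) (r x y : ℝ) :
    ‖heat r F x - heat r F y‖ ≤ A * |x - y| ^ p := by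
  rw [heat, heat, ← integral_sub (hF.integrable x _) (hF.integrable y _)]
  have := norm_integral_le_of_norm_le_const (μ := gaussianReal 0 1)
    (f := fun z => F (x + √(2 * r) * z) - F (y + √(2 * r) * z)) (C := A * |x - y| ^ p)
    (Eventually.of_forall fun z => by simpa using hH (x + √(2 * r) * z) (y + √(2 * r) * z))
  simpa using this

/-- The left side is a Gaussian average of increments of `F` over distances √(2r)|z|. A spatial
modulus of exponent p therefore becomes a modulus of exponent p/2 in the heat time. -/
lemma norm_heat_sub_self_le [CompleteSpace E] {B A p : ℝ} (hp : 0 ≤ p) (hp1 : p ≤ 1) {F : ℝ → E}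
    (hF : BddMeas B F) (hH : ∀ x y, ‖F x - F y‖ ≤ A * |x - y| ^ p) {r : ℝ} (hr : 0 ≤ r) (x : ℝ) :
    ‖heat r F x - F x‖ ≤ 4 * A * r ^ (p / 2) := by
  have hA : 0 ≤ A := by simpa using (norm_nonneg _).trans (hH 1 0)
  have hs : 0 ≤ √(2 * r) := by positivity
  have e : heat r F x - F x = ∫ z, (F (x + √(2 * r) * z) - F x) ∂(gaussianReal 0 1) := by
    rw [integral_sub (hF.integrable x _) (integrable_const _)]
    simp [heat]
  have h1 : ‖heat r F x - F x‖ ≤ A * √(2 * r) ^ p * 2 := by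
    rw [e]
    refine le_of_le_of_eq ?_ (congrArg (A * √(2 * r) ^ p * ·) integral_one_add_sq_gauss)
    rw [← integral_const_mul]
    refine norm_integral_le_of_norm_le (integrable_one_add_sq_gauss.const_mul _)
      (Eventually.of_forall fun z => ?_)
    have h2 := hH (x + √(2 * r) * z) x
    rw [add_sub_cancel_left, abs_mul, abs_of_nonneg hs, Real.mul_rpow hs (abs_nonneg _)] at h2
    have h3 : |z| ^ p ≤ 1 + z ^ 2 := by
      rcases le_total |z| 1 with h | h
      · have : |z| ^ p ≤ 1 := Real.rpow_le_one (abs_nonneg _) h hp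
        nlinarith [abs_nonneg z, sq_nonneg z]
      · have : |z| ^ p ≤ |z| := by
          simpa using Real.rpow_le_rpow_of_exponent_le h hp1
        nlinarith [abs_nonneg z, sq_abs z]
    calc _ ≤ A * (√(2 * r) ^ p * |z| ^ p) := h2
      _ = A * √(2 * r) ^ p * |z| ^ p := by ring
      _ ≤ _ := by gcongr
  refine h1.trans ?_
  rw [sqrt_two_mul_rpow hr]
  have h2 : (2 : ℝ) ^ (p / 2) ≤ 2 := by
    simpa using Real.rpow_le_rpow_of_exponent_le (x := 2) (by norm_num) (by linarith : p / 2 ≤ 1)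
  calc A * (2 ^ (p / 2) * r ^ (p / 2)) * 2 ≤ A * (2 * r ^ (p / 2)) * 2 := by gcongr
    _ = _ := by ring

/-! ### Joint measurability of the heat flow in source, time and space. -/

section Measurability

variable {β : Type*} [MeasurableSpace β]

lemma stronglyMeasurable_heat {f : β → ℝ → E} (hf : StronglyMeasurable (Function.uncurry f))
    {r x : β → ℝ} (hr : Measurable r) (hx : Measurable x) :
    StronglyMeasurable fun b => heat (r b) (f b) (x b) := by
  have : StronglyMeasurable (Function.uncurry fun (b : β) (z : ℝ) => f b (x b + √(2 * r b) * z)) :=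
    hf.comp_measurable (g := fun q : β × ℝ => (q.1, x q.1 + √(2 * r q.1) * q.2)) (by fun_prop)
  exact this.integral_prod_right

lemma stronglyMeasurable_heatD {f : β → ℝ → E} (hf : StronglyMeasurable (Function.uncurry f))
    {r x : β → ℝ} (hr : Measurable r) (hx : Measurable x) :
    StronglyMeasurable fun b => heatD (r b) (f b) (x b) := by
  have : StronglyMeasurable
      (Function.uncurry fun (b : β) (z : ℝ) => z • f b (x b + √(2 * r b) * z)) := by
    refine StronglyMeasurable.smul (f := fun q : β × ℝ => q.2)
      (g := fun q : β × ℝ => f q.1 (x q.1 + √(2 * r q.1) * q.2))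
      measurable_snd.stronglyMeasurable ?_
    exact hf.comp_measurable (g := fun q : β × ℝ => (q.1, x q.1 + √(2 * r q.1) * q.2)) (by fun_prop)
  refine StronglyMeasurable.smul (f := fun b => (√(2 * r b))⁻¹) ?_ this.integral_prod_right
  exact Measurable.stronglyMeasurable (by fun_prop)

end Measurability

lemma BddMeas.uncurry {B : ℝ} {F : ℝ → E} (hF : BddMeas B F) :
    StronglyMeasurable (Function.uncurry fun _ : ℝ => F) :=
  hF.meas.comp_measurable measurable_snd

lemma BddMeas.heat {B : ℝ} {F : ℝ → E} (hF : BddMeas B F) (r : ℝ) : BddMeas B (heat r F) :=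
  ⟨stronglyMeasurable_heat hF.uncurry measurable_const measurable_id, norm_heat_le hF.bound r⟩

lemma BddMeas.heatD {r B : ℝ} (hr : 0 < r) {F : ℝ → E} (hF : BddMeas B F) :
    BddMeas (B * r ^ (-(1 / 2) : ℝ)) (heatD r F) :=
  ⟨stronglyMeasurable_heatD hF.uncurry measurable_const measurable_id, norm_heatD_le hr hF.bound⟩

lemma heat_eq_gaussianReal {r B : ℝ} (hr : 0 ≤ r) {F : ℝ → E} (hF : BddMeas B F) (x : ℝ) :
    heat r F x = ∫ y, F (x + y) ∂(gaussianReal 0 (2 * r).toNNReal) := by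
  have h := gaussianReal_map_const_mul (μ := 0) (v := 1) (√(2 * r))
  have e : NNReal.mk (√(2 * r) ^ 2) (sq_nonneg _) * 1 = (2 * r).toNNReal := by
    ext
    rw [mul_one, Real.coe_toNNReal _ (by positivity)]
    exact Real.sq_sqrt (by positivity)
  rw [mul_zero, e] at h
  have hm : StronglyMeasurable fun y => F (x + y) := hF.meas.comp_measurable (by fun_prop)
  rw [← h, integral_map (by fun_prop) hm.aestronglyMeasurable]
  rfl

/-- Variances add under convolution of centred Gaussians. -/
lemma heat_heat {r h B : ℝ} (hr : 0 ≤ r) (hh : 0 ≤ h) {F : ℝ → E} (hF : BddMeas B F) (x : ℝ) :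
    heat h (heat r F) x = heat (r + h) F x := by
  have hm : StronglyMeasurable fun y => F (x + y) := hF.meas.comp_measurable (by fun_prop)
  rw [heat_eq_gaussianReal (add_nonneg hr hh) hF, heat_eq_gaussianReal hh (hF.heat r),
    mul_add, Real.toNNReal_add (by positivity) (by positivity), add_comm (2 * r).toNNReal]
  have := gaussianReal_conv_gaussianReal (m₁ := 0) (m₂ := 0) (v₁ := (2 * h).toNNReal)
    (v₂ := (2 * r).toNNReal)
  rw [add_zero] at this
  rw [← this, integral_conv (Integrable.of_bound hm.aestronglyMeasurable B
    (Eventually.of_forall fun _ => hF.bound _))]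
  refine integral_congr_ae (Eventually.of_forall fun y => ?_)
  simp only
  rw [heat_eq_gaussianReal hr hF]
  simp [add_assoc]

lemma hasDerivAt_heat_of_deriv {r B B' : ℝ} {F F' : ℝ → E} (hF : BddMeas B F)
    (hF' : BddMeas B' F') (hd : ∀ x, HasDerivAt F (F' x) x) (x : ℝ) :
    HasDerivAt (heat r F) (heat r F' x) x := by
  refine (hasDerivAt_integral_of_dominated_loc_of_deriv_le (μ := gaussianReal 0 1) (x₀ := x)
    (F := fun x z => F (x + √(2 * r) * z)) (F' := fun x z => F' (x + √(2 * r) * z))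
    (s := univ) (bound := fun _ => B') univ_mem ?_ (hF.integrable x _) ?_ ?_
    (integrable_const _) ?_).2
  · exact Eventually.of_forall fun x => (stronglyMeasurable_shift hF.meas x _).aestronglyMeasurable
  · exact (stronglyMeasurable_shift hF'.meas x _).aestronglyMeasurable
  · exact Eventually.of_forall fun z x _ => hF'.bound _
  · exact Eventually.of_forall fun z x _ => (hd _).comp_add_const _ _

/-- Both sides are the derivative at x of `heat (r + h) F`: the left one by differentiating the
outer average of a smooth function, the right one by differentiating the kernel. -/
lemma heat_heatD {r h B : ℝ} (hr : 0 < r) (hh : 0 < h) {F : ℝ → E} (hF : BddMeas B F) (x : ℝ) :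
    heat h (heatD r F) x = heatD (r + h) F x := by
  have h1 := hasDerivAt_heat_of_deriv (r := h) (hF.heat r) (hF.heatD hr)
    (fun x => hasDerivAt_heat hr hF x) x
  rw [funext (heat_heat hr.le hh.le hF)] at h1
  exact h1.unique (hasDerivAt_heat (add_pos hr hh) hF x)

end Heat

/-! ### Time convolution of smoothed sources -/

section Duhamel

variable {E : Type*} [NormedAddCommGroup E] [NormedSpace ℝ E]

/-- On each half of (0,t) one of the two factors is at most its value at t/2, so the product is
dominated by a sum of two integrable powers. This avoids the Beta function and gives an explicit
constant with the right scaling in t. -/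
lemma integrable_beta {a b : ℝ} (ha : -1 < a) (hb : -1 < b) (ha0 : a ≤ 0) (hb0 : b ≤ 0) {t : ℝ}
    (ht : 0 < t) :
    IntegrableOn (fun s => (t - s) ^ a * s ^ b) (Ioo 0 t) ∧
      ∫ s in Ioo 0 t, (t - s) ^ a * s ^ b ≤ (2 / (a + 1) + 2 / (b + 1)) * t ^ (a + b + 1) := by
  have i1 : IntervalIntegrable (fun s : ℝ => s ^ b) volume 0 t :=
    intervalIntegral.intervalIntegrable_rpow' hb
  have i2 : IntervalIntegrable (fun s : ℝ => (t - s) ^ a) volume 0 t := by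
    have := (intervalIntegral.intervalIntegrable_rpow' (a := 0) (b := t) ha).comp_sub_left t
    simpa using this.symm
  have v1 : ∫ s in (0 : ℝ)..t, s ^ b = t ^ (b + 1) / (b + 1) := by
    rw [integral_rpow (Or.inl hb), Real.zero_rpow (by linarith), sub_zero]
  have v2 : ∫ s in (0 : ℝ)..t, (t - s) ^ a = t ^ (a + 1) / (a + 1) := by
    rw [intervalIntegral.integral_comp_sub_left (fun s => s ^ a), sub_self, sub_zero,
      integral_rpow (Or.inl ha), Real.zero_rpow (by linarith), sub_zero]
  have i3 : IntervalIntegrable (fun s : ℝ => (t / 2) ^ a * s ^ b + (t / 2) ^ b * (t - s) ^ a)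
      volume 0 t := (i1.const_mul _).add (i2.const_mul _)
  have i3' : IntegrableOn (fun s : ℝ => (t / 2) ^ a * s ^ b + (t / 2) ^ b * (t - s) ^ a)
      (Ioo 0 t) := ((intervalIntegrable_iff_integrableOn_Ioo_of_le ht.le).1 i3)
  have hle : ∀ s ∈ Ioo 0 t, (t - s) ^ a * s ^ b ≤
      (t / 2) ^ a * s ^ b + (t / 2) ^ b * (t - s) ^ a := by
    intro s hs
    have h1 : 0 < s := hs.1
    have h2 : 0 < t - s := by linarith [hs.2]
    rcases le_total s (t / 2) with h | h
    · have : (t - s) ^ a ≤ (t / 2) ^ a :=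
        Real.rpow_le_rpow_of_nonpos (by positivity) (by linarith) ha0
      have h3 : 0 ≤ (t / 2) ^ b * (t - s) ^ a := by positivity
      have h4 := mul_le_mul_of_nonneg_right this (by positivity : 0 ≤ s ^ b)
      linarith
    · have : s ^ b ≤ (t / 2) ^ b :=
        Real.rpow_le_rpow_of_nonpos (by positivity) h hb0
      have h3 : 0 ≤ (t / 2) ^ a * s ^ b := by positivity
      have h4 := mul_le_mul_of_nonneg_left this (by positivity : 0 ≤ (t - s) ^ a)
      linarith
  have hint : IntegrableOn (fun s => (t - s) ^ a * s ^ b) (Ioo 0 t) := by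
    refine Integrable.mono' i3' (by fun_prop) ?_
    refine (ae_restrict_iff' measurableSet_Ioo).2 (Eventually.of_forall fun s hs => ?_)
    have h1 : 0 < s := hs.1
    have h2 : 0 < t - s := by linarith [hs.2]
    rw [Real.norm_of_nonneg (by positivity)]
    exact hle s hs
  refine ⟨hint, ?_⟩
  -- The powers of 1/2 left over from evaluation at t/2 are at most 2, because both exponents exceed
  -- -1.
  have h2 : ∀ c : ℝ, -1 < c → (2 : ℝ)⁻¹ ^ c ≤ 2 := fun c hc => by
    rw [Real.inv_rpow (by norm_num), ← Real.rpow_neg (by norm_num)]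
    simpa using Real.rpow_le_rpow_of_exponent_le (x := 2) (by norm_num) (by linarith : -c ≤ 1)
  calc ∫ s in Ioo 0 t, (t - s) ^ a * s ^ b
      ≤ ∫ s in Ioo 0 t, ((t / 2) ^ a * s ^ b + (t / 2) ^ b * (t - s) ^ a) :=
        setIntegral_mono_on hint i3' measurableSet_Ioo hle
    _ = (t / 2) ^ a * (t ^ (b + 1) / (b + 1)) + (t / 2) ^ b * (t ^ (a + 1) / (a + 1)) := by
        rw [← integral_Ioc_eq_integral_Ioo, ← intervalIntegral.integral_of_le ht.le,
          intervalIntegral.integral_add (i1.const_mul _) (i2.const_mul _),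
          intervalIntegral.integral_const_mul, intervalIntegral.integral_const_mul, v1, v2]
    _ = (2⁻¹ ^ b / (a + 1) + 2⁻¹ ^ a / (b + 1)) * t ^ (a + b + 1) := by
        rw [div_eq_mul_inv t 2, Real.mul_rpow ht.le (by norm_num), Real.mul_rpow ht.le (by norm_num),
          Real.rpow_add ht, Real.rpow_add ht, Real.rpow_add ht, Real.rpow_add ht]
        ring
    _ ≤ _ := by
        have := h2 a ha
        have := h2 b hb
        have : 0 < a + 1 := by linarith
        have : 0 < b + 1 := by linarith
        gcongr

/-- The constant of the Beta integral bounds. -/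
def betaConst (a b : ℝ) : ℝ := 2 / (a + 1) + 2 / (b + 1)

lemma betaConst_nonneg {a b : ℝ} (ha : -1 < a) (hb : -1 < b) : 0 ≤ betaConst a b := by
  have : 0 < a + 1 := by linarith
  have : 0 < b + 1 := by linarith
  unfold betaConst; positivity

/-- As b ≤ 0, the weight s^b only grows when s is replaced by s - t₀. A translation reduces the
claim to an interval starting at 0. General t₀ is needed for increments in time. -/
lemma integral_le_of_beta {a b C : ℝ} (ha : -1 < a) (hb : -1 < b) (ha0 : a ≤ 0) (hb0 : b ≤ 0)
    (hC : 0 ≤ C) {t₀ t₁ : ℝ} (h0 : 0 ≤ t₀) (h01 : t₀ ≤ t₁) {f : ℝ → E} (hf : StronglyMeasurable f)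
    (hb : ∀ s ∈ Ioo t₀ t₁, ‖f s‖ ≤ C * (t₁ - s) ^ a * s ^ b) :
    IntegrableOn f (Ioo t₀ t₁) ∧
      ‖∫ s in t₀..t₁, f s‖ ≤ C * betaConst a b * (t₁ - t₀) ^ (a + b + 1) := by
  rcases h01.eq_or_lt with rfl | h01
  · have := betaConst_nonneg ha ‹-1 < b›
    simp only [Ioo_self, integrableOn_empty, intervalIntegral.integral_same, norm_zero, true_and]
    positivity
  obtain ⟨i, v⟩ := integrable_beta ha ‹-1 < b› ha0 hb0 (sub_pos.2 h01)
  have hsh : MeasurePreserving (fun s : ℝ => s - t₀) (volume.restrict (Ioo t₀ t₁))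
      (volume.restrict (Ioo 0 (t₁ - t₀))) := by
    have := (measurePreserving_sub_right volume t₀).restrict_preimage
      (measurableSet_Ioo : MeasurableSet (Ioo (0 : ℝ) (t₁ - t₀)))
    rwa [preimage_sub_const_Ioo, zero_add, sub_add_cancel] at this
  have i' : IntegrableOn (fun s => (t₁ - s) ^ a * (s - t₀) ^ b) (Ioo t₀ t₁) := by
    refine (hsh.integrable_comp_of_integrable i).congr (Eventually.of_forall fun s => ?_)
    simp
  have v' : ∫ s in Ioo t₀ t₁, (t₁ - s) ^ a * (s - t₀) ^ b ≤
      betaConst a b * (t₁ - t₀) ^ (a + b + 1) := by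
    refine le_trans (le_of_eq ?_) v
    rw [← hsh.integral_comp' (f := MeasurableEquiv.subRight t₀)]
    refine integral_congr_ae (Eventually.of_forall fun s => ?_)
    have : MeasurableEquiv.subRight t₀ s = s - t₀ := rfl
    simp [this]
  have hle : ∀ᵐ s ∂(volume.restrict (Ioo t₀ t₁)),
      ‖f s‖ ≤ C * ((t₁ - s) ^ a * (s - t₀) ^ b) := by
    refine (ae_restrict_iff' measurableSet_Ioo).2 (Eventually.of_forall fun s hs => ?_)
    refine (hb s hs).trans ?_
    have h1 : 0 < s - t₀ := by linarith [hs.1]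
    have h2 : 0 < t₁ - s := by linarith [hs.2]
    have h3 : s ^ b ≤ (s - t₀) ^ b := Real.rpow_le_rpow_of_nonpos h1 (by linarith) hb0
    rw [mul_assoc]
    gcongr
  refine ⟨Integrable.mono' (i'.const_mul C) hf.aestronglyMeasurable hle, ?_⟩
  rw [intervalIntegral.integral_of_le h01.le, integral_Ioc_eq_integral_Ioo, mul_assoc]
  refine (norm_integral_le_of_norm_le (i'.const_mul C) hle).trans ?_
  rw [integral_const_mul]
  gcongr

/-- `q r s` is a source at time `s`, smoothed by the heat flow for a time `r`. -/
structure Source (T a b C : ℝ) (q : ℝ → ℝ → ℝ → E) : Prop where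
  meas : StronglyMeasurable fun z : ℝ × ℝ × ℝ => q z.1 z.2.1 z.2.2
  bound : ∀ r s x, 0 < r → r ≤ 1 → 0 < s → s < T → ‖q r s x‖ ≤ C * r ^ a * s ^ b
  semigroup : ∀ r h s x, 0 < r → 0 < h → r + h ≤ 1 → 0 < s → s < T →
    heat h (q r s) x = q (r + h) s x

/-- The time convolution of a smoothed source. -/
def duhamel (q : ℝ → ℝ → ℝ → E) (t x : ℝ) : E := ∫ s in (0 : ℝ)..t, q (t - s) s x

/-- The spatial derivative of a smoothed source. -/
def sourceD (q : ℝ → ℝ → ℝ → E) (r s x : ℝ) : E := heatD (r / 2) (q (r / 2) s) x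

namespace Source

variable {T a b C : ℝ} {q : ℝ → ℝ → ℝ → E}

lemma bddMeas (h : Source T a b C q) {r s : ℝ} (hr : 0 < r) (hr1 : r ≤ 1) (hs : 0 < s)
    (hsT : s < T) : BddMeas (C * r ^ a * s ^ b) (q r s) :=
  ⟨h.meas.comp_measurable (g := fun x => (r, s, x)) (by fun_prop),
    fun x => h.bound r s x hr hr1 hs hsT⟩

lemma hasDerivAt (h : Source T a b C q) {r s : ℝ} (hr : 0 < r) (hr1 : r ≤ 1) (hs : 0 < s)
    (hsT : s < T) (x : ℝ) : HasDerivAt (q r s) (sourceD q r s x) x := by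
  have h1 := hasDerivAt_heat (half_pos hr) (h.bddMeas (half_pos hr) (by linarith) hs hsT) x
  have e : heat (r / 2) (q (r / 2) s) = q r s := by
    funext y
    rw [h.semigroup _ _ _ _ (half_pos hr) (half_pos hr) (by linarith) hs hsT, add_halves]
  rwa [e] at h1

/-- The smoothing time is split in halves: the first bounds the source, the second pays r^{-1/2} for
the derivative. This leaves the factor 2^{1/2-a}, at most 4 when a ≥ -1. The semigroup property is
inherited by differentiating the one of `q`, so the lemma can be iterated. -/
lemma deriv_source (h : Source T a b C q) (hC : 0 ≤ C) (ha : -1 ≤ a) :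
    Source T (a - 1 / 2) b (4 * C) (sourceD q) := by
  have hb : ∀ r s x, 0 < r → r ≤ 1 → 0 < s → s < T →
      ‖sourceD q r s x‖ ≤ 4 * C * r ^ (a - 1 / 2) * s ^ b := by
    intro r s x hr hr1 hs hsT
    refine (norm_heatD_le (half_pos hr)
      (h.bddMeas (half_pos hr) (by linarith) hs hsT).bound x).trans ?_
    have e : (r / 2) ^ a * (r / 2) ^ (-(1 / 2) : ℝ) = r ^ (a - 1 / 2) * 2 ^ (1 / 2 - a) := by
      rw [← Real.rpow_add (half_pos hr), ← sub_eq_add_neg, Real.div_rpow hr.le (by norm_num),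
        div_eq_mul_inv, ← Real.rpow_neg (by norm_num), neg_sub]
    have h2 : (2 : ℝ) ^ (1 / 2 - a) ≤ 4 := by
      have := Real.rpow_le_rpow_of_exponent_le (x := 2) (by norm_num) (by linarith : 1 / 2 - a ≤ 2)
      norm_num at this ⊢
      exact this
    calc C * (r / 2) ^ a * s ^ b * (r / 2) ^ (-(1 / 2) : ℝ)
        = C * ((r / 2) ^ a * (r / 2) ^ (-(1 / 2) : ℝ)) * s ^ b := by ring
      _ = C * (r ^ (a - 1 / 2) * 2 ^ (1 / 2 - a)) * s ^ b := by rw [e]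
      _ ≤ C * (r ^ (a - 1 / 2) * 4) * s ^ b := by gcongr
      _ = _ := by ring
  have hm : StronglyMeasurable fun z : ℝ × ℝ × ℝ => sourceD q z.1 z.2.1 z.2.2 := by
    refine stronglyMeasurable_heatD (β := ℝ × ℝ × ℝ) (f := fun z => q (z.1 / 2) z.2.1) ?_
      (by fun_prop) (by fun_prop)
    exact h.meas.comp_measurable
      (g := fun w : (ℝ × ℝ × ℝ) × ℝ => (w.1.1 / 2, w.1.2.1, w.2)) (by fun_prop)
  refine ⟨hm, hb, ?_⟩
  intro r k s x hr hk hrk hs hsT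
  have h1 := hasDerivAt_heat_of_deriv (r := k) (h.bddMeas hr (by linarith) hs hsT)
    (F' := sourceD q r s) (B' := 4 * C * r ^ (a - 1 / 2) * s ^ b)
    ⟨hm.comp_measurable (g := fun x => (r, s, x)) (by fun_prop),
      fun x => hb r s x hr (by linarith) hs hsT⟩
    (fun x => h.hasDerivAt hr (by linarith) hs hsT x) x
  have e : heat k (q r s) = q (r + k) s := by
    funext y
    rw [h.semigroup _ _ _ _ hr hk hrk hs hsT]
  rw [e] at h1
  exact h1.unique (h.hasDerivAt (by linarith) hrk hs hsT x)

lemma meas_time (h : Source T a b C q) (t x : ℝ) : StronglyMeasurable fun s => q (t - s) s x :=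
  h.meas.comp_measurable (g := fun s => (t - s, s, x)) (by fun_prop)

lemma bound_time (h : Source T a b C q) (hT : T ≤ 1) {t₀ t : ℝ} (ht0 : 0 ≤ t₀) (htT : t ≤ T) (x : ℝ) :
    ∀ s ∈ Ioo t₀ t, ‖q (t - s) s x‖ ≤ C * (t - s) ^ a * s ^ b := fun s hs =>
  h.bound _ _ _ (by linarith [hs.2]) (by linarith [hs.1]) (by linarith [hs.1]) (by linarith [hs.2])

lemma intervalIntegrable (h : Source T a b C q) (hT : T ≤ 1) (hC : 0 ≤ C) (ha : -1 < a)
    (hb : -1 < b) (ha0 : a ≤ 0) (hb0 : b ≤ 0) {t : ℝ} (ht : 0 ≤ t) (htT : t ≤ T) (x : ℝ) :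
    IntervalIntegrable (fun s => q (t - s) s x) volume 0 t :=
  (intervalIntegrable_iff_integrableOn_Ioo_of_le ht).2
    (integral_le_of_beta ha hb ha0 hb0 hC le_rfl ht (h.meas_time t x)
      (h.bound_time hT le_rfl htT x)).1

lemma norm_duhamel_le (h : Source T a b C q) (hT : T ≤ 1) (hC : 0 ≤ C) (ha : -1 < a)
    (hb : -1 < b) (ha0 : a ≤ 0) (hb0 : b ≤ 0) {t : ℝ} (ht : 0 ≤ t) (htT : t ≤ T) (x : ℝ) :
    ‖duhamel q t x‖ ≤ C * betaConst a b * t ^ (a + b + 1) := by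
  simpa [duhamel] using (integral_le_of_beta ha hb ha0 hb0 hC le_rfl ht (h.meas_time t x)
      (h.bound_time hT le_rfl htT x)).2

lemma stronglyMeasurable_duhamel (h : Source T a b C q) (t : ℝ) (ht : 0 ≤ t) :
    StronglyMeasurable (duhamel q t) := by
  unfold duhamel
  simp_rw [intervalIntegral.integral_of_le ht]
  exact StronglyMeasurable.integral_prod_right (f := fun (x s : ℝ) => q (t - s) s x)
    (h.meas.comp_measurable (g := fun w : ℝ × ℝ => (t - w.2, w.2, w.1)) (by fun_prop))

/-- The condition a > -1/2 keeps the exponent a - 1/2 of the differentiated source above -1, so its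
bound is an integrable majorant uniform in x. -/
lemma hasDerivAt_duhamel (h : Source T a b C q) (hT : T ≤ 1) (hC : 0 ≤ C) (ha : -(1 / 2) < a)
    (hb : -1 < b) (ha0 : a ≤ 0) (hb0 : b ≤ 0) {t : ℝ} (ht : 0 ≤ t) (htT : t ≤ T) (x : ℝ) :
    HasDerivAt (duhamel q t) (duhamel (sourceD q) t x) x := by
  have hD := h.deriv_source hC (by linarith)
  have hi := integral_le_of_beta (C := 4 * C) (a := a - 1 / 2) (by linarith) hb (by linarith) hb0
    (by positivity) le_rfl ht
    (f := fun s : ℝ => 4 * C * (t - s) ^ (a - 1 / 2) * s ^ b)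
    (Measurable.stronglyMeasurable (by fun_prop)) (fun s hs => by
      have h1 : 0 < s := hs.1
      have h2 : 0 < t - s := by linarith [hs.2]
      rw [Real.norm_of_nonneg (by positivity)])
  refine (intervalIntegral.hasDerivAt_integral_of_dominated_loc_of_deriv_le (μ := volume) (x₀ := x)
    (F := fun x s => q (t - s) s x) (F' := fun x s => sourceD q (t - s) s x)
    (s := univ) (bound := fun s => 4 * C * (t - s) ^ (a - 1 / 2) * s ^ b) univ_mem ?_ ?_ ?_ ?_
    ?_ ?_).2
  · exact Eventually.of_forall fun x => (h.meas_time t x).aestronglyMeasurable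
  · exact h.intervalIntegrable hT hC (by linarith) hb ha0 hb0 ht htT x
  · exact (hD.meas_time t x).aestronglyMeasurable
  -- At s = t no smoothing time is left and the source is uncontrolled; this single point is null.
  · have : ∀ᵐ s : ℝ, s ≠ t := by simp [ae_iff, measure_singleton]
    filter_upwards [this] with s hst hs x _
    rw [uIoc_of_le ht] at hs
    exact hD.bound_time hT le_rfl htT x s ⟨hs.1, lt_of_le_of_ne hs.2 hst⟩
  · exact (intervalIntegrable_iff_integrableOn_Ioo_of_le ht).2 hi.1
  · have : ∀ᵐ s : ℝ, s ≠ t := by simp [ae_iff, measure_singleton]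
    filter_upwards [this] with s hst hs x _
    rw [uIoc_of_le ht] at hs
    have := lt_of_le_of_ne hs.2 hst
    exact h.hasDerivAt (by linarith) (by linarith [hs.1]) hs.1 (by linarith) x

lemma heat_duhamel [CompleteSpace E] (h : Source T a b C q) (hT : T ≤ 1) (hC : 0 ≤ C) (ha : -1 < a)
    (hb : -1 < b) (ha0 : a ≤ 0) (hb0 : b ≤ 0) {t k : ℝ} (ht : 0 ≤ t) (hk : 0 < k) (htT : t + k ≤ T)
    (x : ℝ) : heat k (duhamel q t) x = ∫ s in (0 : ℝ)..t, q (t + k - s) s x := by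
  have hi := (integral_le_of_beta (C := C) ha hb ha0 hb0 hC le_rfl ht
    (f := fun s : ℝ => C * (t - s) ^ a * s ^ b)
    (Measurable.stronglyMeasurable (by fun_prop)) (fun s hs => by
      have h1 : 0 < s := hs.1
      have h2 : 0 < t - s := by linarith [hs.2]
      rw [Real.norm_of_nonneg (by positivity)])).1
  simp only [heat, duhamel, intervalIntegral.integral_of_le ht, integral_Ioc_eq_integral_Ioo]
  rw [integral_integral_swap]
  · refine setIntegral_congr_fun measurableSet_Ioo fun s hs => ?_
    have := h.semigroup (t - s) k s x (by linarith [hs.2]) hk (by linarith [hs.1]) hs.1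
      (by linarith [hs.2])
    rw [sub_add_eq_add_sub] at this
    exact this
  · refine Integrable.mono' (hi.comp_snd (gaussianReal 0 1)) ?_ ?_
    · exact (h.meas.comp_measurable (g := fun w : ℝ × ℝ => (t - w.2, w.2, x + √(2 * k) * w.1))
        (by fun_prop)).aestronglyMeasurable
    · have : ∀ᵐ s ∂(volume.restrict (Ioo 0 t)), ∀ z : ℝ,
          ‖q (t - s) s z‖ ≤ C * (t - s) ^ a * s ^ b :=
        (ae_restrict_iff' measurableSet_Ioo).2 (Eventually.of_forall fun s hs z =>
          h.bound_time hT le_rfl (by linarith) z s hs)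
      filter_upwards [Measure.quasiMeasurePreserving_snd.ae this] with w hw
      exact hw _

/-- The convolution at time t + k is the heat flow for time k of the convolution at time t, plus the
sources arriving in [t, t+k]. The first part is controlled by the spatial modulus, the second by the
size of the sources. -/
lemma norm_duhamel_sub_le [CompleteSpace E] (h : Source T a b C q) (hT : T ≤ 1) (hC : 0 ≤ C)
    (ha : -1 < a) (hb : -1 < b) (ha0 : a ≤ 0) (hb0 : b ≤ 0) {t k A p : ℝ} (ht : 0 ≤ t) (hk : 0 < k)
    (htT : t + k ≤ T) (hp : 0 ≤ p) (hp1 : p ≤ 1)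
    (hH : ∀ x y, ‖duhamel q t x - duhamel q t y‖ ≤ A * |x - y| ^ p) (x : ℝ) :
    ‖duhamel q (t + k) x - duhamel q t x‖ ≤
      4 * A * k ^ (p / 2) + C * betaConst a b * k ^ (a + b + 1) := by
  have hN : BddMeas (C * betaConst a b * t ^ (a + b + 1)) (duhamel q t) :=
    ⟨h.stronglyMeasurable_duhamel t ht,
      h.norm_duhamel_le hT hC ha hb ha0 hb0 ht (by linarith)⟩
  have hi := h.intervalIntegrable hT hC ha hb ha0 hb0 (by linarith : 0 ≤ t + k) htT x
  have i1 := hi.mono_set (c := 0) (d := t) (by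
    rw [uIcc_of_le ht, uIcc_of_le (by linarith)]; exact Icc_subset_Icc le_rfl (by linarith))
  have i2 := hi.mono_set (c := t) (d := t + k) (by
    rw [uIcc_of_le (by linarith), uIcc_of_le (by linarith)]; exact Icc_subset_Icc ht le_rfl)
  have e : duhamel q (t + k) x - duhamel q t x = (heat k (duhamel q t) x - duhamel q t x) +
      ∫ s in t..t + k, q (t + k - s) s x := by
    rw [h.heat_duhamel hT hC ha hb ha0 hb0 ht hk htT, duhamel,
      ← intervalIntegral.integral_add_adjacent_intervals i1 i2]
    abel
  rw [e]
  refine (norm_add_le _ _).trans (add_le_add (norm_heat_sub_self_le hp hp1 hN hH hk.le x) ?_)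
  have := (integral_le_of_beta ha hb ha0 hb0 hC ht (by linarith : t ≤ t + k)
    (h.meas_time (t + k) x) (h.bound_time hT ht htT x)).2
  simpa using this

/-- Interpolation between the sup bound and the Lipschitz bound, with the parabolic scale |x-y| = √r
as the threshold: each power of |x-y| costs half a power of r. -/
lemma norm_sub_le_of_sourceD {C' : ℝ} (h : Source T a b C q)
    (hC : 0 ≤ C) (hD : Source T (a - 1 / 2) b C' (sourceD q)) (hCC : 2 * C ≤ C') {p : ℝ}
    (hp : 0 ≤ p) (hp1 : p ≤ 1) {r s : ℝ} (hr : 0 < r) (hr1 : r ≤ 1) (hs : 0 < s) (hsT : s < T)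
    (x y : ℝ) : ‖q r s x - q r s y‖ ≤ C' * r ^ (a - p / 2) * s ^ b * |x - y| ^ p := by
  have hC' : 0 ≤ C' := by linarith
  have h1 : ‖q r s x - q r s y‖ ≤ C' * r ^ a * s ^ b := by
    have h2 := norm_sub_le_of_le (h.bound r s x hr hr1 hs hsT) (h.bound r s y hr hr1 hs hsT)
    refine h2.trans ?_
    rw [← two_mul, ← mul_assoc, ← mul_assoc]
    gcongr
  have h2 : ‖q r s x - q r s y‖ ≤ C' * r ^ (a - 1 / 2) * s ^ b * |x - y| := by
    exact Convex.norm_image_sub_le_of_norm_hasDerivWithin_le (s := univ)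
      (fun z _ => (h.hasDerivAt hr hr1 hs hsT z).hasDerivWithinAt)
      (fun z _ => hD.bound r s z hr hr1 hs hsT) convex_univ (mem_univ y) (mem_univ x)
  have hsq : (r ^ (1 / 2 : ℝ)) ^ p = r ^ (p / 2) := by
    rw [← Real.rpow_mul hr.le]; congr 1; ring
  have hr2 : 0 < r ^ (1 / 2 : ℝ) := by positivity
  have hrp : 0 < r ^ (p / 2) := by positivity
  rw [Real.rpow_sub hr] at h2 ⊢
  rcases le_total (r ^ (1 / 2 : ℝ)) |x - y| with hxy | hxy
  · refine h1.trans ?_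
    have h3 : r ^ (p / 2) ≤ |x - y| ^ p := by
      rw [← hsq]; exact Real.rpow_le_rpow hr2.le hxy hp
    have h4 : 1 ≤ |x - y| ^ p / r ^ (p / 2) := (one_le_div hrp).2 h3
    calc C' * r ^ a * s ^ b = C' * r ^ a * s ^ b * 1 := by ring
      _ ≤ C' * r ^ a * s ^ b * (|x - y| ^ p / r ^ (p / 2)) := by gcongr
      _ = _ := by ring
  · refine h2.trans ?_
    have h3 : |x - y| / r ^ (1 / 2 : ℝ) ≤ |x - y| ^ p / r ^ (p / 2) := by
      rw [← hsq, ← Real.div_rpow (abs_nonneg _) hr2.le]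
      rcases (abs_nonneg (x - y)).eq_or_lt with h0 | h0
      · rw [← h0, zero_div]; positivity
      · have h5 : 0 < |x - y| / r ^ (1 / 2 : ℝ) := by positivity
        simpa using Real.rpow_le_rpow_of_exponent_ge h5 ((div_le_one hr2).2 hxy) hp1
    calc C' * (r ^ a / r ^ (1 / 2 : ℝ)) * s ^ b * |x - y|
        = C' * r ^ a * s ^ b * (|x - y| / r ^ (1 / 2 : ℝ)) := by ring
      _ ≤ C' * r ^ a * s ^ b * (|x - y| ^ p / r ^ (p / 2)) := by gcongr
      _ = _ := by ring

lemma norm_duhamel_sub_le_of_holder {C' p : ℝ} (h : Source T a b C q) (hT : T ≤ 1) (hC : 0 ≤ C)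
    (hD : Source T (a - 1 / 2) b C' (sourceD q)) (hCC : 2 * C ≤ C')
    (hp : 0 ≤ p) (hp1 : p ≤ 1) (ha : -1 < a - p / 2)
    (hb : -1 < b) (ha0 : a ≤ 0) (hb0 : b ≤ 0) {t : ℝ} (ht : 0 ≤ t) (htT : t ≤ T) (x y : ℝ) :
    ‖duhamel q t x - duhamel q t y‖ ≤
      C' * betaConst (a - p / 2) b * t ^ (a - p / 2 + b + 1) * |x - y| ^ p := by
  have hC' : 0 ≤ C' := by linarith
  have ix := h.intervalIntegrable hT hC (by linarith) hb ha0 hb0 ht htT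
  rw [duhamel, duhamel, ← intervalIntegral.integral_sub (ix x) (ix y)]
  have := (integral_le_of_beta (C := C' * |x - y| ^ p) ha hb (by linarith) hb0
    (by positivity) le_rfl ht ((h.meas_time t x).sub (h.meas_time t y)) (fun s hs => by
      refine (h.norm_sub_le_of_sourceD hC hD hCC hp hp1 (by linarith [hs.2] : 0 < t - s)
        (by linarith [hs.1]) hs.1 (by linarith [hs.2]) x y).trans (le_of_eq ?_)
      ring)).2
  rw [sub_zero] at this
  refine this.trans (le_of_eq ?_)
  ring

end Source

/-- The constant in the bounds on time convolutions. -/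
def duhamelConst (p σ : ℝ) : ℝ :=
  16 * betaConst (p / 2 - 1) (-σ) + 64 * betaConst (p / 2 - 1 - (p / 2 - σ) / 2) (-σ)
    + betaConst ((p - 1) / 2) (-σ)

/-- Regularity of the time convolution of a smoothed source. -/
structure DuhamelBounds (T κ B : ℝ) (N ND : ℝ → ℝ → E) : Prop where
  deriv : ∀ t ∈ Icc 0 T, ∀ x, HasDerivAt (N t) (ND t x) x
  norm_le : ∀ t ∈ Icc 0 T, ∀ x, ‖N t x‖ ≤ B * T ^ κ
  norm_deriv_le : ∀ t ∈ Icc 0 T, ∀ x, ‖ND t x‖ ≤ B * T ^ κ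
  time : ∀ s ∈ Icc 0 T, ∀ t ∈ Icc 0 T, ∀ x, ‖N t x - N s x‖ ≤ B * |t - s| ^ (1 / 2 : ℝ)
  time_deriv : ∀ s ∈ Icc 0 T, ∀ t ∈ Icc 0 T, ∀ x, ‖ND t x - ND s x‖ ≤ B * |t - s| ^ (κ / 2)
  space_deriv : ∀ t ∈ Icc 0 T, ∀ x y, ‖ND t x - ND t y‖ ≤ B * |x - y| ^ κ

/-- After one derivative the source is of size r^{p/2-1} s^{-σ}, with convolution of order t^κ. A
κ-Hölder modulus of the derivative costs a further r^{-κ/2} and leaves the positive power t^{κ/2},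
so it holds uniformly. Spatial moduli turn into time moduli of half the exponent: Lipschitz into 1/2
for the function, κ into κ/2 for its derivative. -/
lemma Source.duhamelBounds [CompleteSpace E] {T p σ A : ℝ} {q : ℝ → ℝ → ℝ → E}
    (h : Source T ((p - 1) / 2) (-σ) A q) (hT : T ≤ 1) (hA : 0 ≤ A) (hp1 : p ≤ 1)
    (hσ : 0 ≤ σ) (hσp : σ < p / 2) :
    DuhamelBounds T (p / 2 - σ) (duhamelConst p σ * A) (duhamel q) (duhamel (sourceD q)) := by
  have e1 : (p - 1) / 2 - 1 / 2 = p / 2 - 1 := by ring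
  have hD : Source T (p / 2 - 1) (-σ) (4 * A) (sourceD q) := by
    have := h.deriv_source hA (by linarith)
    rwa [e1] at this
  have hDD := hD.deriv_source (by positivity) (by linarith)
  have k1 := betaConst_nonneg (a := p / 2 - 1) (b := -σ) (by linarith) (by linarith)
  have k2 := betaConst_nonneg (a := p / 2 - 1 - (p / 2 - σ) / 2) (b := -σ) (by linarith) (by linarith)
  have k3 := betaConst_nonneg (a := (p - 1) / 2) (b := -σ) (by linarith) (by linarith)
  set κ := p / 2 - σ with hκ
  have hκ0 : 0 < κ := by linarith
  have hκ1 : κ ≤ 1 / 2 := by linarith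
  set b1 := betaConst (p / 2 - 1) (-σ)
  set b2 := betaConst (p / 2 - 1 - κ / 2) (-σ)
  set b3 := betaConst ((p - 1) / 2) (-σ)
  have hK : duhamelConst p σ = 16 * b1 + 64 * b2 + b3 := rfl
  have hder : ∀ t ∈ Icc 0 T, ∀ x, HasDerivAt (duhamel q t) (duhamel (sourceD q) t x) x :=
    fun t ht x => h.hasDerivAt_duhamel hT hA (by linarith) (by linarith) (by linarith)
      (by linarith) ht.1 ht.2 x
  have hDb : ∀ t ∈ Icc 0 T, ∀ x, ‖duhamel (sourceD q) t x‖ ≤ 4 * A * b1 * t ^ κ := fun t ht x => by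
    have := hD.norm_duhamel_le hT (by positivity) (by linarith) (by linarith) (by linarith)
      (by linarith) ht.1 ht.2 x
    have e : p / 2 - 1 + -σ + 1 = κ := by rw [hκ]; ring
    rwa [e] at this
  have hone : ∀ {t c : ℝ}, t ∈ Icc 0 T → 0 ≤ c → t ^ c ≤ 1 := fun {t c} ht hc =>
    Real.rpow_le_one ht.1 (by linarith [ht.2]) hc
  have hsp : ∀ t ∈ Icc 0 T, ∀ x y, ‖duhamel (sourceD q) t x - duhamel (sourceD q) t y‖ ≤
      16 * A * b2 * |x - y| ^ κ := fun t ht x y => by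
    have := hD.norm_duhamel_sub_le_of_holder (p := κ) hT (by positivity) hDD (by linarith) hκ0.le
      (by linarith) (by linarith) (by linarith) (by linarith) (by linarith) ht.1 ht.2 x y
    refine this.trans ?_
    have h1 : t ^ (p / 2 - 1 - κ / 2 + -σ + 1) ≤ 1 := hone ht (by linarith)
    calc 4 * (4 * A) * b2 * t ^ (p / 2 - 1 - κ / 2 + -σ + 1) * |x - y| ^ κ
        ≤ 4 * (4 * A) * b2 * 1 * |x - y| ^ κ := by gcongr
      _ = _ := by ring
  have hpow : ∀ {k c d : ℝ}, 0 < k → k ≤ 1 → d ≤ c → k ^ c ≤ k ^ d := fun h1 h2 h3 =>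
    Real.rpow_le_rpow_of_exponent_ge h1 h2 h3
  have htime : ∀ s ∈ Icc 0 T, ∀ t ∈ Icc 0 T, s < t → ∀ x,
      ‖duhamel q t x - duhamel q s x‖ ≤ duhamelConst p σ * A * |t - s| ^ (1 / 2 : ℝ) ∧
      ‖duhamel (sourceD q) t x - duhamel (sourceD q) s x‖ ≤
        duhamelConst p σ * A * |t - s| ^ (κ / 2) := by
    intro s hs t ht hst x
    obtain ⟨k, rfl⟩ : ∃ k, t = s + k := ⟨t - s, by ring⟩
    have hk : 0 < k := by linarith
    have hk1 : k ≤ 1 := by linarith [hs.1, ht.2]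
    rw [add_sub_cancel_left, abs_of_pos hk, hK]
    constructor
    · have hlip : ∀ x y, ‖duhamel q s x - duhamel q s y‖ ≤ 4 * A * b1 * |x - y| ^ (1 : ℝ) := by
        intro x y
        rw [Real.rpow_one]
        refine Convex.norm_image_sub_le_of_norm_hasDerivWithin_le (s := univ)
          (fun z _ => (hder s hs z).hasDerivWithinAt) (fun z _ => (hDb s hs z).trans ?_)
          convex_univ (mem_univ y) (mem_univ x)
        exact mul_le_of_le_one_right (by positivity) (hone hs hκ0.le)
      refine (h.norm_duhamel_sub_le hT hA (by linarith) (by linarith) (by linarith) (by linarith)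
        hs.1 hk ht.2 zero_le_one le_rfl hlip x).trans ?_
      -- The exponent is κ + 1/2, so the newly arriving sources are no worse than k^{1/2}.
      have h1 : k ^ ((p - 1) / 2 + -σ + 1) ≤ k ^ (1 / 2 : ℝ) := hpow hk hk1 (by linarith)
      calc 4 * (4 * A * b1) * k ^ (1 / 2 : ℝ) + A * b3 * k ^ ((p - 1) / 2 + -σ + 1)
          ≤ 4 * (4 * A * b1) * k ^ (1 / 2 : ℝ) + A * b3 * k ^ (1 / 2 : ℝ) := by gcongr
        _ = (16 * b1 + b3) * A * k ^ (1 / 2 : ℝ) := by ring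
        _ ≤ _ := by refine mul_le_mul_of_nonneg_right (mul_le_mul_of_nonneg_right ?_ hA) (by positivity); linarith
    · refine (hD.norm_duhamel_sub_le hT (by positivity) (by linarith) (by linarith) (by linarith)
        (by linarith) hs.1 hk ht.2 hκ0.le (by linarith) (hsp s hs) x).trans ?_
      have h1 : k ^ (p / 2 - 1 + -σ + 1) ≤ k ^ (κ / 2) := hpow hk hk1 (by linarith)
      calc 4 * (16 * A * b2) * k ^ (κ / 2) + 4 * A * b1 * k ^ (p / 2 - 1 + -σ + 1)
          ≤ 4 * (16 * A * b2) * k ^ (κ / 2) + 4 * A * b1 * k ^ (κ / 2) := by gcongr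
        _ = (64 * b2 + 4 * b1) * A * k ^ (κ / 2) := by ring
        _ ≤ _ := by refine mul_le_mul_of_nonneg_right (mul_le_mul_of_nonneg_right ?_ hA) (by positivity); linarith
  have hK0 : 0 ≤ duhamelConst p σ := by rw [hK]; positivity
  have hboth : ∀ s ∈ Icc 0 T, ∀ t ∈ Icc 0 T, ∀ x,
      ‖duhamel q t x - duhamel q s x‖ ≤ duhamelConst p σ * A * |t - s| ^ (1 / 2 : ℝ) ∧
      ‖duhamel (sourceD q) t x - duhamel (sourceD q) s x‖ ≤
        duhamelConst p σ * A * |t - s| ^ (κ / 2) := by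
    intro s hs t ht x
    rcases lt_trichotomy s t with hst | rfl | hst
    · exact htime s hs t ht hst x
    · simp only [sub_self, norm_zero, abs_zero]; constructor <;> positivity
    · rw [norm_sub_rev, norm_sub_rev (duhamel (sourceD q) t x), abs_sub_comm]
      exact htime t ht s hs hst x
  refine ⟨hder, fun t ht x => ?_, fun t ht x => ?_, fun s hs t ht x => (hboth s hs t ht x).1,
    fun s hs t ht x => (hboth s hs t ht x).2, fun t ht x y => ?_⟩
  · refine (h.norm_duhamel_le hT hA (by linarith) (by linarith) (by linarith) (by linarith)
      ht.1 ht.2 x).trans ?_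
    have h1 : t ^ ((p - 1) / 2 + -σ + 1) ≤ T ^ κ := by
      rcases ht.1.eq_or_lt with h0 | h0
      · rw [← h0, Real.zero_rpow (by linarith)]
        exact Real.rpow_nonneg (ht.1.trans ht.2) _
      · exact (hpow h0 (by linarith [ht.2]) (by linarith)).trans
          (Real.rpow_le_rpow ht.1 ht.2 hκ0.le)
    have : 0 ≤ T ^ κ := Real.rpow_nonneg (ht.1.trans ht.2) _
    calc A * b3 * t ^ ((p - 1) / 2 + -σ + 1) ≤ A * b3 * T ^ κ := by gcongr
      _ = b3 * A * T ^ κ := by ring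
      _ ≤ _ := by rw [hK]; refine mul_le_mul_of_nonneg_right (mul_le_mul_of_nonneg_right ?_ hA) (by positivity); linarith
  · refine (hDb t ht x).trans ?_
    have h1 : t ^ κ ≤ T ^ κ := Real.rpow_le_rpow ht.1 ht.2 hκ0.le
    have : 0 ≤ T ^ κ := Real.rpow_nonneg (ht.1.trans ht.2) _
    calc 4 * A * b1 * t ^ κ ≤ 4 * A * b1 * T ^ κ := by gcongr
      _ = 4 * b1 * A * T ^ κ := by ring
      _ ≤ _ := by rw [hK]; refine mul_le_mul_of_nonneg_right (mul_le_mul_of_nonneg_right ?_ hA) (by positivity); linarith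
  · refine (hsp t ht x y).trans ?_
    rw [hK]
    calc 16 * A * b2 * |x - y| ^ κ = 16 * b2 * A * |x - y| ^ κ := by ring
      _ ≤ _ := by refine mul_le_mul_of_nonneg_right (mul_le_mul_of_nonneg_right ?_ hA) (by positivity); linarith

end Duhamel

/-! ### Sewing -/

section Sewing

variable {E : Type*} [NormedAddCommGroup E]

/-- Projection of `t` to `[a,b]`. -/
def clamp (a b t : ℝ) : ℝ := max a (min b t)

lemma clamp_mono (a b : ℝ) : Monotone (clamp a b) := fun _ _ h =>
  max_le_max le_rfl (min_le_min le_rfl h)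

lemma le_clamp (a b t : ℝ) : a ≤ clamp a b t := le_max_left _ _

lemma clamp_le {a b : ℝ} (h : a ≤ b) (t : ℝ) : clamp a b t ≤ b := max_le h (min_le_left _ _)

lemma clamp_of_le {a b t : ℝ} (h : a ≤ b) (ht : t ≤ a) : clamp a b t = a := by
  rw [clamp, min_eq_right (ht.trans h), max_eq_left ht]

lemma clamp_of_ge {a b t : ℝ} (h : a ≤ b) (ht : b ≤ t) : clamp a b t = b := by
  rw [clamp, min_eq_left ht, max_eq_right h]

lemma clamp_sub_le {a b s t : ℝ} (h : s ≤ t) : clamp a b t - clamp a b s ≤ t - s := by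
  unfold clamp
  rcases max_cases a (min b t) with h1 | h1 <;> rcases max_cases a (min b s) with h2 | h2 <;>
  rcases min_cases b t with h3 | h3 <;> rcases min_cases b s with h4 | h4 <;> linarith

/-- Riemann sum of the germ `Ξ` on `[a,b]` along the dyadic grid of level `n`. -/
def sewSum (Ξ : ℝ → ℝ → E) (n : ℕ) (a b : ℝ) : E :=
  ∑ k ∈ Finset.range (2 ^ n), Ξ (clamp a b (k / 2 ^ n)) (clamp a b ((k + 1) / 2 ^ n))

/-- The sewing of a germ. -/
def sew (Ξ : ℝ → ℝ → E) (a b : ℝ) : E := limUnder atTop fun n => sewSum Ξ n a b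

/-- A germ on `[0,1]` with defect of order `1 + 2ε`. -/
structure IsGerm (ε D : ℝ) (Ξ : ℝ → ℝ → E) : Prop where
  diag : ∀ x, 0 ≤ x → x ≤ 1 → Ξ x x = 0
  defect : ∀ x y z, 0 ≤ x → x ≤ y → y ≤ z → z ≤ 1 →
    ‖Ξ x z - Ξ x y - Ξ y z‖ ≤ D * (z - x) ^ (1 + 2 * ε)

lemma sum_range_two_mul (f : ℕ → E) (m : ℕ) :
    ∑ k ∈ Finset.range (2 * m), f k = ∑ k ∈ Finset.range m, (f (2 * k) + f (2 * k + 1)) := by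
  induction m with
  | zero => simp
  | succ m ih =>
    rw [Finset.sum_range_succ, ← ih, show 2 * (m + 1) = 2 * m + 1 + 1 by ring,
      Finset.sum_range_succ, Finset.sum_range_succ, add_assoc]

lemma IsGerm.nonneg {ε D : ℝ} {Ξ : ℝ → ℝ → E} (h : IsGerm ε D Ξ) : 0 ≤ D := by
  have := (norm_nonneg _).trans (h.defect 0 0 1 le_rfl le_rfl zero_le_one le_rfl)
  simpa using this

lemma sewSum_zero {Ξ : ℝ → ℝ → E} {a b : ℝ} (ha : 0 ≤ a) (hab : a ≤ b) (hb : b ≤ 1) :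
    sewSum Ξ 0 a b = Ξ a b := by
  simp [sewSum, clamp_of_le hab ha, clamp_of_ge hab hb]

lemma sum_clamp (n : ℕ) {a b : ℝ} (ha : 0 ≤ a) (hab : a ≤ b) (hb : b ≤ 1) :
    ∑ k ∈ Finset.range (2 ^ n), (clamp a b ((k + 1) / 2 ^ n) - clamp a b (k / 2 ^ n)) = b - a := by
  have := Finset.sum_range_sub (fun k : ℕ => clamp a b (k / 2 ^ n)) (2 ^ n)
  simp only [Nat.cast_add, Nat.cast_one, Nat.cast_pow, Nat.cast_ofNat, Nat.cast_zero,
    zero_div] at this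
  rw [this, div_self (by positivity), clamp_of_le hab ha, clamp_of_ge hab hb]

lemma two_pow_rpow (ε : ℝ) (n : ℕ) : ((1 : ℝ) / 2 ^ n) ^ ε = (2 ^ (-ε)) ^ n := by
  rw [one_div, ← inv_pow, ← Real.rpow_natCast, ← Real.rpow_mul (by norm_num), mul_comm,
    Real.rpow_mul (by norm_num), Real.rpow_natCast, Real.inv_rpow (by norm_num),
    Real.rpow_neg (by norm_num)]

/-- Refinement changes each cell by its defect. Of the surplus power (length)^{2ε}, one half is at
most 2^{-nε} and makes the series geometric, the other is at most (b-a)^ε. The remaining first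
powers of the lengths add up to b - a. -/
lemma IsGerm.norm_sewSum_succ_sub_le {ε D : ℝ} (hε : 0 ≤ ε) {Ξ : ℝ → ℝ → E} (h : IsGerm ε D Ξ)
    {a b : ℝ} (ha : 0 ≤ a) (hab : a ≤ b) (hb : b ≤ 1) (n : ℕ) :
    ‖sewSum Ξ n a b - sewSum Ξ (n + 1) a b‖ ≤ D * (b - a) ^ (1 + ε) * (2 ^ (-ε)) ^ n := by
  have hD := h.nonneg
  have e : sewSum Ξ (n + 1) a b = ∑ k ∈ Finset.range (2 ^ n),
      (Ξ (clamp a b (k / 2 ^ n)) (clamp a b ((2 * k + 1) / 2 ^ (n + 1))) +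
        Ξ (clamp a b ((2 * k + 1) / 2 ^ (n + 1))) (clamp a b ((k + 1) / 2 ^ n))) := by
    rw [sewSum, pow_succ', sum_range_two_mul]
    refine Finset.sum_congr rfl fun k _ => ?_
    have e1 : ((2 * k : ℕ) : ℝ) / (2 * 2 ^ n) = k / 2 ^ n := by
      push_cast; rw [mul_div_mul_left _ _ two_ne_zero]
    have e2 : (((2 * k + 1 : ℕ) : ℝ) + 1) / (2 * 2 ^ n) = (k + 1) / 2 ^ n := by
      push_cast
      rw [show (2 * (k : ℝ) + 1 + 1) = 2 * (k + 1) by ring, mul_div_mul_left _ _ two_ne_zero]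
    rw [pow_succ', e1, e2]
    push_cast
    rfl
  rw [e, sewSum, ← Finset.sum_sub_distrib, ← sum_clamp n ha hab hb]
  have hterm : ∀ k : ℕ, ‖Ξ (clamp a b (k / 2 ^ n)) (clamp a b ((k + 1) / 2 ^ n)) -
      (Ξ (clamp a b (k / 2 ^ n)) (clamp a b ((2 * k + 1) / 2 ^ (n + 1))) +
        Ξ (clamp a b ((2 * k + 1) / 2 ^ (n + 1))) (clamp a b ((k + 1) / 2 ^ n)))‖ ≤
      D * (b - a) ^ ε * (2 ^ (-ε)) ^ n *
        (clamp a b ((k + 1) / 2 ^ n) - clamp a b (k / 2 ^ n)) := by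
    intro k
    have m1 : (k : ℝ) / 2 ^ n ≤ (2 * k + 1) / 2 ^ (n + 1) := by
      rw [div_le_div_iff₀ (by positivity) (by positivity), pow_succ]
      nlinarith [pow_pos (two_pos : (0 : ℝ) < 2) n]
    have m2 : (2 * (k : ℝ) + 1) / 2 ^ (n + 1) ≤ (k + 1) / 2 ^ n := by
      rw [div_le_div_iff₀ (by positivity) (by positivity), pow_succ]
      nlinarith [pow_pos (two_pos : (0 : ℝ) < 2) n]
    have m3 : ((k : ℝ) + 1) / 2 ^ n - k / 2 ^ n = 1 / 2 ^ n := by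
      rw [← sub_div, add_sub_cancel_left]
    have l1 := clamp_sub_le (a := a) (b := b) (m1.trans m2)
    rw [m3] at l1
    have l0 := clamp_mono a b (m1.trans m2)
    have l2 : clamp a b ((k + 1) / 2 ^ n) - clamp a b (k / 2 ^ n) ≤ b - a :=
      sub_le_sub (clamp_le hab _) (le_clamp _ _ _)
    set p := clamp a b (k / 2 ^ n)
    set q := clamp a b ((k + 1) / 2 ^ n)
    have := h.defect p (clamp a b ((2 * k + 1) / 2 ^ (n + 1))) q (ha.trans (le_clamp _ _ _))
      (clamp_mono a b m1) (clamp_mono a b m2) ((clamp_le hab _).trans hb)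
    rw [← sub_sub]
    refine this.trans ?_
    rcases (sub_nonneg.2 l0).eq_or_lt with h0 | h0
    · rw [← h0, Real.zero_rpow (by linarith)]; simp
    · rw [Real.rpow_add h0, Real.rpow_one, two_mul, Real.rpow_add h0, ← two_pow_rpow]
      have g1 : (q - p) ^ ε ≤ (1 / 2 ^ n) ^ ε := Real.rpow_le_rpow h0.le l1 hε
      have g2 : (q - p) ^ ε ≤ (b - a) ^ ε := Real.rpow_le_rpow h0.le l2 hε
      have g3 : 0 ≤ (b - a) ^ ε := Real.rpow_nonneg (sub_nonneg.2 hab) _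
      calc D * ((q - p) * ((q - p) ^ ε * (q - p) ^ ε))
          ≤ D * ((q - p) * ((b - a) ^ ε * (1 / 2 ^ n) ^ ε)) := by gcongr
        _ = _ := by ring
  refine (norm_sum_le _ _).trans ((Finset.sum_le_sum fun k _ => hterm k).trans (le_of_eq ?_))
  rw [← Finset.mul_sum, sum_clamp n ha hab hb]
  rcases (sub_nonneg.2 hab).eq_or_lt with h0 | h0
  · rw [← h0, Real.zero_rpow (by linarith : 1 + ε ≠ 0)]; simp
  · rw [Real.rpow_add h0, Real.rpow_one]; ring

/-- The constant of the sewing lemma. -/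
def sewConst (ε : ℝ) : ℝ := (1 - 2 ^ (-ε))⁻¹

lemma two_rpow_neg_lt_one {ε : ℝ} (hε : 0 < ε) : (2 : ℝ) ^ (-ε) < 1 :=
  Real.rpow_lt_one_of_one_lt_of_neg (by norm_num) (by linarith)

lemma sewConst_nonneg {ε : ℝ} (hε : 0 < ε) : 0 ≤ sewConst ε :=
  inv_nonneg.2 (sub_nonneg.2 (two_rpow_neg_lt_one hε).le)

lemma IsGerm.tendsto_sewSum [CompleteSpace E] {ε D : ℝ} (hε : 0 < ε) {Ξ : ℝ → ℝ → E}
    (h : IsGerm ε D Ξ) {a b : ℝ} (ha : 0 ≤ a) (hab : a ≤ b) (hb : b ≤ 1) :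
    Tendsto (fun n => sewSum Ξ n a b) atTop (𝓝 (sew Ξ a b)) := by
  have := cauchySeq_of_le_geometric (f := fun n => sewSum Ξ n a b) (2 ^ (-ε))
    (D * (b - a) ^ (1 + ε)) (two_rpow_neg_lt_one hε) fun n => by
      rw [dist_eq_norm]; exact h.norm_sewSum_succ_sub_le hε.le ha hab hb n
  exact this.tendsto_limUnder

lemma IsGerm.norm_sub_sew_le [CompleteSpace E] {ε D : ℝ} (hε : 0 < ε) {Ξ : ℝ → ℝ → E}
    (h : IsGerm ε D Ξ) {a b : ℝ} (ha : 0 ≤ a) (hab : a ≤ b) (hb : b ≤ 1) :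
    ‖Ξ a b - sew Ξ a b‖ ≤ D * sewConst ε * (b - a) ^ (1 + ε) := by
  have := dist_le_of_le_geometric_of_tendsto₀ (f := fun n => sewSum Ξ n a b) (2 ^ (-ε))
    (D * (b - a) ^ (1 + ε)) (two_rpow_neg_lt_one hε) (fun n => by
      rw [dist_eq_norm]; exact h.norm_sewSum_succ_sub_le hε.le ha hab hb n)
    (h.tendsto_sewSum hε ha hab hb)
  rw [dist_eq_norm, sewSum_zero ha hab hb] at this
  refine this.trans (le_of_eq ?_)
  rw [sewConst]; ring

/-- All intervals use the same dyadic grid of [0,1], cut off by clamping. Hence the sums over [a,b]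
and [b,c] differ from the sum over [a,c] only in cells around b. Bounding every cell by the worst
defect still leaves 2^n · 2^{-n(1+2ε)} → 0. -/
lemma IsGerm.sew_add [CompleteSpace E] {ε D : ℝ} (hε : 0 < ε) {Ξ : ℝ → ℝ → E}
    (h : IsGerm ε D Ξ) {a b c : ℝ} (ha : 0 ≤ a) (hab : a ≤ b) (hbc : b ≤ c) (hc : c ≤ 1) :
    sew Ξ a b + sew Ξ b c = sew Ξ a c := by
  have hD := h.nonneg
  have t := ((h.tendsto_sewSum hε ha (hab.trans hbc) hc).sub
    (h.tendsto_sewSum hε ha hab (hbc.trans hc))).sub (h.tendsto_sewSum hε (ha.trans hab) hbc hc)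
  have hz : Tendsto (fun n : ℕ => D * (((2 : ℝ) ^ (-(2 * ε))) ^ n)) atTop (𝓝 (D * 0)) :=
    (tendsto_pow_atTop_nhds_zero_of_lt_one (by positivity)
      (two_rpow_neg_lt_one (by positivity))).const_mul D
  rw [mul_zero] at hz
  have := squeeze_zero_norm (a := fun n : ℕ => D * (((2 : ℝ) ^ (-(2 * ε))) ^ n))
    (f := fun n => sewSum Ξ n a c - sewSum Ξ n a b - sewSum Ξ n b c) (fun n => ?_) hz
  · have := tendsto_nhds_unique t this
    rw [sub_sub, sub_eq_zero] at this
    exact this.symm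
  rw [sewSum, sewSum, sewSum, ← Finset.sum_sub_distrib, ← Finset.sum_sub_distrib]
  have hac := hab.trans hbc
  have key : ∀ k ∈ Finset.range (2 ^ n),
      ‖Ξ (clamp a c (k / 2 ^ n)) (clamp a c ((k + 1) / 2 ^ n)) -
        Ξ (clamp a b (k / 2 ^ n)) (clamp a b ((k + 1) / 2 ^ n)) -
        Ξ (clamp b c (k / 2 ^ n)) (clamp b c ((k + 1) / 2 ^ n))‖ ≤
        D * (1 / 2 ^ n) ^ (1 + 2 * ε) := by
    intro k _
    have m1 : (k : ℝ) / 2 ^ n ≤ (k + 1) / 2 ^ n := by gcongr; linarith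
    have m3 : ((k : ℝ) + 1) / 2 ^ n - k / 2 ^ n = 1 / 2 ^ n := by
      rw [← sub_div, add_sub_cancel_left]
    have hpos : 0 ≤ D * (1 / 2 ^ n) ^ (1 + 2 * ε) := by positivity
    have cb : ∀ t, t ≤ b → clamp a c t = clamp a b t := fun t ht => by
      rw [clamp, clamp, min_eq_right (ht.trans hbc), min_eq_right ht]
    have cb' : ∀ t, b ≤ t → clamp a c t = clamp b c t := fun t ht => by
      have : b ≤ min c t := le_min hbc ht
      rw [clamp, clamp, max_eq_right this, max_eq_right (hab.trans this)]
    generalize (k : ℝ) / 2 ^ n = s at *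
    generalize ((k : ℝ) + 1) / 2 ^ n = t at *
    rcases le_total t b with htb | htb
    · rw [clamp_of_le hbc (m1.trans htb), clamp_of_le hbc htb, cb _ htb, cb _ (m1.trans htb),
        h.diag b (ha.trans hab) (hbc.trans hc)]
      simpa using hpos
    rcases le_total b s with hsb | hsb
    · rw [clamp_of_ge hab hsb, clamp_of_ge hab htb, cb' _ htb, cb' _ hsb,
        h.diag b (ha.trans hab) (hbc.trans hc)]
      simpa using hpos
    -- The only case with a genuine discrepancy: b lies in the cell, and splitting the cell at b
    -- costs one defect.
    · rw [← cb _ hsb, ← cb' _ htb, clamp_of_ge hab htb, clamp_of_le hbc hsb]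
      have h1 : clamp a c s ≤ b := (cb _ hsb).trans_le (clamp_le hab _)
      have h2 : b ≤ clamp a c t := (le_clamp _ _ _).trans_eq (cb' _ htb).symm
      refine (h.defect _ _ _ (ha.trans (le_clamp _ _ _)) h1 h2
        ((clamp_le hac _).trans hc)).trans ?_
      have := clamp_sub_le (a := a) (b := c) m1
      rw [m3] at this
      exact mul_le_mul_of_nonneg_left
        (Real.rpow_le_rpow (by linarith) this (by positivity)) hD
  refine (norm_sum_le_of_le _ key).trans (le_of_eq ?_)
  rw [Finset.sum_const, Finset.card_range, nsmul_eq_mul, ← two_pow_rpow,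
    Real.rpow_add (by positivity), Real.rpow_one]
  push_cast
  field_simp

lemma IsGerm.sew_self [CompleteSpace E] {ε D : ℝ} (hε : 0 < ε) {Ξ : ℝ → ℝ → E}
    (h : IsGerm ε D Ξ) {a : ℝ} (ha : 0 ≤ a) (ha1 : a ≤ 1) : sew Ξ a a = 0 := by
  have := h.sew_add hε ha le_rfl le_rfl ha1
  simpa using this

lemma sew_sub [CompleteSpace E] {ε D D' : ℝ} (hε : 0 < ε) {Ξ Ξ' : ℝ → ℝ → E}
    (h : IsGerm ε D Ξ) (h' : IsGerm ε D' Ξ') {a b : ℝ} (ha : 0 ≤ a) (hab : a ≤ b) (hb : b ≤ 1) :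
    sew (fun x y => Ξ x y - Ξ' x y) a b = sew Ξ a b - sew Ξ' a b := by
  refine Tendsto.limUnder_eq (((h.tendsto_sewSum hε ha hab hb).sub
    (h'.tendsto_sewSum hε ha hab hb)).congr fun n => ?_)
  rw [sewSum, sewSum, sewSum, Finset.sum_sub_distrib]

lemma IsGerm.norm_sew_le [CompleteSpace E] {ε D p c : ℝ} (hε : 0 < ε) (hp : p ≤ 1)
    {Ξ : ℝ → ℝ → E} (h : IsGerm ε D Ξ)
    (hc : ∀ x y, 0 ≤ x → x ≤ y → y ≤ 1 → ‖Ξ x y‖ ≤ c * (y - x) ^ p) {a b : ℝ} (ha : 0 ≤ a)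
    (hab : a ≤ b) (hb : b ≤ 1) : ‖sew Ξ a b‖ ≤ (c + D * sewConst ε) * (b - a) ^ p := by
  have hD := h.nonneg
  have hs := sewConst_nonneg hε
  rcases hab.eq_or_lt with rfl | hab'
  · rw [h.sew_self hε ha hb, norm_zero]
    have : 0 ≤ c := by
      have := (norm_nonneg _).trans (hc 0 1 le_rfl zero_le_one le_rfl)
      simpa using this
    exact mul_nonneg (by positivity) (Real.rpow_nonneg (by simp) _)
  have h1 := h.norm_sub_sew_le hε ha hab hb
  have h2 := hc a b ha hab hb
  have h3 : (b - a) ^ (1 + ε) ≤ (b - a) ^ p :=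
    Real.rpow_le_rpow_of_exponent_ge (by linarith) (by linarith) (by linarith)
  calc ‖sew Ξ a b‖ ≤ ‖Ξ a b‖ + ‖Ξ a b - sew Ξ a b‖ := by
        have := norm_sub_le (Ξ a b) (Ξ a b - sew Ξ a b)
        rwa [sub_sub_cancel] at this
    _ ≤ c * (b - a) ^ p + D * sewConst ε * (b - a) ^ p := by gcongr; exact h1.trans (by gcongr)
    _ = _ := by ring

end Sewing

/-! ### Periodization and the periodic heat kernel -/

section Periodic

variable {E : Type*} [NormedAddCommGroup E] [NormedSpace ℝ E]

/-- Periodic extension of the restriction of `f` to `[0,1)`. -/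
def per (f : ℝ → E) (y : ℝ) : E := f (Int.fract y)

lemma fract_mem (y : ℝ) : Int.fract y ∈ Icc (0 : ℝ) 1 :=
  ⟨Int.fract_nonneg y, (Int.fract_lt_one y).le⟩

lemma clamp_mem (t : ℝ) : clamp 0 1 t ∈ Icc (0 : ℝ) 1 :=
  ⟨le_clamp _ _ _, clamp_le zero_le_one _⟩

lemma clamp_of_mem {t : ℝ} (ht : t ∈ Icc (0 : ℝ) 1) : clamp 0 1 t = t := by
  rw [clamp, min_eq_right ht.2, max_eq_right ht.1]

lemma continuous_clamp (a b : ℝ) : Continuous (clamp a b) := by unfold clamp; fun_prop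

lemma bddMeas_per {f : ℝ → E} (hf : ContinuousOn f (Icc 0 1)) {B : ℝ}
    (hB : ∀ x ∈ Icc (0 : ℝ) 1, ‖f x‖ ≤ B) : BddMeas B (per f) := by
  refine ⟨?_, fun x => hB _ (fract_mem x)⟩
  have h1 : Continuous fun t => f (clamp 0 1 t) :=
    hf.comp_continuous (continuous_clamp 0 1) clamp_mem
  have h2 : per f = fun y => f (clamp 0 1 (Int.fract y)) := by
    funext y; rw [clamp_of_mem (fract_mem y), per]
  rw [h2]
  exact h1.stronglyMeasurable.comp_measurable measurable_fract

/-- If exactly one integer is crossed, the increment is routed through f 0 = f 1, which gives the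
factor 2. If the integer parts differ by at least two, then |x-y| exceeds the distance of the
fractional parts. -/
lemma per_holder {f : ℝ → E} {A p : ℝ} (hp : 0 ≤ p) (h01 : f 0 = f 1)
    (hf : ∀ x ∈ Icc (0 : ℝ) 1, ∀ y ∈ Icc (0 : ℝ) 1, ‖f x - f y‖ ≤ A * |x - y| ^ p) (x y : ℝ) :
    ‖per f x - per f y‖ ≤ 2 * A * |x - y| ^ p := by
  have hA : 0 ≤ A := by
    simpa using (norm_nonneg _).trans (hf 0 (by simp) 1 (by simp))
  wlog hxy : x ≤ y generalizing x y
  · rw [norm_sub_rev, abs_sub_comm]; exact this y x (le_of_not_ge hxy)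
  have hle : ∀ s t : ℝ, |s| ≤ |t| → A * |s| ^ p ≤ A * |t| ^ p := fun s t h =>
    mul_le_mul_of_nonneg_left (Real.rpow_le_rpow (abs_nonneg _) h hp) hA
  have hpos : 0 ≤ A * |x - y| ^ p := by positivity
  have e1 := Int.fract_add_floor x
  have e2 := Int.fract_add_floor y
  have b1 := Int.fract_nonneg x
  have b2 := Int.fract_lt_one x
  have b3 := Int.fract_nonneg y
  have b4 := Int.fract_lt_one y
  have habs : |x - y| = y - x := by rw [abs_sub_comm, abs_of_nonneg (by linarith)]
  rcases (Int.floor_mono hxy).eq_or_lt with h | h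
  · have h' : ((⌊x⌋ : ℤ) : ℝ) = ⌊y⌋ := by exact_mod_cast h
    have := hf _ (fract_mem x) _ (fract_mem y)
    rw [show Int.fract x - Int.fract y = x - y by linarith] at this
    unfold per
    linarith
  rcases (Int.add_one_le_of_lt h).eq_or_lt with h | h
  · have h' : ((⌊x⌋ : ℤ) : ℝ) + 1 = ⌊y⌋ := by exact_mod_cast h
    have g1 := hf _ (fract_mem x) 1 (by simp)
    have g2 := hf 0 (by simp) _ (fract_mem y)
    have l1 := hle (Int.fract x - 1) (x - y) (by
      rw [habs, abs_sub_comm, abs_of_nonneg (by linarith)]; linarith)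
    have l2 := hle (0 - Int.fract y) (x - y) (by
      rw [habs, zero_sub, abs_neg, abs_of_nonneg (by linarith)]; linarith)
    calc ‖per f x - per f y‖ = ‖(f (Int.fract x) - f 1) + (f 0 - f (Int.fract y))‖ := by
          rw [h01, per, per]; congr 1; abel
      _ ≤ _ := (norm_add_le _ _).trans (by linarith)
  · have h' : ((⌊x⌋ : ℤ) : ℝ) + 1 + 1 ≤ ⌊y⌋ := by exact_mod_cast h
    have g1 := hf _ (fract_mem x) _ (fract_mem y)
    have l1 := hle (Int.fract x - Int.fract y) (x - y) (by
      rw [habs, abs_le]; constructor <;> linarith)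
    unfold per
    linarith

/-- Unfolding: the integral over the line is the sum over unit cells, and a periodic integrand
allows the sum to be moved onto the kernel. Periodic convolutions on [0,1] thereby become heat flows
on the line. -/
lemma integral_periodize [CompleteSpace E] {K : ℝ → ℝ} {x : ℝ} (hK : Integrable fun y => K (x - y))
    (hKs : ∀ y, Summable fun k : ℤ => K (x - y - k)) {B : ℝ} {f : ℝ → E}
    (hf : BddMeas B (per f)) :
    ∫ y in (0 : ℝ)..1, (∑' k : ℤ, K (x - y - k)) • f y = ∫ y, K (x - y) • per f y := by
  have hi : Integrable fun y => K (x - y) • per f y :=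
    hK.smul_bdd B hf.meas.aestronglyMeasurable (Eventually.of_forall hf.bound)
  have hper : ∀ (y : ℝ) (k : ℤ), per f (y + k) = per f y := fun y k => by
    rw [per, per, Int.fract_add_intCast]
  have h1 := hi.hasSum_intervalIntegral_comp_add_int
  have h2 := hi.norm.hasSum_intervalIntegral_comp_add_int
  simp only [hper, ← sub_sub, intervalIntegral.integral_of_le zero_le_one] at h1 h2
  have h3 := hasSum_integral_of_summable_integral_norm (μ := volume.restrict (Ioc (0 : ℝ) 1))
    (F := fun (k : ℤ) y => K (x - y - k) • per f y) (fun k => by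
      have := (hi.comp_add_right (k : ℝ)).integrableOn (s := Ioc (0 : ℝ) 1)
      simp only [hper, ← sub_sub] at this
      exact this) h2.summable
  -- The endpoint 1 has to be removed, since `per f 1 = f 0` may differ from `f 1`.
  rw [h1.unique h3, intervalIntegral.integral_of_le zero_le_one,
    integral_Ioc_eq_integral_Ioo, integral_Ioc_eq_integral_Ioo]
  refine setIntegral_congr_fun measurableSet_Ioo fun y hy => ?_
  rw [(hKs y).tsum_smul_const, per, Int.fract_eq_self.2 ⟨hy.1.le, hy.2⟩]

/-- Completing the square gives -bw² ≤ 1/(4b) - |w|. Half of this exponential decay absorbs the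
linear factor, the other half is compared with exp(-|k|/2). -/
lemma summable_gauss_bound {b : ℝ} (hb : 0 < b) (x : ℝ) :
    Summable fun k : ℤ => (|x - k| + 1) * Real.exp (-b * (x - k) ^ 2) := by
  have hs : Summable fun k : ℤ => Real.exp (-(|(k : ℝ)| / 2)) := by
    have hn : Summable fun k : ℕ => Real.exp (-((k : ℝ) / 2)) := by
      have := Real.summable_exp_nat_mul_iff.2 (by norm_num : (-(1 / 2) : ℝ) < 0)
      refine this.congr fun k => ?_
      congr 1; ring
    refine Summable.of_nat_of_neg ?_ ?_
    · simpa using hn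
    · simpa using hn
  refine Summable.of_nonneg_of_le (fun k => by positivity) (fun k => ?_)
    (hs.mul_left (2 * Real.exp (1 / (4 * b)) * Real.exp (|x| / 2)))
  set w := x - k with hw
  have h1 : -b * w ^ 2 ≤ 1 / (4 * b) - |w| := by
    have : 0 ≤ b * (|w| - 1 / (2 * b)) ^ 2 := by positivity
    have e : b * (|w| - 1 / (2 * b)) ^ 2 = b * w ^ 2 - |w| + 1 / (4 * b) := by
      rw [sub_sq, sq_abs]; field_simp; ring
    linarith
  have h2 : |w| + 1 ≤ 2 * Real.exp (|w| / 2) := by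
    have := Real.add_one_le_exp (|w| / 2)
    linarith [abs_nonneg w]
  have h3 : |(k : ℝ)| ≤ |x| + |w| := by
    have : (k : ℝ) = x - w := by rw [hw]; ring
    rw [this]; exact abs_sub x w
  calc (|w| + 1) * Real.exp (-b * w ^ 2)
      ≤ 2 * Real.exp (|w| / 2) * Real.exp (1 / (4 * b) - |w|) := by gcongr
    _ = 2 * Real.exp (1 / (4 * b)) * Real.exp (-(|w| / 2)) := by
        rw [mul_assoc, mul_assoc, ← Real.exp_add, ← Real.exp_add]; congr 2; ring
    _ ≤ 2 * Real.exp (1 / (4 * b)) * Real.exp (|x| / 2 + -(|(k : ℝ)| / 2)) := by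
        gcongr; linarith
    _ = _ := by rw [Real.exp_add]; ring

/-- Derivative of the periodic heat kernel. -/
def heatKernelD (t x : ℝ) : ℝ := ∑' k : ℤ, gaussKernelD t (x - k)

lemma gaussKernel_le_bound {r : ℝ} (hr : 0 < r) {x y : ℝ} (hxy : |y - x| ≤ 1) (k : ℤ) :
    ‖gaussKernel r (y - k)‖ ≤ (√(4 * Real.pi * r))⁻¹ * Real.exp (1 / (4 * r)) *
      ((|x - k| + 1) * Real.exp (-(1 / (8 * r)) * (x - k) ^ 2)) := by
  have := gaussKernel_shift_le hr (w := x - k) hxy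
  rw [show x - k + (y - x) = y - k by ring] at this
  rw [Real.norm_of_nonneg (gaussKernel_nonneg _ _)]
  refine this.trans ?_
  have h1 : 1 ≤ |x - k| + 1 := by linarith [abs_nonneg (x - k)]
  have h2 := Real.exp_pos (-(1 / (8 * r)) * (x - k) ^ 2)
  gcongr
  nlinarith

lemma gaussKernelD_le_bound {r : ℝ} (hr : 0 < r) {x y : ℝ} (hxy : |y - x| ≤ 1) (k : ℤ) :
    ‖gaussKernelD r (y - k)‖ ≤ (√(4 * Real.pi * r))⁻¹ * Real.exp (1 / (4 * r)) / (2 * r) *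
      ((|x - k| + 1) * Real.exp (-(1 / (8 * r)) * (x - k) ^ 2)) := by
  have := norm_gaussKernelD_shift_le hr (w := x - k) hxy
  rwa [show x - k + (y - x) = y - k by ring] at this

lemma summable_gaussKernel {r : ℝ} (hr : 0 < r) (x : ℝ) :
    Summable fun k : ℤ => gaussKernel r (x - k) :=
  Summable.of_norm_bounded ((summable_gauss_bound (b := 1 / (8 * r)) (by positivity) x).mul_left _)
    fun k => gaussKernel_le_bound hr (by simp) k

lemma summable_gaussKernelD {r : ℝ} (hr : 0 < r) (x : ℝ) :
    Summable fun k : ℤ => gaussKernelD r (x - k) :=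
  Summable.of_norm_bounded ((summable_gauss_bound (b := 1 / (8 * r)) (by positivity) x).mul_left _)
    fun k => gaussKernelD_le_bound hr (by simp) k

lemma hasDerivAt_heatKernel {r : ℝ} (hr : 0 < r) (x : ℝ) :
    HasDerivAt (heatKernel r) (heatKernelD r x) x := by
  refine hasDerivAt_tsum_of_isPreconnected (g := fun (k : ℤ) y => gaussKernel r (y - k))
    (g' := fun (k : ℤ) y => gaussKernelD r (y - k))
    ((summable_gauss_bound (b := 1 / (8 * r)) (by positivity) x).mul_left
      ((√(4 * Real.pi * r))⁻¹ * Real.exp (1 / (4 * r)) / (2 * r)))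
    Metric.isOpen_ball (convex_ball x 1).isPreconnected (fun k y _ => ?_) (fun k y hy => ?_)
    (Metric.mem_ball_self one_pos) (summable_gaussKernel hr x) (Metric.mem_ball_self one_pos)
  · have := (hasDerivAt_gaussKernel hr (y - k)).comp y ((hasDerivAt_id y).sub_const (k : ℝ))
    rwa [mul_one] at this
  · rw [Metric.mem_ball, Real.dist_eq] at hy
    exact gaussKernelD_le_bound hr hy.le k

lemma continuous_heatKernel {r : ℝ} (hr : 0 < r) : Continuous (heatKernel r) :=
  continuous_iff_continuousAt.2 fun x => (hasDerivAt_heatKernel hr x).continuousAt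

lemma continuous_heatKernelD {r : ℝ} (hr : 0 < r) : Continuous (heatKernelD r) := by
  refine continuous_iff_continuousAt.2 fun x => ?_
  refine ContinuousOn.continuousAt (s := Metric.ball x 1) ?_ (Metric.ball_mem_nhds _ one_pos)
  refine continuousOn_tsum (fun k => ?_)
    ((summable_gauss_bound (b := 1 / (8 * r)) (by positivity) x).mul_left
      ((√(4 * Real.pi * r))⁻¹ * Real.exp (1 / (4 * r)) / (2 * r))) (fun k y hy => ?_)
  · exact ((continuous_gaussKernelD hr).comp (by fun_prop)).continuousOn
  · rw [Metric.mem_ball, Real.dist_eq] at hy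
    exact gaussKernelD_le_bound hr hy.le k

lemma integral_heatKernel_smul [CompleteSpace E] {r B : ℝ} (hr : 0 < r) {f : ℝ → E}
    (hf : BddMeas B (per f)) (x : ℝ) :
    ∫ y in (0 : ℝ)..1, heatKernel r (x - y) • f y = heat r (per f) x := by
  rw [heat_eq_kernel hr]
  exact integral_periodize (integrable_gaussKernel hr x) (fun y => summable_gaussKernel hr (x - y)) hf

lemma integral_heatKernelD_smul [CompleteSpace E] {r B : ℝ} (hr : 0 < r) {f : ℝ → E}
    (hf : BddMeas B (per f)) (x : ℝ) :
    ∫ y in (0 : ℝ)..1, heatKernelD r (x - y) • f y = heatD r (per f) x := by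
  rw [heatD_eq_kernel hr]
  exact integral_periodize (integrable_gaussKernelD hr x)
    (fun y => summable_gaussKernelD hr (x - y)) hf

lemma integral_heatKernel {r : ℝ} (hr : 0 < r) (x : ℝ) :
    ∫ y in (0 : ℝ)..1, heatKernel r (x - y) = 1 := by
  have := integral_heatKernel_smul hr (f := fun _ => (1 : ℝ)) (B := 1)
    (bddMeas_per continuousOn_const (by simp)) x
  simpa [heat, per] using this

end Periodic

/-! ### Riemann sums -/

section RiemannStieltjes

variable {E : Type*} [NormedAddCommGroup E] [NormedSpace ℝ E]

namespace IsPartition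

variable {δ : ℝ} {m : ℕ} {p : ℕ → ℝ}

lemma monotone_le (h : IsPartition δ m p) {i j : ℕ} (hij : i ≤ j) (hj : j ≤ m) : p i ≤ p j := by
  induction j, hij using Nat.le_induction with
  | base => exact le_rfl
  | succ j _ ih => exact (ih (by omega)).trans (h.mono j (by omega))

lemma mem (h : IsPartition δ m p) {i : ℕ} (hi : i ≤ m) : p i ∈ Icc (0 : ℝ) 1 :=
  ⟨h.left ▸ h.monotone_le (Nat.zero_le i) hi, h.right ▸ h.monotone_le hi le_rfl⟩

lemma sum_sub (h : IsPartition δ m p) : ∑ i ∈ Finset.range m, (p (i + 1) - p i) = 1 := by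
  rw [Finset.sum_range_sub, h.left, h.right, sub_zero]

end IsPartition

lemma exists_isPartition {δ : ℝ} (hδ : 0 < δ) : ∃ (m : ℕ) (p : ℕ → ℝ), IsPartition δ m p := by
  obtain ⟨m, hm⟩ := exists_nat_one_div_lt hδ
  have h0 : ((m : ℝ) + 1) ≠ 0 := by positivity
  refine ⟨m + 1, fun i => i / (m + 1), by simp, ?_, fun i _ => ?_, fun i _ => ?_⟩
  · push_cast; exact div_self h0
  · gcongr; simp
  · push_cast
    rw [← sub_div, add_sub_cancel_left]
    exact hm

/-- A germ that agrees with the increments of `I` up to order 1 + ε can be replaced by them in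
Riemann sums with a bounded weight φ. For smooth φ the resulting sums converge to the Stieltjes
integral, here already integrated by parts. Only Hölder continuity of `I` is used, with any positive
exponent. -/
lemma riemann_stieltjes [CompleteSpace E] {φ φ' : ℝ → ℝ} (hφ : ∀ y, HasDerivAt φ (φ' y) y)
    (hφ' : Continuous φ') {I : ℝ → E} {Ξ : ℝ → ℝ → E} {H p C ε : ℝ} (hp : 0 < p) (hε : 0 < ε)
    (hI : ∀ x y, 0 ≤ x → x ≤ y → y ≤ 1 → ‖I y - I x‖ ≤ H * (y - x) ^ p)
    (hIc : ContinuousOn I (Icc 0 1))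
    (hΞ : ∀ x y, 0 ≤ x → x ≤ y → y ≤ 1 → ‖Ξ x y - (I y - I x)‖ ≤ C * (y - x) ^ (1 + ε))
    {η : ℝ} (hη : 0 < η) :
    ∃ δ > 0, ∀ (m : ℕ) (q : ℕ → ℝ), IsPartition δ m q →
      ‖(∑ i ∈ Finset.range m, φ (q i) • Ξ (q i) (q (i + 1))) -
        (φ 1 • I 1 - φ 0 • I 0 - ∫ y in (0 : ℝ)..1, φ' y • I y)‖ < η := by
  have hφc : Continuous φ := continuous_iff_continuousAt.2 fun y => (hφ y).continuousAt
  obtain ⟨B, hB⟩ : ∃ B, ∀ y ∈ Icc (0 : ℝ) 1, ‖φ y‖ ≤ B :=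
    isCompact_Icc.exists_bound_of_continuousOn hφc.continuousOn
  obtain ⟨B', hB'⟩ : ∃ B, ∀ y ∈ Icc (0 : ℝ) 1, ‖φ' y‖ ≤ B :=
    isCompact_Icc.exists_bound_of_continuousOn hφ'.continuousOn
  have hB0 : 0 ≤ B := (norm_nonneg _).trans (hB 0 (by simp))
  have hB0' : 0 ≤ B' := (norm_nonneg _).trans (hB' 0 (by simp))
  have hH0 : 0 ≤ H := by
    simpa using (norm_nonneg _).trans (hI 0 1 le_rfl zero_le_one le_rfl)
  have hC0 : 0 ≤ C := by
    simpa using (norm_nonneg _).trans (hΞ 0 1 le_rfl zero_le_one le_rfl)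
  have hlim : Tendsto (fun δ : ℝ => B * C * δ ^ ε + B' * H * δ ^ p) (𝓝[>] 0) (𝓝 0) := by
    have h1 : ContinuousAt (fun δ : ℝ => B * C * δ ^ ε + B' * H * δ ^ p) 0 :=
      (continuousAt_const.mul (Real.continuousAt_rpow_const _ _ (Or.inr hε.le))).add
        (continuousAt_const.mul (Real.continuousAt_rpow_const _ _ (Or.inr hp.le)))
    have h2 := h1.tendsto
    simp only [Real.zero_rpow hε.ne', Real.zero_rpow hp.ne', mul_zero, add_zero] at h2
    exact h2.mono_left nhdsWithin_le_nhds
  obtain ⟨δ, hδη, hδ⟩ := ((hlim.eventually (gt_mem_nhds hη)).and self_mem_nhdsWithin).exists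
  have hδ : 0 < δ := hδ
  refine ⟨δ, hδ, fun m q hq => lt_of_le_of_lt ?_ hδη⟩
  have hJc : ContinuousOn (fun y => φ' y • I y) (Icc 0 1) := hφ'.continuousOn.smul hIc
  have hJ : ∀ a b : ℝ, 0 ≤ a → a ≤ b → b ≤ 1 →
      IntervalIntegrable (fun y => φ' y • I y) volume a b := fun a b ha hab hb =>
    (hJc.mono (by rw [uIcc_of_le hab]; exact Icc_subset_Icc ha hb)).intervalIntegrable
  have e1 : ∫ y in (0 : ℝ)..1, φ' y • I y =
      ∑ i ∈ Finset.range m, ∫ y in (q i)..(q (i + 1)), φ' y • I y := by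
    rw [intervalIntegral.sum_integral_adjacent_intervals, hq.left, hq.right]
    exact fun i hi => hJ _ _ (hq.mem hi.le).1 (hq.mono i hi) (hq.mem hi).2
  have e2 : φ 1 • I 1 - φ 0 • I 0 =
      ∑ i ∈ Finset.range m, (φ (q (i + 1)) • I (q (i + 1)) - φ (q i) • I (q i)) := by
    rw [Finset.sum_range_sub (fun i => φ (q i) • I (q i)), hq.left, hq.right]
  rw [e1, e2, ← Finset.sum_sub_distrib, ← Finset.sum_sub_distrib]
  have hterm : ∀ i ∈ Finset.range m, ‖φ (q i) • Ξ (q i) (q (i + 1)) -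
      (φ (q (i + 1)) • I (q (i + 1)) - φ (q i) • I (q i) -
        ∫ y in (q i)..(q (i + 1)), φ' y • I y)‖ ≤
      (B * C * δ ^ ε + B' * H * δ ^ p) * (q (i + 1) - q i) := by
    intro i hi
    have hi := Finset.mem_range.1 hi
    have m1 := hq.mem hi.le
    have m2 := hq.mem (Nat.succ_le_of_lt hi)
    have hab := hq.mono i hi
    have hmesh := hq.mesh i hi
    simp only [Nat.succ_eq_add_one] at m2
    generalize q i = a at *
    generalize q (i + 1) = b at *
    have hint : ∫ y in a..b, φ' y • (I b - I y) = (φ b - φ a) • I b - ∫ y in a..b, φ' y • I y := by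
      simp_rw [smul_sub]
      have i1 : IntervalIntegrable (fun y => φ' y • I b) volume a b :=
        (hφ'.smul continuous_const).intervalIntegrable _ _
      rw [intervalIntegral.integral_sub i1
        (hJ a b m1.1 hab m2.2), intervalIntegral.integral_smul_const,
        intervalIntegral.integral_eq_sub_of_hasDerivAt (fun y _ => hφ y)
          (hφ'.intervalIntegrable _ _)]
    -- Per cell, the error is the sewing error weighted by φ(a), plus the cost of freezing `I` at
    -- the right endpoint in the integral against φ'.
    have e : φ a • Ξ a b - (φ b • I b - φ a • I a - ∫ y in a..b, φ' y • I y) =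
        φ a • (Ξ a b - (I b - I a)) - ∫ y in a..b, φ' y • (I b - I y) := by
      rw [hint]; module
    rw [e]
    have n1 : ‖φ a • (Ξ a b - (I b - I a))‖ ≤ B * C * δ ^ ε * (b - a) := by
      rw [norm_smul]
      rcases (sub_nonneg.2 hab).eq_or_lt with h0 | h0
      · have := hΞ a b m1.1 hab m2.2
        rw [← h0, Real.zero_rpow (by linarith), mul_zero] at this
        rw [← h0, mul_zero, le_antisymm this (norm_nonneg _), mul_zero]
      have h1 : (b - a) ^ ε ≤ δ ^ ε := Real.rpow_le_rpow h0.le hmesh.le hε.le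
      calc ‖φ a‖ * ‖Ξ a b - (I b - I a)‖ ≤ B * (C * (b - a) ^ (1 + ε)) := by
            gcongr
            · exact hB a m1
            · exact hΞ a b m1.1 hab m2.2
        _ = B * C * (b - a) ^ ε * (b - a) := by rw [Real.rpow_add h0, Real.rpow_one]; ring
        _ ≤ _ := by gcongr
    have n2 : ‖∫ y in a..b, φ' y • (I b - I y)‖ ≤ B' * H * δ ^ p * (b - a) := by
      have := intervalIntegral.norm_integral_le_of_norm_le_const (a := a) (b := b)
        (f := fun y => φ' y • (I b - I y)) (C := B' * H * δ ^ p) (fun y hy => by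
          rw [uIoc_of_le hab] at hy
          rw [norm_smul, mul_assoc]
          have h1 := hI y b (by linarith [hy.1, m1.1]) hy.2 m2.2
          have h2 : (b - y) ^ p ≤ δ ^ p :=
            Real.rpow_le_rpow (by linarith [hy.2]) (by linarith [hy.1]) hp.le
          gcongr
          · exact hB' y ⟨by linarith [hy.1, m1.1], by linarith [hy.2, m2.2]⟩
          · exact h1.trans (by gcongr))
      rwa [abs_of_nonneg (sub_nonneg.2 hab)] at this
    refine (norm_sub_le _ _).trans ((add_le_add n1 n2).trans (le_of_eq ?_))
    ring
  refine (norm_sum_le_of_le _ hterm).trans (le_of_eq ?_)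
  rw [← Finset.mul_sum, hq.sum_sub, mul_one]

/-- Subtracting the linear function y I(1) makes `I` vanish at both ends, so that its periodic
extension inherits Hölder regularity and gains from smoothing. The linear part is integrated
exactly, using that the kernel has mass 1, and produces the summand I(1). -/
lemma heat_stieltjes [CompleteSpace E] {r : ℝ} (hr : 0 < r) {I : ℝ → E}
    (hIc : ContinuousOn I (Icc 0 1)) (hI0 : I 0 = 0) (x : ℝ) :
    heatKernel r (x - 1) • I 1 - heatKernel r (x - 0) • I 0 -
        ∫ y in (0 : ℝ)..1, (-heatKernelD r (x - y)) • I y =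
      heatD r (per fun y => I y - y • I 1) x + I 1 := by
  have hc : Continuous fun y => heatKernelD r (x - y) :=
    (continuous_heatKernelD hr).comp (by fun_prop)
  have hc0 : Continuous fun y => heatKernel r (x - y) :=
    (continuous_heatKernel hr).comp (by fun_prop)
  have hfc : ContinuousOn (fun y => I y - y • I 1) (Icc 0 1) :=
    hIc.sub (Continuous.continuousOn (by fun_prop))
  obtain ⟨B, hB⟩ := isCompact_Icc.exists_bound_of_continuousOn hfc
  rw [← integral_heatKernelD_smul hr (bddMeas_per hfc hB), hI0, smul_zero, sub_zero]
  have hd : ∀ y, HasDerivAt (fun y => heatKernel r (x - y)) (-heatKernelD r (x - y)) y := fun y => by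
    have := (hasDerivAt_heatKernel hr (x - y)).comp y ((hasDerivAt_id y).const_sub x)
    rwa [mul_neg, mul_one] at this
  have hibp : ∫ y in (0 : ℝ)..1, y * -heatKernelD r (x - y) = heatKernel r (x - 1) - 1 := by
    have := intervalIntegral.integral_mul_deriv_eq_deriv_mul (a := 0) (b := 1) (u := fun y => y)
      (u' := fun _ => (1 : ℝ)) (v := fun y => heatKernel r (x - y))
      (v' := fun y => -heatKernelD r (x - y)) (fun y _ => hasDerivAt_id y) (fun y _ => hd y)
      (continuous_const.intervalIntegrable _ _) (hc.neg.intervalIntegrable _ _)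
    rw [this]
    simp [integral_heatKernel hr]
  have hsplit : ∀ y, heatKernelD r (x - y) • (I y - y • I 1) =
      (y * -heatKernelD r (x - y)) • I 1 - (-heatKernelD r (x - y)) • I y := fun y => by module
  simp_rw [hsplit]
  rw [intervalIntegral.integral_sub, intervalIntegral.integral_smul_const, hibp]
  · module
  · exact Continuous.intervalIntegrable (by fun_prop) _ _
  · refine ContinuousOn.intervalIntegrable ?_
    rw [uIcc_of_le zero_le_one]
    exact hc.neg.continuousOn.smul hIc

end RiemannStieltjes

/-- Two limits are compared along a single partition fine enough for both; this requires that
partitions of arbitrarily small mesh exist. -/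
lemma IsRoughIntegral.unique {n : ℕ} {XX : ℝ → ℝ → Tens n} {Y : ℝ → Mat n}
    {Y' : ℝ → Vec n →L[ℝ] Mat n} {Z : ℝ → Vec n} {Z' : ℝ → Mat n} {I J : Vec n}
    (hI : IsRoughIntegral XX Y Y' Z Z' I) (hJ : IsRoughIntegral XX Y Y' Z Z' J) : I = J := by
  refine eq_of_forall_dist_le fun ε hε => ?_
  obtain ⟨δ₁, h₁, H₁⟩ := hI (ε / 2) (half_pos hε)
  obtain ⟨δ₂, h₂, H₂⟩ := hJ (ε / 2) (half_pos hε)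
  obtain ⟨m, p, hp⟩ := exists_isPartition (lt_min h₁ h₂)
  have g₁ := H₁ m p ⟨hp.left, hp.right, hp.mono, fun i hi => (hp.mesh i hi).trans_le (min_le_left _ _)⟩
  have g₂ := H₂ m p ⟨hp.left, hp.right, hp.mono, fun i hi => (hp.mesh i hi).trans_le (min_le_right _ _)⟩
  rw [dist_eq_norm, ← sub_sub_sub_cancel_left]
  refine (norm_sub_le _ _).trans ?_
  linarith

lemma IsRoughIntegral.roughIntegral_eq {n : ℕ} {XX : ℝ → ℝ → Tens n} {Y : ℝ → Mat n}
    {Y' : ℝ → Vec n →L[ℝ] Mat n} {Z : ℝ → Vec n} {Z' : ℝ → Mat n} {I : Vec n}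
    (hI : IsRoughIntegral XX Y Y' Z Z' I) : roughIntegral XX Y Y' Z Z' = I := by
  have h : ∃ I, IsRoughIntegral XX Y Y' Z Z' I := ⟨I, hI⟩
  rw [roughIntegral, dif_pos h]
  exact h.choose_spec.unique hI

/-! ### Pairs of nearby vectors -/

section Near

variable {E F G : Type*} [NormedAddCommGroup E] [NormedAddCommGroup F] [NormedAddCommGroup G]

/-- Both vectors are bounded by `A` and they differ by at most `A δ`. -/
structure Near (δ A : ℝ) (a b : E) : Prop where
  left : ‖a‖ ≤ A
  right : ‖b‖ ≤ A
  diff : ‖a - b‖ ≤ A * δ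

namespace Near

variable {δ A B : ℝ}

lemma nonneg {a b : E} (h : Near δ A a b) : 0 ≤ A := (norm_nonneg _).trans h.left

lemma mono {a b : E} (hδ : 0 ≤ δ) (h : Near δ A a b) (hAB : A ≤ B) : Near δ B a b :=
  ⟨h.left.trans hAB, h.right.trans hAB, h.diff.trans (by gcongr)⟩

lemma add {a b : E} {c d : E} (h : Near δ A a b) (h' : Near δ B c d) :
    Near δ (A + B) (a + c) (b + d) :=
  ⟨norm_add_le_of_le h.left h'.left, norm_add_le_of_le h.right h'.right, by
    rw [add_sub_add_comm, add_mul]; exact norm_add_le_of_le h.diff h'.diff⟩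

lemma neg {a b : E} (h : Near δ A a b) : Near δ A (-a) (-b) :=
  ⟨by simpa using h.left, by simpa using h.right, by
    rw [neg_sub_neg, norm_sub_rev]; exact h.diff⟩

lemma sub {a b : E} {c d : E} (h : Near δ A a b) (h' : Near δ B c d) :
    Near δ (A + B) (a - c) (b - d) := by
  simpa [sub_eq_add_neg] using h.add h'.neg

lemma sum {ι : Type*} (s : Finset ι) {a b : ι → E} (h : ∀ i ∈ s, Near δ A (a i) (b i)) :
    Near δ (s.card * A) (∑ i ∈ s, a i) (∑ i ∈ s, b i) := by
  refine ⟨?_, ?_, ?_⟩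
  · simpa using norm_sum_le_of_le s fun i hi => (h i hi).left
  · simpa using norm_sum_le_of_le s fun i hi => (h i hi).right
  · rw [← Finset.sum_sub_distrib]
    simpa [mul_assoc] using norm_sum_le_of_le s fun i hi => (h i hi).diff

/-- The Leibniz rule f(a,c) - f(b,d) = f(a-b,c) + f(b,c-d) yields two terms of size ABδ. The
constant 2AB serves both for them and for the values themselves, so products can be nested freely.
-/
lemma bilin {f : E → F → G} (hδ : 0 ≤ δ) (h1 : ∀ x x' y, f (x - x') y = f x y - f x' y)
    (h2 : ∀ x y y', f x (y - y') = f x y - f x y') (hf : ∀ x y, ‖f x y‖ ≤ ‖x‖ * ‖y‖)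
    {a b : E} {c d : F} (h : Near δ A a b) (h' : Near δ B c d) :
    Near δ (2 * A * B) (f a c) (f b d) := by
  have hA := h.nonneg
  have hB := h'.nonneg
  have l : ∀ {x : E} {y : F}, ‖x‖ ≤ A → ‖y‖ ≤ B → ‖f x y‖ ≤ 2 * A * B := fun {x y} hx hy => by
    have := (hf x y).trans (mul_le_mul hx hy (norm_nonneg _) hA)
    nlinarith [mul_nonneg hA hB]
  refine ⟨l h.left h'.left, l h.right h'.right, ?_⟩
  have e : f a c - f b d = f (a - b) c + f b (c - d) := by rw [h1, h2]; abel
  rw [e]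
  refine (norm_add_le_of_le ((hf _ _).trans (mul_le_mul h.diff h'.left (norm_nonneg _)
    (by positivity))) ((hf _ _).trans (mul_le_mul h.right h'.diff (norm_nonneg _) hA))).trans ?_
  exact le_of_eq (by ring)

variable [NormedSpace ℝ E] [NormedSpace ℝ F] [NormedSpace ℝ G]

lemma apply (hδ : 0 ≤ δ) {S T : E →L[ℝ] F} {x y : E} (h : Near δ A S T) (h' : Near δ B x y) :
    Near δ (2 * A * B) (S x) (T y) :=
  bilin (f := fun (S : E →L[ℝ] F) x => S x) hδ (fun _ _ _ => rfl) (fun S _ _ => map_sub S _ _)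
    (fun S x => S.le_opNorm x) h h'

lemma comp (hδ : 0 ≤ δ) {S T : F →L[ℝ] G} {x y : E →L[ℝ] F} (h : Near δ A S T)
    (h' : Near δ B x y) : Near δ (2 * A * B) (S.comp x) (T.comp y) :=
  bilin (f := fun (S : F →L[ℝ] G) (x : E →L[ℝ] F) => S.comp x) hδ
    (fun _ _ _ => ContinuousLinearMap.sub_comp _ _ _)
    (fun _ _ _ => ContinuousLinearMap.comp_sub _ _ _)
    (fun S x => S.opNorm_comp_le x) h h'

lemma smul (hδ : 0 ≤ δ) {s t : ℝ} {x y : E} (h : Near δ A s t) (h' : Near δ B x y) :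
    Near δ (2 * A * B) (s • x) (t • y) :=
  bilin (f := fun (s : ℝ) (x : E) => s • x) hδ (fun _ _ _ => sub_smul _ _ _)
    (fun _ _ _ => smul_sub _ _ _) (fun s x => (norm_smul s x).le) h h'

lemma apply_unit {S T : E →L[ℝ] F} (h : Near δ A S T) {x : E} (hx : ‖x‖ = 1) :
    Near δ A (S x) (T x) := by
  have l : ∀ {S : E →L[ℝ] F} {C : ℝ}, ‖S‖ ≤ C → ‖S x‖ ≤ C := fun {S C} hS => by
    have := S.le_opNorm x
    rw [hx, mul_one] at this
    exact this.trans hS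
  exact ⟨l h.left, l h.right, l h.diff⟩

end Near

end Near

/-! ### Taylor estimates -/

section Taylor

variable {V W : Type*} [NormedAddCommGroup V] [NormedSpace ℝ V] [NormedAddCommGroup W]
  [NormedSpace ℝ W]

lemma norm_taylor_le {f : V → W} {f' : V → V →L[ℝ] W} {L : ℝ} (hf : ∀ x, HasFDerivAt f (f' x) x)
    (hL : ∀ x y, ‖f' x - f' y‖ ≤ L * ‖x - y‖) (a b : V) :
    ‖f b - f a - f' a (b - a)‖ ≤ L * ‖b - a‖ ^ 2 := by
  have hL0 : 0 ≤ L * ‖b - a‖ := (norm_nonneg _).trans (hL b a)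
  have hd : ∀ τ : ℝ, HasDerivAt (fun τ : ℝ => f (a + τ • (b - a)) - τ • f' a (b - a))
      ((f' (a + τ • (b - a)) - f' a) (b - a)) τ := fun τ => by
    have h1 : HasDerivAt (fun τ : ℝ => a + τ • (b - a)) (b - a) τ := by
      simpa using ((hasDerivAt_id τ).smul_const (b - a)).const_add a
    have h2 := (hf (a + τ • (b - a))).comp_hasDerivAt τ h1
    have h3 : HasDerivAt (fun τ : ℝ => τ • f' a (b - a)) (f' a (b - a)) τ := by
      simpa using (hasDerivAt_id τ).smul_const (f' a (b - a))
    exact h2.sub h3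
  have := norm_image_sub_le_of_norm_deriv_le_segment_01' (C := L * ‖b - a‖ ^ 2)
    (fun τ _ => (hd τ).hasDerivWithinAt) (fun τ hτ => by
      refine (ContinuousLinearMap.le_opNorm _ _).trans ?_
      have := hL (a + τ • (b - a)) a
      rw [add_sub_cancel_left, norm_smul, Real.norm_of_nonneg hτ.1] at this
      have h2 : ‖f' (a + τ • (b - a)) - f' a‖ ≤ L * ‖b - a‖ := this.trans (by nlinarith [hτ.2])
      rw [sq, ← mul_assoc]
      gcongr)
  simpa [sub_right_comm] using this

lemma norm_segment_le {c d : V} {m τ : ℝ} (hτ : τ ∈ Icc (0 : ℝ) 1) (hc : ‖c‖ ≤ m) (hd : ‖d‖ ≤ m) :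
    ‖d + τ • (c - d)‖ ≤ m := by
  have e : d + τ • (c - d) = (1 - τ) • d + τ • c := by module
  rw [e]
  refine (norm_add_le _ _).trans ?_
  rw [norm_smul, norm_smul, Real.norm_of_nonneg hτ.1, Real.norm_of_nonneg (sub_nonneg.2 hτ.2)]
  nlinarith [hτ.1, hτ.2]

lemma hasDerivAt_segment (c d : V) (τ : ℝ) : HasDerivAt (fun τ : ℝ => d + τ • (c - d)) (c - d) τ := by
  simpa using ((hasDerivAt_id τ).smul_const (c - d)).const_add d

/-- Both endpoints are moved along segments from a', b' to a, b. The derivative of f(B) - f(A) is f'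
applied to the difference of increments, plus a difference of f' over the short distance |B - A| ≤
m. -/
lemma norm_rectangle_le {f : V → W} {f' : V → V →L[ℝ] W} {L m : ℝ}
    (hf : ∀ x, HasFDerivAt f (f' x) x) (hL : ∀ x y, ‖f' x - f' y‖ ≤ L * ‖x - y‖)
    (hL0 : ∀ x, ‖f' x‖ ≤ L) {a b a' b' : V} (hm : ‖b - a‖ ≤ m) (hm' : ‖b' - a'‖ ≤ m) :
    ‖(f b - f a) - (f b' - f a')‖ ≤ L * ‖(b - a) - (b' - a')‖ + L * m * ‖a - a'‖ := by
  have hLn : 0 ≤ L := (norm_nonneg _).trans (hL0 0)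
  have hd : ∀ τ : ℝ, HasDerivAt (fun τ : ℝ => f (b' + τ • (b - b')) - f (a' + τ • (a - a')))
      (f' (b' + τ • (b - b')) (b - b') - f' (a' + τ • (a - a')) (a - a')) τ := fun τ =>
    ((hf _).comp_hasDerivAt τ (hasDerivAt_segment b b' τ)).sub
      ((hf _).comp_hasDerivAt τ (hasDerivAt_segment a a' τ))
  have := norm_image_sub_le_of_norm_deriv_le_segment_01'
    (C := L * ‖(b - a) - (b' - a')‖ + L * m * ‖a - a'‖)
    (fun τ _ => (hd τ).hasDerivWithinAt) (fun τ hτ => by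
      have e : f' (b' + τ • (b - b')) (b - b') - f' (a' + τ • (a - a')) (a - a') =
          f' (b' + τ • (b - b')) ((b - a) - (b' - a')) +
          (f' (b' + τ • (b - b')) - f' (a' + τ • (a - a'))) (a - a') := by
        simp only [sub_apply, map_sub]; abel
      rw [e]
      have h1 : ‖b' + τ • (b - b') - (a' + τ • (a - a'))‖ ≤ m := by
        have := norm_segment_le ⟨hτ.1, hτ.2.le⟩ hm hm'
        convert this using 2
        module
      refine norm_add_le_of_le ((ContinuousLinearMap.le_opNorm _ _).trans ?_)
        ((ContinuousLinearMap.le_opNorm _ _).trans ?_)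
      · gcongr; exact hL0 _
      · gcongr; exact (hL _ _).trans (by gcongr))
  simpa [sub_sub_sub_comm] using this

/-- The same homotopy for the first-order Taylor remainder. In the derivative, the terms with a - a'
combine to the Taylor remainder of f', of order m². This is where a Lipschitz second derivative, and
so C³ regularity of g, is needed. -/
lemma norm_taylor_sub_le {f : V → W} {f' : V → V →L[ℝ] W} {f'' : V → V →L[ℝ] V →L[ℝ] W}
    {L m : ℝ} (hf : ∀ x, HasFDerivAt f (f' x) x) (hf' : ∀ x, HasFDerivAt f' (f'' x) x)
    (hsymm : ∀ x v w, f'' x v w = f'' x w v) (hL : ∀ x y, ‖f' x - f' y‖ ≤ L * ‖x - y‖)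
    (hL' : ∀ x y, ‖f'' x - f'' y‖ ≤ L * ‖x - y‖) (hLn : 0 ≤ L)
    {a b a' b' : V} (hm : ‖b - a‖ ≤ m) (hm' : ‖b' - a'‖ ≤ m) :
    ‖(f b - f a - f' a (b - a)) - (f b' - f a' - f' a' (b' - a'))‖ ≤
      L * m ^ 2 * ‖a - a'‖ + L * m * ‖(b - a) - (b' - a')‖ := by
  have hm0 : 0 ≤ m := (norm_nonneg _).trans hm
  set A : ℝ → V := fun τ => a' + τ • (a - a') with hA
  set B : ℝ → V := fun τ => b' + τ • (b - b') with hB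
  have hdA : ∀ τ, HasDerivAt A (a - a') τ := hasDerivAt_segment a a'
  have hdB : ∀ τ, HasDerivAt B (b - b') τ := hasDerivAt_segment b b'
  have hd : ∀ τ : ℝ, HasDerivAt (fun τ => f (B τ) - f (A τ) - f' (A τ) (B τ - A τ))
      (f' (B τ) (b - b') - f' (A τ) (a - a') -
        (f'' (A τ) (a - a') (B τ - A τ) + f' (A τ) ((b - b') - (a - a')))) τ := fun τ => by
    have h1 := (hf _).comp_hasDerivAt τ (hdB τ)
    have h2 := (hf _).comp_hasDerivAt τ (hdA τ)
    have h3 := ((hf' _).comp_hasDerivAt τ (hdA τ)).clm_apply ((hdB τ).sub (hdA τ))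
    exact (h1.sub h2).sub h3
  have := norm_image_sub_le_of_norm_deriv_le_segment_01'
    (C := L * m ^ 2 * ‖a - a'‖ + L * m * ‖(b - a) - (b' - a')‖)
    (fun τ _ => (hd τ).hasDerivWithinAt) (fun τ hτ => by
      have h1 : ‖B τ - A τ‖ ≤ m := by
        have := norm_segment_le ⟨hτ.1, hτ.2.le⟩ hm hm'
        convert this using 2
        simp only [hA, hB]
        module
      have e : f' (B τ) (b - b') - f' (A τ) (a - a') -
          (f'' (A τ) (a - a') (B τ - A τ) + f' (A τ) ((b - b') - (a - a'))) =
          (f' (B τ) - f' (A τ) - f'' (A τ) (B τ - A τ)) (a - a') +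
            (f' (B τ) - f' (A τ)) ((b - a) - (b' - a')) := by
        -- Symmetry of the second derivative lets the increment B - A be the first argument, as the
        -- Taylor expansion of f' requires.
        rw [hsymm, sub_sub_sub_comm b a b' a']
        simp only [sub_apply, map_sub]
        abel
      rw [e]
      refine norm_add_le_of_le ((ContinuousLinearMap.le_opNorm _ _).trans ?_)
        ((ContinuousLinearMap.le_opNorm _ _).trans ?_)
      · gcongr
        exact (norm_taylor_le hf' hL' _ _).trans (by gcongr)
      · gcongr
        exact (hL _ _).trans (by gcongr))
  simpa [hA, hB] using this

end Taylor

/-! ### Stability of the germ of the rough integral -/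

section Germ

variable {n : ℕ}

/-- Bounds on `g` and its first three derivatives. -/
structure C3Bound (L : ℝ) (g : Vec n → Mat n) : Prop where
  d1 : ∀ x, HasFDerivAt g (fderiv ℝ g x) x
  d2 : ∀ x, HasFDerivAt (fderiv ℝ g) (fderiv ℝ (fderiv ℝ g) x) x
  symm : ∀ x v w, fderiv ℝ (fderiv ℝ g) x v w = fderiv ℝ (fderiv ℝ g) x w v
  b0 : ∀ x, ‖g x‖ ≤ L
  b1 : ∀ x, ‖fderiv ℝ g x‖ ≤ L
  b2 : ∀ x, ‖fderiv ℝ (fderiv ℝ g) x‖ ≤ L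
  l0 : ∀ x y, ‖g x - g y‖ ≤ L * ‖x - y‖
  l1 : ∀ x y, ‖fderiv ℝ g x - fderiv ℝ g y‖ ≤ L * ‖x - y‖
  l2 : ∀ x y, ‖fderiv ℝ (fderiv ℝ g) x - fderiv ℝ (fderiv ℝ g) y‖ ≤ L * ‖x - y‖

/-- The data at a fixed time; `w` is the regular part of the solution. -/
structure Slice (n : ℕ) where
  X : ℝ → Vec n
  XX : ℝ → ℝ → Tens n
  Ψ : ℝ → Vec n
  Ψ' : ℝ → Mat n
  R : ℝ → ℝ → Vec n
  w : ℝ → Vec n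

/-- Contraction of a tensor with `Y'` and `Z'`. -/
def contract (T : Tens n) (Y' : Vec n →L[ℝ] Mat n) (Z' : Mat n) : Vec n :=
  ∑ k : Fin n, ∑ l : Fin n,
    T (k, l) • (Y' (EuclideanSpace.single k 1)) (Z' (EuclideanSpace.single l 1))

namespace Slice

/-- The solution at a fixed time. -/
def u (P : Slice n) (x : ℝ) : Vec n := P.w x + P.Ψ x

/-- The derivative of `g(u)` with respect to `X`. -/
def Y' (g : Vec n → Mat n) (P : Slice n) (x : ℝ) : Vec n →L[ℝ] Mat n :=
  (fderiv ℝ g (P.u x)).comp (P.Ψ' x)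

/-- The remainder of `g(u)` as a path controlled by `X`. -/
def RY (g : Vec n → Mat n) (P : Slice n) (x y : ℝ) : Mat n :=
  (g (P.u y) - g (P.u x) - fderiv ℝ g (P.u x) (P.u y - P.u x)) +
    fderiv ℝ g (P.u x) (incr P.w x y + P.R x y)

/-- The germ of the rough integral `∫ g(u) dΨ`. -/
def germ (g : Vec n → Mat n) (P : Slice n) (x y : ℝ) : Vec n :=
  secondOrder P.XX (fun x => g (P.u x)) (P.Y' g) P.Ψ P.Ψ' x y

/-- Chen's relation, and the expansion of `Ψ`. -/
structure IsRough (P : Slice n) : Prop where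
  chen : ∀ x y z : ℝ, 0 ≤ x → x ≤ y → y ≤ z → z ≤ 1 → ∀ i j : Fin n,
    P.XX x z (i, j) - P.XX x y (i, j) - P.XX y z (i, j) = incr P.X x y i * incr P.X y z j
  controlled : ∀ x y : ℝ, 0 ≤ x → x ≤ y → y ≤ 1 →
    incr P.Ψ x y = P.Ψ' x (incr P.X x y) + P.R x y

lemma germ_eq (g : Vec n → Mat n) (P : Slice n) (x y : ℝ) :
    P.germ g x y = g (P.u x) (incr P.Ψ x y) + contract (P.XX x y) (P.Y' g x) (P.Ψ' x) := rfl

/-- g(u) is controlled by X with derivative Dg(u)Ψ'. The increments of the regular part w are of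
order 2α and go to the remainder. -/
lemma incr_g (g : Vec n → Mat n) (P : Slice n) (h : P.IsRough) {x y : ℝ} (hx : 0 ≤ x)
    (hxy : x ≤ y) (hy : y ≤ 1) :
    g (P.u y) - g (P.u x) = P.RY g x y + P.Y' g x (incr P.X x y) := by
  have e : P.u y - P.u x = incr P.w x y + incr P.Ψ x y := by simp only [u, incr]; abel
  rw [RY, Y', e, h.controlled x y hx hxy hy, ContinuousLinearMap.comp_apply]
  simp only [map_add]
  abel

lemma clm_eq_sum {F : Type*} [NormedAddCommGroup F] [NormedSpace ℝ F] (S : Vec n →L[ℝ] F)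
    (v : Vec n) : S v = ∑ k : Fin n, v k • S (EuclideanSpace.single k 1) := by
  conv_lhs => rw [← (EuclideanSpace.basisFun (Fin n) ℝ).sum_repr v]
  simp

/-- Chen's relation, tested against the basis expansions of the two linear maps. -/
lemma contract_chen (P : Slice n) (h : P.IsRough) {x y z : ℝ} (hx : 0 ≤ x)
    (hxy : x ≤ y) (hyz : y ≤ z) (hz : z ≤ 1) (Y' : Vec n →L[ℝ] Mat n) (Z' : Mat n) :
    contract (P.XX x z) Y' Z' - contract (P.XX x y) Y' Z' =
      contract (P.XX y z) Y' Z' + Y' (incr P.X x y) (Z' (incr P.X y z)) := by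
  have e : Y' (incr P.X x y) (Z' (incr P.X y z)) = ∑ k : Fin n, ∑ l : Fin n,
      (incr P.X x y k * incr P.X y z l) •
        (Y' (EuclideanSpace.single k 1)) (Z' (EuclideanSpace.single l 1)) := by
    rw [clm_eq_sum Y', sum_apply]
    refine Finset.sum_congr rfl fun k _ => ?_
    rw [clm_eq_sum Z', map_sum]
    refine Finset.sum_congr rfl fun l _ => ?_
    rw [smul_apply, map_smul, smul_smul]
  rw [e]
  simp only [contract, ← Finset.sum_sub_distrib, ← Finset.sum_add_distrib]
  refine Finset.sum_congr rfl fun k _ => Finset.sum_congr rfl fun l _ => ?_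
  rw [← h.chen x y z hx hxy hyz hz k l]
  module

/-- All terms of order below 3α cancel: the first-order terms by additivity of δΨ, and Y' δX δΨ
against the Chen product after expanding δΨ(y,z) at x. Each surviving term pairs an increment of
order α with one of order 2α, or multiplies three increments of order α. -/
lemma germ_defect (g : Vec n → Mat n) (P : Slice n) (h : P.IsRough) {x y z : ℝ} (hx : 0 ≤ x)
    (hxy : x ≤ y) (hyz : y ≤ z) (hz : z ≤ 1) :
    P.germ g x z - P.germ g x y - P.germ g y z =
      -(P.RY g x y (incr P.Ψ y z)) - P.Y' g x (incr P.X x y) (P.R y z)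
        - P.Y' g x (incr P.X x y) (incr P.Ψ' x y (incr P.X y z))
        - (contract (P.XX y z) (P.Y' g y) (P.Ψ' y) - contract (P.XX y z) (P.Y' g x) (P.Ψ' x)) := by
  have e1 : incr P.Ψ x z = incr P.Ψ x y + incr P.Ψ y z := by simp only [incr]; abel
  have e2 := incr_g g P h hx hxy (hyz.trans hz)
  have e3 := contract_chen P h hx hxy hyz hz (P.Y' g x) (P.Ψ' x)
  have e4 : (P.RY g x y) (incr P.Ψ y z) = g (P.u y) (incr P.Ψ y z) - g (P.u x) (incr P.Ψ y z) -
      P.Y' g x (incr P.X x y) (incr P.Ψ y z) := by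
    rw [← sub_eq_of_eq_add e2]; rfl
  have e5 := congrArg (P.Y' g x (incr P.X x y)) (h.controlled y z (hx.trans hxy) hyz hz)
  rw [map_add] at e5
  have e6 : incr P.Ψ' x y (incr P.X y z) = P.Ψ' y (incr P.X y z) - P.Ψ' x (incr P.X y z) := rfl
  rw [← sub_eq_iff_eq_add] at e5 e3
  rw [germ_eq, germ_eq, germ_eq, e1, e4, e6, map_add, map_sub, ← e5, ← e3]
  abel

/-- Two slices with the same bounds, whose difference is of order `δ`. -/
structure Close (α A B δ : ℝ) (P Q : Slice n) : Prop where
  left : P.IsRough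
  right : Q.IsRough
  X : ∀ x y, 0 ≤ x → x ≤ y → y ≤ 1 → Near δ (A * (y - x) ^ α) (incr P.X x y) (incr Q.X x y)
  XX : ∀ x y, 0 ≤ x → x ≤ y → y ≤ 1 → Near δ (A * ((y - x) ^ α) ^ 2) (P.XX x y) (Q.XX x y)
  Ψ : ∀ x y, 0 ≤ x → x ≤ y → y ≤ 1 → Near δ (A * (y - x) ^ α) (incr P.Ψ x y) (incr Q.Ψ x y)
  Ψ_sup : ∀ x, 0 ≤ x → x ≤ 1 → ‖P.Ψ x - Q.Ψ x‖ ≤ A * δ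
  Ψ' : ∀ x y, 0 ≤ x → x ≤ y → y ≤ 1 → Near δ (A * (y - x) ^ α) (incr P.Ψ' x y) (incr Q.Ψ' x y)
  Ψ'_sup : ∀ x, 0 ≤ x → x ≤ 1 → Near δ A (P.Ψ' x) (Q.Ψ' x)
  R : ∀ x y, 0 ≤ x → x ≤ y → y ≤ 1 → Near δ (A * ((y - x) ^ α) ^ 2) (P.R x y) (Q.R x y)
  w : ∀ x y, 0 ≤ x → x ≤ y → y ≤ 1 → Near δ (A * (y - x) ^ α) (incr P.w x y) (incr Q.w x y)
  w_two : ∀ x y, 0 ≤ x → x ≤ y → y ≤ 1 →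
    Near δ (A * B * ((y - x) ^ α) ^ 2) (incr P.w x y) (incr Q.w x y)
  w_sup : ∀ x, 0 ≤ x → x ≤ 1 → ‖P.w x - Q.w x‖ ≤ A * δ

namespace Close

variable {α A B δ L : ℝ} {P Q : Slice n} {g : Vec n → Mat n}

lemma u_sup (h : Close α A B δ P Q) {x : ℝ} (hx : 0 ≤ x) (hx1 : x ≤ 1) :
    ‖P.u x - Q.u x‖ ≤ 2 * A * δ := by
  rw [u, u, add_sub_add_comm]
  exact (norm_add_le_of_le (h.w_sup x hx hx1) (h.Ψ_sup x hx hx1)).trans (le_of_eq (by ring))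

lemma u_incr (h : Close α A B δ P Q) {x y : ℝ} (hx : 0 ≤ x) (hxy : x ≤ y) (hy : y ≤ 1) :
    Near δ (2 * A * (y - x) ^ α) (P.u y - P.u x) (Q.u y - Q.u x) := by
  have e : ∀ P : Slice n, P.u y - P.u x = incr P.w x y + incr P.Ψ x y := fun P => by
    simp only [u, incr]; abel
  rw [e, e, show 2 * A * (y - x) ^ α = A * (y - x) ^ α + A * (y - x) ^ α by ring]
  exact (h.w x y hx hxy hy).add (h.Ψ x y hx hxy hy)

lemma g_near (h : Close α A B δ P Q) (hg : C3Bound L g) (hL : 0 ≤ L) (hLA : L ≤ A) (hA : 1 ≤ A)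
    {x : ℝ} (hx : 0 ≤ x) (hx1 : x ≤ 1) :
    Near δ (2 * A ^ 2) (g (P.u x)) (g (Q.u x)) := by
  refine ⟨(hg.b0 _).trans (by nlinarith), (hg.b0 _).trans (by nlinarith), (hg.l0 _ _).trans ?_⟩
  calc L * ‖P.u x - Q.u x‖ ≤ A * (2 * A * δ) := by gcongr; exact h.u_sup hx hx1
    _ = _ := by ring

lemma dg_near (h : Close α A B δ P Q) (hg : C3Bound L g) (hL : 0 ≤ L) (hLA : L ≤ A) (hA : 1 ≤ A)
    {x : ℝ} (hx : 0 ≤ x) (hx1 : x ≤ 1) :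
    Near δ (2 * A ^ 2) (fderiv ℝ g (P.u x)) (fderiv ℝ g (Q.u x)) := by
  refine ⟨(hg.b1 _).trans (by nlinarith), (hg.b1 _).trans (by nlinarith), (hg.l1 _ _).trans ?_⟩
  calc L * ‖P.u x - Q.u x‖ ≤ A * (2 * A * δ) := by gcongr; exact h.u_sup hx hx1
    _ = _ := by ring

lemma Y'_near (h : Close α A B δ P Q) (hg : C3Bound L g) (hL : 0 ≤ L) (hLA : L ≤ A) (hA : 1 ≤ A)
    (hδ : 0 ≤ δ) {x : ℝ} (hx : 0 ≤ x) (hx1 : x ≤ 1) :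
    Near δ (4 * A ^ 3) (P.Y' g x) (Q.Y' g x) :=
  ((h.dg_near hg hL hLA hA hx hx1).comp hδ (h.Ψ'_sup x hx hx1)).mono hδ (le_of_eq (by ring))

lemma dg_incr (h : Close α A B δ P Q) (hg : C3Bound L g) (hL : 0 ≤ L) (hLA : L ≤ A) (hA : 1 ≤ A)
    (hδ : 0 ≤ δ) {x y : ℝ} (hx : 0 ≤ x) (hxy : x ≤ y) (hy : y ≤ 1) :
    Near δ (6 * A ^ 3 * (y - x) ^ α) (fderiv ℝ g (P.u y) - fderiv ℝ g (P.u x))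
      (fderiv ℝ g (Q.u y) - fderiv ℝ g (Q.u x)) := by
  have hu := h.u_incr hx hxy hy
  have hs : 0 ≤ (y - x) ^ α := Real.rpow_nonneg (sub_nonneg.2 hxy) _
  have hA0 : 0 ≤ A := by linarith
  have hA2 : A ^ 2 ≤ A ^ 3 := pow_le_pow_right₀ hA (by norm_num)
  have l : L * (2 * A * (y - x) ^ α) ≤ 6 * A ^ 3 * (y - x) ^ α := by
    calc L * (2 * A * (y - x) ^ α) ≤ A * (2 * A * (y - x) ^ α) := by gcongr
      _ = 2 * A ^ 2 * (y - x) ^ α := by ring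
      _ ≤ _ := by gcongr; norm_num
  refine ⟨(hg.l1 _ _).trans (le_trans (by gcongr; exact hu.left) l),
    (hg.l1 _ _).trans (le_trans (by gcongr; exact hu.right) l),
    (norm_rectangle_le hg.d2 hg.l2 hg.b2 hu.left hu.right).trans ?_⟩
  calc L * ‖P.u y - P.u x - (Q.u y - Q.u x)‖ + L * (2 * A * (y - x) ^ α) * ‖P.u x - Q.u x‖
      ≤ A * (2 * A * (y - x) ^ α * δ) + A * (2 * A * (y - x) ^ α) * (2 * A * δ) := by
        gcongr
        · exact hu.diff
        · exact h.u_sup hx (hxy.trans hy)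
    _ = (2 * A ^ 2 + 4 * A ^ 3) * (y - x) ^ α * δ := by ring
    _ ≤ _ := by gcongr; linarith

/-- `B` enters only through the increments of w, where the derivative of g is applied linearly. The
Taylor remainder is quadratic, but there the α-Hölder bound of u is enough, and this bound does not
involve `B`. -/
lemma RY_near (h : Close α A B δ P Q) (hg : C3Bound L g) (hL : 0 ≤ L) (hLA : L ≤ A) (hA : 1 ≤ A)
    (hB : 1 ≤ B) (hδ : 0 ≤ δ) {x y : ℝ} (hx : 0 ≤ x) (hxy : x ≤ y) (hy : y ≤ 1) :
    Near δ (20 * A ^ 4 * B * ((y - x) ^ α) ^ 2) (P.RY g x y) (Q.RY g x y) := by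
  have hu := h.u_incr hx hxy hy
  have hs : 0 ≤ (y - x) ^ α := Real.rpow_nonneg (sub_nonneg.2 hxy) _
  have hA0 : 0 ≤ A := by linarith
  have hA2 : A ^ 2 ≤ A ^ 4 := pow_le_pow_right₀ hA (by norm_num)
  have hA3 : A ^ 3 ≤ A ^ 4 := pow_le_pow_right₀ hA (by norm_num)
  have l : L * (2 * A * (y - x) ^ α) ^ 2 ≤ 12 * A ^ 4 * ((y - x) ^ α) ^ 2 := by
    calc L * (2 * A * (y - x) ^ α) ^ 2 ≤ A * (2 * A * (y - x) ^ α) ^ 2 := by gcongr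
      _ = 4 * A ^ 3 * ((y - x) ^ α) ^ 2 := by ring
      _ ≤ _ := by gcongr; norm_num
  have hT : Near δ (12 * A ^ 4 * ((y - x) ^ α) ^ 2)
      (g (P.u y) - g (P.u x) - fderiv ℝ g (P.u x) (P.u y - P.u x))
      (g (Q.u y) - g (Q.u x) - fderiv ℝ g (Q.u x) (Q.u y - Q.u x)) := by
    refine ⟨(norm_taylor_le hg.d1 hg.l1 _ _).trans (le_trans (by gcongr; exact hu.left) l),
      (norm_taylor_le hg.d1 hg.l1 _ _).trans (le_trans (by gcongr; exact hu.right) l),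
      (norm_taylor_sub_le hg.d1 hg.d2 hg.symm hg.l1 hg.l2 hL hu.left hu.right).trans ?_⟩
    calc L * (2 * A * (y - x) ^ α) ^ 2 * ‖P.u x - Q.u x‖ +
          L * (2 * A * (y - x) ^ α) * ‖P.u y - P.u x - (Q.u y - Q.u x)‖
        ≤ A * (2 * A * (y - x) ^ α) ^ 2 * (2 * A * δ) +
          A * (2 * A * (y - x) ^ α) * (2 * A * (y - x) ^ α * δ) := by
          gcongr
          · exact h.u_sup hx (hxy.trans hy)
          · exact hu.diff
      _ = (8 * A ^ 4 + 4 * A ^ 3) * ((y - x) ^ α) ^ 2 * δ := by ring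
      _ ≤ _ := by gcongr; linarith
  refine (hT.add ((h.dg_near hg hL hLA hA hx (hxy.trans hy)).apply hδ
    ((h.w_two x y hx hxy hy).add (h.R x y hx hxy hy)))).mono hδ ?_
  have h1 : A ^ 4 * 1 ≤ A ^ 4 * B := by gcongr
  have h2 : A ^ 3 * B ≤ A ^ 4 * B := by gcongr
  calc _ = (12 * A ^ 4 + 4 * (A ^ 3 * B) + 4 * A ^ 3) * ((y - x) ^ α) ^ 2 := by ring
    _ ≤ _ := by gcongr; linarith

lemma contract_near {a b c : ℝ} (hδ : 0 ≤ δ) {T T' : Tens n} {Y Y' : Vec n →L[ℝ] Mat n}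
    {Z Z' : Mat n} (hT : Near δ a T T') (hY : Near δ b Y Y') (hZ : Near δ c Z Z') :
    Near δ (n ^ 2 * (4 * a * b * c)) (contract T Y Z) (contract T' Y' Z') := by
  have hk : ∀ k : Fin n, ‖(EuclideanSpace.single k 1 : Vec n)‖ = 1 := fun k => by simp
  have hTc : ∀ q, Near δ a (T q) (T' q) := fun q => by
    refine ⟨(PiLp.norm_apply_le T q).trans hT.left, (PiLp.norm_apply_le T' q).trans hT.right, ?_⟩
    exact (PiLp.norm_apply_le (T - T') q).trans hT.diff
  have := Near.sum Finset.univ fun (k : Fin n) _ => Near.sum Finset.univ fun (l : Fin n) _ =>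
    (hTc (k, l)).smul hδ ((hY.apply_unit (hk k)).apply hδ (hZ.apply_unit (hk l)))
  refine this.mono hδ (le_of_eq ?_)
  simp only [Finset.card_univ, Fintype.card_fin]
  ring

lemma contract_sub_eq (T : Tens n) (Y₁ Y₂ : Vec n →L[ℝ] Mat n) (Z₁ Z₂ : Mat n) :
    contract T Y₁ Z₁ - contract T Y₂ Z₂ = contract T (Y₁ - Y₂) Z₁ + contract T Y₂ (Z₁ - Z₂) := by
  simp only [contract, ← Finset.sum_sub_distrib, ← Finset.sum_add_distrib]
  refine Finset.sum_congr rfl fun k _ => Finset.sum_congr rfl fun l _ => ?_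
  simp only [sub_apply, map_sub]
  module

lemma Y'_incr (h : Close α A B δ P Q) (hg : C3Bound L g) (hL : 0 ≤ L) (hLA : L ≤ A) (hA : 1 ≤ A)
    (hδ : 0 ≤ δ) {x y : ℝ} (hx : 0 ≤ x) (hxy : x ≤ y) (hy : y ≤ 1) :
    Near δ (16 * A ^ 4 * (y - x) ^ α) (P.Y' g y - P.Y' g x) (Q.Y' g y - Q.Y' g x) := by
  have hs : 0 ≤ (y - x) ^ α := Real.rpow_nonneg (sub_nonneg.2 hxy) _
  have hA0 : 0 ≤ A := by linarith
  have hA3 : A ^ 3 ≤ A ^ 4 := pow_le_pow_right₀ hA (by norm_num)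
  have e : ∀ P : Slice n, P.Y' g y - P.Y' g x =
      (fderiv ℝ g (P.u y) - fderiv ℝ g (P.u x)).comp (P.Ψ' y) +
        (fderiv ℝ g (P.u x)).comp (incr P.Ψ' x y) := fun P => by
    simp only [Y', incr, ContinuousLinearMap.sub_comp, ContinuousLinearMap.comp_sub]
    abel
  rw [e, e]
  refine (((h.dg_incr hg hL hLA hA hδ hx hxy hy).comp hδ (h.Ψ'_sup y (hx.trans hxy) hy)).add
    ((h.dg_near hg hL hLA hA hx (hxy.trans hy)).comp hδ (h.Ψ' x y hx hxy hy))).mono hδ ?_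
  calc _ = (12 * A ^ 4 + 4 * A ^ 3) * (y - x) ^ α := by ring
    _ ≤ _ := by gcongr; linarith

/-- The constant in the stability of the germ. -/
def germConst (n : ℕ) (A : ℝ) : ℝ := (200 + 200 * n ^ 2) * A ^ 6

/-- Only the α-Hölder bounds enter, so the size of the germ is free of `B`; the singularity in time
sits in the defect alone. -/
lemma germ_near (h : Close α A B δ P Q) (hg : C3Bound L g) (hL : 0 ≤ L) (hLA : L ≤ A) (hA : 1 ≤ A)
    (hδ : 0 ≤ δ) (hα : 0 ≤ α) {x y : ℝ} (hx : 0 ≤ x) (hxy : x ≤ y) (hy : y ≤ 1) :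
    Near δ (germConst n A * (y - x) ^ α) (P.germ g x y) (Q.germ g x y) := by
  have hs : 0 ≤ (y - x) ^ α := Real.rpow_nonneg (sub_nonneg.2 hxy) _
  have hs1 : (y - x) ^ α ≤ 1 := Real.rpow_le_one (sub_nonneg.2 hxy) (by linarith) hα
  have hA0 : 0 ≤ A := by linarith
  have hA3 : A ^ 3 ≤ A ^ 6 := pow_le_pow_right₀ hA (by norm_num)
  have hA5 : A ^ 5 ≤ A ^ 6 := pow_le_pow_right₀ hA (by norm_num)
  have hx1 := hxy.trans hy
  rw [germ_eq, germ_eq]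
  refine (((h.g_near hg hL hLA hA hx hx1).apply hδ (h.Ψ x y hx hxy hy)).add
    (contract_near hδ (h.XX x y hx hxy hy) (h.Y'_near hg hL hLA hA hδ hx hx1)
      (h.Ψ'_sup x hx hx1))).mono hδ ?_
  set s := (y - x) ^ α
  calc _ = (4 * A ^ 3 + 16 * (n ^ 2 * A ^ 5) * s) * s := by ring
    _ ≤ (4 * A ^ 6 + 16 * (n ^ 2 * A ^ 6) * 1) * s := by gcongr
    _ ≤ germConst n A * s := by
      rw [germConst]
      gcongr
      have : 0 ≤ (n : ℝ) ^ 2 * A ^ 6 := by positivity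
      have : 0 ≤ A ^ 6 := by positivity
      linarith

/-- Each term of the defect carries three α-powers, and just the one with the remainder of g(u)
carries `B`. Linearity in `B` is essential: it will be a negative power of s, and higher powers need
not match the available smoothing. -/
lemma defect_near (h : Close α A B δ P Q) (hg : C3Bound L g) (hL : 0 ≤ L) (hLA : L ≤ A)
    (hA : 1 ≤ A) (hB : 1 ≤ B) (hδ : 0 ≤ δ) (hα : 0 ≤ α) {x y z : ℝ} (hx : 0 ≤ x) (hxy : x ≤ y)
    (hyz : y ≤ z) (hz : z ≤ 1) :
    Near δ (germConst n A * B * ((z - x) ^ α) ^ 3)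
      (P.germ g x z - P.germ g x y - P.germ g y z)
      (Q.germ g x z - Q.germ g x y - Q.germ g y z) := by
  have hy := hyz.trans hz
  have hy0 := hx.trans hxy
  have hx1 := hxy.trans hy
  have hA0 : 0 ≤ A := by linarith
  have hB0 : 0 ≤ B := by linarith
  have hA5 : A ^ 5 ≤ A ^ 6 := pow_le_pow_right₀ hA (by norm_num)
  have s1 : 0 ≤ (y - x) ^ α := Real.rpow_nonneg (sub_nonneg.2 hxy) _
  have s2 : 0 ≤ (z - y) ^ α := Real.rpow_nonneg (sub_nonneg.2 hyz) _
  have m1 : (y - x) ^ α ≤ (z - x) ^ α :=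
    Real.rpow_le_rpow (sub_nonneg.2 hxy) (by linarith) hα
  have m2 : (z - y) ^ α ≤ (z - x) ^ α :=
    Real.rpow_le_rpow (sub_nonneg.2 hyz) (by linarith) hα
  rw [germ_defect g P h.left hx hxy hyz hz, germ_defect g Q h.right hx hxy hyz hz,
    contract_sub_eq, contract_sub_eq]
  have k1 := (h.RY_near hg hL hLA hA hB hδ hx hxy hy).apply hδ (h.Ψ y z hy0 hyz hz)
  have kY := (h.Y'_near hg hL hLA hA hδ hx hx1).apply hδ (h.X x y hx hxy hy)
  have k2 := kY.apply hδ (h.R y z hy0 hyz hz)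
  have k3 := kY.apply hδ ((h.Ψ' x y hx hxy hy).apply hδ (h.X y z hy0 hyz hz))
  have k4 := contract_near hδ (h.XX y z hy0 hyz hz) (h.Y'_incr hg hL hLA hA hδ hx hxy hy)
    (h.Ψ'_sup y hy0 hy)
  have k5 := contract_near hδ (h.XX y z hy0 hyz hz) (h.Y'_near hg hL hLA hA hδ hx hx1)
    (h.Ψ' x y hx hxy hy)
  refine (((k1.neg.sub k2).sub k3).sub (k4.add k5)).mono hδ ?_
  set s := (z - x) ^ α
  set a := (y - x) ^ α
  set b := (z - y) ^ α
  have hs : 0 ≤ s := s1.trans m1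
  have t1 : a ^ 2 * b ≤ s ^ 3 := by
    calc a ^ 2 * b ≤ s ^ 2 * s := by gcongr
      _ = s ^ 3 := by ring
  have t2 : a * b ^ 2 ≤ s ^ 3 := by
    calc a * b ^ 2 ≤ s * s ^ 2 := by gcongr
      _ = s ^ 3 := by ring
  have g1 : 1 * s ^ 3 ≤ B * s ^ 3 := by gcongr
  have g0 : 0 ≤ B * s ^ 3 := by positivity
  calc _ = 40 * A ^ 5 * B * (a ^ 2 * b) + 16 * A ^ 5 * (a * b ^ 2) + 32 * A ^ 6 * (a ^ 2 * b)
        + 64 * n ^ 2 * A ^ 6 * (a * b ^ 2) + 16 * n ^ 2 * A ^ 5 * (a * b ^ 2) := by ring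
    _ ≤ 40 * A ^ 6 * B * s ^ 3 + 16 * A ^ 6 * s ^ 3 + 32 * A ^ 6 * s ^ 3
        + 64 * n ^ 2 * A ^ 6 * s ^ 3 + 16 * n ^ 2 * A ^ 6 * s ^ 3 := by gcongr
    _ = 40 * A ^ 6 * (B * s ^ 3) + (48 * A ^ 6 + 80 * n ^ 2 * A ^ 6) * (1 * s ^ 3) := by ring
    _ ≤ 40 * A ^ 6 * (B * s ^ 3) + (48 * A ^ 6 + 80 * n ^ 2 * A ^ 6) * (B * s ^ 3) := by gcongr
    _ = (88 + 80 * n ^ 2) * A ^ 6 * (B * s ^ 3) := by ring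
    _ ≤ (200 + 200 * n ^ 2) * A ^ 6 * (B * s ^ 3) := by
        gcongr
        · norm_num
        · norm_num
    _ = _ := by rw [germConst]; ring

end Close

end Slice

end Germ

/-! ### Norms with values in `[0,∞]` -/

section Norms

variable {F : Type*} [NormedAddCommGroup F]

lemma enorm_le_ofReal_iff {c : ℝ} (hc : 0 ≤ c) {x : F} : ‖x‖ₑ ≤ ENNReal.ofReal c ↔ ‖x‖ ≤ c := by
  rw [← ofReal_norm, ENNReal.ofReal_le_ofReal_iff hc]

lemma supNorm_le_iff {c : ℝ} (hc : 0 ≤ c) {f : ℝ → F} :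
    supNorm f ≤ ENNReal.ofReal c ↔ ∀ x ∈ Icc (0 : ℝ) 1, ‖f x‖ ≤ c := by
  simp only [supNorm, iSup_le_iff, enorm_le_ofReal_iff hc]

lemma holderTwo_le_iff {c p : ℝ} (hc : 0 ≤ c) {R : ℝ → ℝ → F} :
    holderTwo p R ≤ ENNReal.ofReal c ↔
      ∀ x ∈ Icc (0 : ℝ) 1, ∀ y ∈ Icc (0 : ℝ) 1, x ≠ y → ‖R x y‖ ≤ c * |x - y| ^ p := by
  simp only [holderTwo, iSup_le_iff]
  refine forall₂_congr fun x _ => forall₂_congr fun y _ => forall_congr' fun hxy => ?_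
  have h : 0 < |x - y| ^ p := Real.rpow_pos_of_pos (abs_pos.2 (sub_ne_zero.2 hxy)) _
  rw [ENNReal.div_le_iff (by simpa using h) ENNReal.ofReal_ne_top, ← ENNReal.ofReal_mul hc,
    enorm_le_ofReal_iff (by positivity)]

lemma norm_le_of_holderNorm {c p : ℝ} (hc : 0 ≤ c) {f : ℝ → F}
    (h : holderNorm p f ≤ ENNReal.ofReal c) : ∀ x ∈ Icc (0 : ℝ) 1, ‖f x‖ ≤ c :=
  (supNorm_le_iff hc).1 (le_self_add.trans h)

lemma incr_le_of_holderNorm {c p : ℝ} (hc : 0 ≤ c) (hp : 0 < p) {f : ℝ → F}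
    (h : holderNorm p f ≤ ENNReal.ofReal c) :
    ∀ x ∈ Icc (0 : ℝ) 1, ∀ y ∈ Icc (0 : ℝ) 1, ‖incr f x y‖ ≤ c * |x - y| ^ p := by
  intro x hx y hy
  rcases eq_or_ne x y with rfl | hxy
  · simp [incr, Real.zero_rpow hp.ne']
  · exact (holderTwo_le_iff hc).1 (le_add_self.trans h) x hx y hy hxy

lemma continuousOn_of_incr_le {c p : ℝ} (hp : 0 < p) {f : ℝ → F}
    (h : ∀ x ∈ Icc (0 : ℝ) 1, ∀ y ∈ Icc (0 : ℝ) 1, ‖incr f x y‖ ≤ c * |x - y| ^ p) :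
    ContinuousOn f (Icc 0 1) := by
  intro x hx
  rw [ContinuousWithinAt, tendsto_iff_norm_sub_tendsto_zero]
  have h1 : Tendsto (fun y => c * |x - y| ^ p) (𝓝 x) (𝓝 0) := by
    have : ContinuousAt (fun y => c * |x - y| ^ p) x :=
      continuousAt_const.mul (ContinuousAt.rpow_const (by fun_prop) (Or.inr hp.le))
    simpa [ContinuousAt, Real.zero_rpow hp.ne'] using this
  refine squeeze_zero' (Eventually.of_forall fun _ => norm_nonneg _) ?_
    (h1.mono_left nhdsWithin_le_nhds)
  filter_upwards [self_mem_nhdsWithin] with y hy using h x hx y hy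

lemma exists_ofReal_of_lt_top {a : ℝ≥0∞} (h : a < ⊤) : ∃ c : ℝ, 0 ≤ c ∧ a ≤ ENNReal.ofReal c :=
  ⟨a.toReal, ENNReal.toReal_nonneg, (ENNReal.ofReal_toReal h.ne).ge⟩

lemma continuousOn_of_holderNorm {p : ℝ} (hp : 0 < p) {f : ℝ → F} (h : holderNorm p f < ⊤) :
    ContinuousOn f (Icc 0 1) := by
  obtain ⟨c, hc, hfc⟩ := exists_ofReal_of_lt_top h
  exact continuousOn_of_incr_le hp (incr_le_of_holderNorm hc hp hfc)

lemma le_of_supTime {V : Type*} {T : ℝ} {N : V → ℝ≥0∞} {f : ℝ → V} {c : ℝ≥0∞}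
    (h : supTime T N f ≤ c) {t : ℝ} (ht : t ∈ Icc 0 T) : N (f t) ≤ c :=
  (le_iSup₂ (f := fun t (_ : t ∈ Icc 0 T) => N (f t)) t ht).trans h

/-- Continuity on `[0,T] × S` from continuity in each time, and uniform continuity of the path. -/
lemma continuousOn_path {Z : Type*} [TopologicalSpace Z] {S : Set Z} {T : ℝ} {f : ℝ → Z → F}
    (hc : ∀ t ∈ Icc 0 T, ContinuousOn (f t) S)
    (hN : ∀ t ∈ Icc 0 T, ∀ ε > 0, ∀ᶠ s in 𝓝[Icc 0 T] t, ∀ z ∈ S, ‖f s z - f t z‖ ≤ ε) :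
    ContinuousOn (fun q : ℝ × Z => f q.1 q.2) (Icc 0 T ×ˢ S) := by
  rintro ⟨t, z⟩ ⟨ht, hz⟩
  rw [ContinuousWithinAt, nhdsWithin_prod_eq, Metric.tendsto_nhds]
  intro ε hε
  have h1 := hN t ht (ε / 2) (half_pos hε)
  have h2 := Metric.tendsto_nhds.1 (hc t ht z hz) (ε / 2) (half_pos hε)
  have h3 : ∀ᶠ z' in 𝓝[S] z, z' ∈ S := self_mem_nhdsWithin
  filter_upwards [h1.prod_mk (h2.and h3)] with q hq
  have g1 := hq.1 q.2 hq.2.2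
  have g2 := hq.2.1
  rw [← dist_eq_norm] at g1
  exact (dist_triangle _ _ _).trans_lt (by linarith)

lemma eventually_of_tendsto {V : Type*} [Sub V] {T : ℝ} {N : V → ℝ≥0∞} {f : ℝ → V}
    (h : ContinuousPath T N f) {t : ℝ} (ht : t ∈ Icc 0 T) {ε : ℝ} (hε : 0 < ε) :
    ∀ᶠ s in 𝓝[Icc 0 T] t, N (f s - f t) ≤ ENNReal.ofReal ε := by
  have := (h t ht).eventually (gt_mem_nhds (ENNReal.ofReal_pos.2 hε))
  filter_upwards [this] with s hs using hs.le

lemma HolderPath.continuousOn {T p : ℝ} (hp : 0 < p) {f : ℝ → ℝ → F} (h : HolderPath T p f) :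
    ContinuousOn (fun q : ℝ × ℝ => f q.1 q.2) (Icc 0 T ×ˢ Icc 0 1) := by
  refine continuousOn_path (fun t ht => continuousOn_of_holderNorm hp (h.mem t ht))
    fun t ht ε hε => ?_
  filter_upwards [eventually_of_tendsto h.continuous ht hε] with s hs
  exact norm_le_of_holderNorm hε.le hs

lemma OmegaPath.continuousOn {T p : ℝ} (hp : 0 < p) {R : ℝ → ℝ → ℝ → F} (h : OmegaPath T p R) :
    ContinuousOn (fun q : ℝ × ℝ × ℝ => R q.1 q.2.1 q.2.2) (Icc 0 T ×ˢ (Icc 0 1 ×ˢ Icc 0 1)) := by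
  refine continuousOn_path (f := fun t (z : ℝ × ℝ) => R t z.1 z.2) (fun t ht => (h.mem t ht).continuousOn)
    fun t ht ε hε => ?_
  filter_upwards [eventually_of_tendsto h.continuous ht hε, self_mem_nhdsWithin] with s hs hsT z hz
  -- The seminorm does not see the diagonal, where both functions vanish by definition of the space.
  rcases eq_or_ne z.1 z.2 with hxy | hxy
  · rw [hxy, (h.mem s hsT).diag _ hz.2, (h.mem t ht).diag _ hz.2, sub_self, norm_zero]
    exact hε.le
  · refine ((holderTwo_le_iff hε.le).1 hs z.1 hz.1 z.2 hz.2 hxy).trans ?_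
    refine mul_le_of_le_one_right hε.le (Real.rpow_le_one (abs_nonneg _) ?_ hp.le)
    rw [abs_le]; constructor <;> linarith [hz.1.1, hz.1.2, hz.2.1, hz.2.2]

lemma continuous_clampPath {T : ℝ} (hT : 0 ≤ T) {f : ℝ → ℝ → F}
    (h : ContinuousOn (fun q : ℝ × ℝ => f q.1 q.2) (Icc 0 T ×ˢ Icc 0 1)) :
    Continuous fun q : ℝ × ℝ => f (clamp 0 T q.1) (clamp 0 1 q.2) :=
  h.comp_continuous (f := fun q : ℝ × ℝ => (clamp 0 T q.1, clamp 0 1 q.2))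
    (((continuous_clamp _ _).comp continuous_fst).prodMk ((continuous_clamp _ _).comp continuous_snd))
    fun _ => ⟨⟨le_clamp _ _ _, clamp_le hT _⟩, clamp_mem _⟩

lemma clamp_of_mem' {T t : ℝ} (ht : t ∈ Icc 0 T) : clamp 0 T t = t := by
  rw [clamp, min_eq_right ht.2, max_eq_right ht.1]

variable [NormedSpace ℝ F]

/-- Spatial derivative on `[0,1]`. -/
def dx (f : ℝ → F) (x : ℝ) : F := derivWithin f (Icc 0 1) x

lemma uniqueDiffOn_unit : UniqueDiffOn ℝ (Icc (0 : ℝ) 1) := uniqueDiffOn_Icc zero_lt_one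

lemma c1Norm_le {a b : ℝ} (ha : 0 ≤ a) (hb : 0 ≤ b) {f : ℝ → F}
    (h : ∀ x ∈ Icc (0 : ℝ) 1, ‖f x‖ ≤ a) (h' : ∀ x ∈ Icc (0 : ℝ) 1, ‖dx f x‖ ≤ b) :
    c1Norm f ≤ ENNReal.ofReal (a + b) := by
  rw [ENNReal.ofReal_add ha hb]
  exact add_le_add ((supNorm_le_iff ha).2 h) ((supNorm_le_iff hb).2 h')

lemma norm_le_of_c1Norm {c : ℝ} (hc : 0 ≤ c) {f : ℝ → F} (h : c1Norm f ≤ ENNReal.ofReal c) :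
    ∀ x ∈ Icc (0 : ℝ) 1, ‖f x‖ ≤ c :=
  (supNorm_le_iff hc).1 (le_self_add.trans h)

lemma norm_dx_le_of_c1Norm {c : ℝ} (hc : 0 ≤ c) {f : ℝ → F} (h : c1Norm f ≤ ENNReal.ofReal c) :
    ∀ x ∈ Icc (0 : ℝ) 1, ‖dx f x‖ ≤ c :=
  (supNorm_le_iff hc).1 (le_add_self.trans h)

lemma incr_le_of_c1Norm {c : ℝ} (hc : 0 ≤ c) {f : ℝ → F} (hf : ContDiffOn ℝ 1 f (Icc 0 1))
    (h : c1Norm f ≤ ENNReal.ofReal c) {x y : ℝ} (hx : x ∈ Icc (0 : ℝ) 1) (hy : y ∈ Icc (0 : ℝ) 1) :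
    ‖incr f x y‖ ≤ c * |y - x| :=
  (convex_Icc (0 : ℝ) 1).norm_image_sub_le_of_norm_derivWithin_le
    (hf.differentiableOn one_ne_zero) (norm_dx_le_of_c1Norm hc h) hx hy

lemma dx_sub {f h : ℝ → F} (hf : ContDiffOn ℝ 1 f (Icc 0 1)) (hh : ContDiffOn ℝ 1 h (Icc 0 1))
    {x : ℝ} (hx : x ∈ Icc (0 : ℝ) 1) : dx (f - h) x = dx f x - dx h x :=
  derivWithin_sub (hf.differentiableOn one_ne_zero x hx) (hh.differentiableOn one_ne_zero x hx)

lemma continuousOn_dx {f : ℝ → F} (hf : ContDiffOn ℝ 1 f (Icc 0 1)) :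
    ContinuousOn (dx f) (Icc 0 1) :=
  hf.continuousOn_derivWithin uniqueDiffOn_unit le_rfl

lemma C1Path.continuousOn {T : ℝ} {v : ℝ → ℝ → F} (h : C1Path T v) :
    ContinuousOn (fun q : ℝ × ℝ => v q.1 q.2) (Icc 0 T ×ˢ Icc 0 1) := by
  refine continuousOn_path (fun t ht => (h.mem t ht).continuousOn) fun t ht ε hε => ?_
  filter_upwards [eventually_of_tendsto h.continuous ht hε] with s hs
  exact norm_le_of_c1Norm hε.le hs

lemma C1Path.continuousOn_dx {T : ℝ} {v : ℝ → ℝ → F} (h : C1Path T v) :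
    ContinuousOn (fun q : ℝ × ℝ => dx (v q.1) q.2) (Icc 0 T ×ˢ Icc 0 1) := by
  refine continuousOn_path (f := fun t => dx (v t))
    (fun t ht => RoughBurgers.continuousOn_dx (h.mem t ht)) fun t ht ε hε => ?_
  filter_upwards [eventually_of_tendsto h.continuous ht hε, self_mem_nhdsWithin] with s hs hsT x hx
  rw [← dx_sub (h.mem s hsT) (h.mem t ht) hx]
  exact norm_dx_le_of_c1Norm hε.le hs x hx

end Norms

/-! ### Bounds on `g` -/

lemma C3Bound.of_c3Norm {n : ℕ} {g : Vec n → Mat n} (hg : ContDiff ℝ 3 g) {L : ℝ≥0}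
    (hL : c3Norm g ≤ L) : C3Bound (L : ℝ) g := by
  have hk : ∀ k < 4, ∀ x, ‖iteratedFDeriv ℝ k g x‖ ≤ L := fun k hk x => by
    refine (enorm_le_ofReal_iff L.coe_nonneg).1 ?_
    rw [ENNReal.ofReal_coe_nnreal]
    refine le_trans ?_ hL
    refine (le_iSup (fun x => ‖iteratedFDeriv ℝ k g x‖ₑ) x).trans ?_
    exact Finset.single_le_sum (f := fun k => ⨆ x : Vec n, ‖iteratedFDeriv ℝ k g x‖ₑ)
      (fun _ _ => zero_le) (Finset.mem_range.2 hk)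
  have c1 : ContDiff ℝ 2 (fderiv ℝ g) := hg.fderiv_right (by norm_num)
  have c2 : ContDiff ℝ 1 (fderiv ℝ (fderiv ℝ g)) := c1.fderiv_right (by norm_num)
  have d1 : ∀ x, HasFDerivAt g (fderiv ℝ g x) x := fun x =>
    (hg.differentiable (by norm_num) x).hasFDerivAt
  have d2 : ∀ x, HasFDerivAt (fderiv ℝ g) (fderiv ℝ (fderiv ℝ g) x) x := fun x =>
    (c1.differentiable (by norm_num) x).hasFDerivAt
  have d3 : ∀ x, HasFDerivAt (fderiv ℝ (fderiv ℝ g)) (fderiv ℝ (fderiv ℝ (fderiv ℝ g)) x) x :=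
    fun x => (c2.differentiable (by norm_num) x).hasFDerivAt
  have b1 : ∀ x, ‖fderiv ℝ g x‖ ≤ L := fun x => by
    rw [← norm_iteratedFDeriv_one]; exact hk 1 (by norm_num) x
  have b2 : ∀ x, ‖fderiv ℝ (fderiv ℝ g) x‖ ≤ L := fun x => by
    rw [← norm_iteratedFDeriv_one, norm_iteratedFDeriv_fderiv]
    exact hk 2 (by norm_num) x
  have b3 : ∀ x, ‖fderiv ℝ (fderiv ℝ (fderiv ℝ g)) x‖ ≤ L := fun x => by
    rw [← norm_iteratedFDeriv_one, norm_iteratedFDeriv_fderiv, norm_iteratedFDeriv_fderiv]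
    exact hk 3 (by norm_num) x
  refine ⟨d1, d2, fun x => ?_, fun x => ?_, b1, b2, fun x y => ?_, fun x y => ?_, fun x y => ?_⟩
  · exact (hg.of_le (m := 2) (by norm_num)).contDiffAt.isSymmSndFDerivAt (by simp)
  · rw [← norm_iteratedFDeriv_zero (𝕜 := ℝ)]; exact hk 0 (by norm_num) x
  · exact convex_univ.norm_image_sub_le_of_norm_hasFDerivWithin_le
      (fun z _ => (d1 z).hasFDerivWithinAt) (fun z _ => b1 z) (mem_univ y) (mem_univ x)
  · exact convex_univ.norm_image_sub_le_of_norm_hasFDerivWithin_le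
      (fun z _ => (d2 z).hasFDerivWithinAt) (fun z _ => b2 z) (mem_univ y) (mem_univ x)
  · exact convex_univ.norm_image_sub_le_of_norm_hasFDerivWithin_le
      (fun z _ => (d3 z).hasFDerivWithinAt) (fun z _ => b3 z) (mem_univ y) (mem_univ x)

/-! ### The heat flow of a periodic Hölder function -/

section HeatInitial

variable {E : Type*} [NormedAddCommGroup E] [NormedSpace ℝ E]

/-- A periodic function on `[0,1]` with Hölder norm at most `a`. -/
structure PerHolder (p a : ℝ) (f : ℝ → E) : Prop where
  nonneg : 0 ≤ a
  periodic : f 0 = f 1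
  bound : ∀ x ∈ Icc (0 : ℝ) 1, ‖f x‖ ≤ a
  holder : ∀ x ∈ Icc (0 : ℝ) 1, ∀ y ∈ Icc (0 : ℝ) 1, ‖f x - f y‖ ≤ a * |x - y| ^ p

lemma PerHolder.of_holderNorm {p a : ℝ} (ha : 0 ≤ a) (hp : 0 < p) {f : ℝ → E} (h01 : f 0 = f 1)
    (h : holderNorm p f ≤ ENNReal.ofReal a) : PerHolder p a f :=
  ⟨ha, h01, norm_le_of_holderNorm ha h, fun x hx y hy => by
    rw [norm_sub_rev]; exact incr_le_of_holderNorm ha hp h x hx y hy⟩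

namespace PerHolder

variable {p a : ℝ} {f : ℝ → E}

lemma bddMeas (h : PerHolder p a f) (hp : 0 < p) : BddMeas a (per f) :=
  bddMeas_per (continuousOn_of_incr_le hp fun x hx y hy => by
    rw [incr, norm_sub_rev]; exact h.holder x hx y hy) h.bound

lemma norm_heatD_le [CompleteSpace E] (h : PerHolder p a f) (hp : 0 < p) (hp1 : p ≤ 1) {s : ℝ}
    (hs : 0 < s) (x : ℝ) : ‖heatD s (per f) x‖ ≤ 4 * a * s ^ ((p - 1) / 2) := by
  refine (norm_heatD_le_of_holder hs hp.le hp1 (h.bddMeas hp)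
    (per_holder hp.le h.periodic h.holder) x).trans (le_of_eq (by ring))

lemma norm_heat_sub_le (h : PerHolder p a f) (hp : 0 < p) (s x y : ℝ) :
    ‖heat s (per f) x - heat s (per f) y‖ ≤ 2 * a * |x - y| ^ p :=
  RoughBurgers.norm_heat_sub_le (h.bddMeas hp) (per_holder hp.le h.periodic h.holder) s x y

/-- Interpolation at distance √s between the p-Hölder bound, valid for all s, and the Lipschitz
bound s^{(p-1)/2}. For p = β and q = α this is the origin of the singularity s^{-(2α-β)/2}. -/
lemma norm_heat_sub_le_two [CompleteSpace E] (h : PerHolder p a f) (hp : 0 < p) (hp1 : p ≤ 1)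
    {q : ℝ} (hpq : p ≤ 2 * q) (hq1 : 2 * q ≤ 1) {s x y : ℝ} (hs : 0 < s) (hxy : x ≤ y) :
    ‖heat s (per f) y - heat s (per f) x‖ ≤ 4 * a * s ^ (-((2 * q - p) / 2)) * ((y - x) ^ q) ^ 2 := by
  have ha := h.nonneg
  rcases hxy.eq_or_lt with rfl | hxy
  · simp only [sub_self, norm_zero]; positivity
  have h0 : 0 < y - x := sub_pos.2 hxy
  have e : ((y - x) ^ q) ^ 2 = (y - x) ^ (2 * q) := by
    rw [← Real.rpow_natCast, ← Real.rpow_mul h0.le, mul_comm]; norm_num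
  have hlip : ‖heat s (per f) y - heat s (per f) x‖ ≤ 4 * a * s ^ ((p - 1) / 2) * (y - x) := by
    have := Convex.norm_image_sub_le_of_norm_hasDerivWithin_le (s := univ)
      (fun z _ => (hasDerivAt_heat hs (h.bddMeas hp) z).hasDerivWithinAt)
      (fun z _ => h.norm_heatD_le hp hp1 hs z) convex_univ (mem_univ x) (mem_univ y)
    rwa [Real.norm_of_nonneg h0.le] at this
  have hhol := h.norm_heat_sub_le hp s y x
  rw [abs_of_pos h0] at hhol
  rw [e]
  set d := y - x
  rcases le_total d (s ^ (1 / 2 : ℝ)) with hd | hd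
  · refine hlip.trans ?_
    have h1 : d ^ (1 - 2 * q) ≤ (s ^ (1 / 2 : ℝ)) ^ (1 - 2 * q) :=
      Real.rpow_le_rpow h0.le hd (by linarith)
    rw [← Real.rpow_mul hs.le] at h1
    have e2 : d = d ^ (2 * q) * d ^ (1 - 2 * q) := by
      rw [← Real.rpow_add h0]; simp
    calc 4 * a * s ^ ((p - 1) / 2) * d
        = 4 * a * s ^ ((p - 1) / 2) * (d ^ (2 * q) * d ^ (1 - 2 * q)) := by rw [← e2]
      _ ≤ 4 * a * s ^ ((p - 1) / 2) * (d ^ (2 * q) * s ^ (1 / 2 * (1 - 2 * q))) := by gcongr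
      _ = 4 * a * (s ^ ((p - 1) / 2) * s ^ (1 / 2 * (1 - 2 * q))) * d ^ (2 * q) := by ring
      _ = _ := by rw [← Real.rpow_add hs]; congr 3; ring
  · refine hhol.trans ?_
    have h1 : d ^ (-(2 * q - p)) ≤ (s ^ (1 / 2 : ℝ)) ^ (-(2 * q - p)) :=
      Real.rpow_le_rpow_of_nonpos (by positivity) hd (by linarith)
    rw [← Real.rpow_mul hs.le] at h1
    have e2 : d ^ p = d ^ (-(2 * q - p)) * d ^ (2 * q) := by
      rw [← Real.rpow_add h0]; congr 1; ring
    rw [e2, show -((2 * q - p) / 2) = 1 / 2 * -(2 * q - p) by ring]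
    calc 2 * a * (d ^ (-(2 * q - p)) * d ^ (2 * q))
        ≤ 4 * a * (s ^ (1 / 2 * -(2 * q - p)) * d ^ (2 * q)) := by gcongr; norm_num
      _ = _ := by ring

end PerHolder

end HeatInitial

/-! ### Slices of the data -/

section Slices

lemma near_of_bounds {E : Type*} [NormedAddCommGroup E] {a b : E} {m h A δ : ℝ} (hh : 0 ≤ h)
    (hδ : 0 ≤ δ) (ha : ‖a‖ ≤ m * h) (hb : ‖b‖ ≤ m * h) (hab : ‖a - b‖ ≤ δ * h) (hm : m ≤ A)
    (hA : 1 ≤ A) : Near δ (A * h) a b :=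
  ⟨ha.trans (by gcongr), hb.trans (by gcongr), hab.trans (by
    calc δ * h = 1 * (h * δ) := by ring
      _ ≤ A * (h * δ) := by gcongr
      _ = _ := by ring)⟩

lemma near_incr {E : Type*} [NormedAddCommGroup E] {f f' : ℝ → E} {m A δ p : ℝ} (hp : 0 < p)
    (hm0 : 0 ≤ m) (hδ : 0 ≤ δ) (hm : m ≤ A) (hA : 1 ≤ A)
    (hf : holderNorm p f ≤ ENNReal.ofReal m) (hf' : holderNorm p f' ≤ ENNReal.ofReal m)
    (hd : holderNorm p (f - f') ≤ ENNReal.ofReal δ) (x y : ℝ) (hx : 0 ≤ x) (hxy : x ≤ y)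
    (hy : y ≤ 1) : Near δ (A * (y - x) ^ p) (incr f x y) (incr f' x y) := by
  have hx' : x ∈ Icc (0 : ℝ) 1 := ⟨hx, hxy.trans hy⟩
  have hy' : y ∈ Icc (0 : ℝ) 1 := ⟨hx.trans hxy, hy⟩
  have e : |x - y| = y - x := by rw [abs_sub_comm, abs_of_nonneg (sub_nonneg.2 hxy)]
  have h1 := incr_le_of_holderNorm hm0 hp hf x hx' y hy'
  have h2 := incr_le_of_holderNorm hm0 hp hf' x hx' y hy'
  have h3 := incr_le_of_holderNorm hδ hp hd x hx' y hy'
  have e2 : incr (f - f') x y = incr f x y - incr f' x y := by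
    simp only [incr, Pi.sub_apply]; abel
  rw [e] at h1 h2 h3
  rw [e2] at h3
  exact near_of_bounds (Real.rpow_nonneg (sub_nonneg.2 hxy) _) hδ h1 h2 h3 hm hA

lemma sq_rpow {d q : ℝ} (hd : 0 ≤ d) : (d ^ q) ^ 2 = d ^ (2 * q) := by
  rw [← Real.rpow_natCast, ← Real.rpow_mul hd, mul_comm]; norm_num

lemma near_two {E : Type*} [NormedAddCommGroup E] {R R' : ℝ → ℝ → E} {m A δ q : ℝ}
    (hm0 : 0 ≤ m) (hδ : 0 ≤ δ) (hm : m ≤ A) (hA : 1 ≤ A) (hR : MemOmega (2 * q) R)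
    (hR' : MemOmega (2 * q) R')
    (hf : holderTwo (2 * q) R ≤ ENNReal.ofReal m) (hf' : holderTwo (2 * q) R' ≤ ENNReal.ofReal m)
    (hd : holderTwo (2 * q) (R - R') ≤ ENNReal.ofReal δ) (x y : ℝ) (hx : 0 ≤ x) (hxy : x ≤ y)
    (hy : y ≤ 1) : Near δ (A * ((y - x) ^ q) ^ 2) (R x y) (R' x y) := by
  have hx' : x ∈ Icc (0 : ℝ) 1 := ⟨hx, hxy.trans hy⟩
  have hy' : y ∈ Icc (0 : ℝ) 1 := ⟨hx.trans hxy, hy⟩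
  have hA0 : 0 ≤ A := by linarith
  rcases eq_or_ne x y with rfl | hne
  · rw [hR.diag x hx', hR'.diag x hx']
    constructor <;> simp only [norm_zero, sub_self] <;> positivity
  have e : |x - y| = y - x := by rw [abs_sub_comm, abs_of_nonneg (sub_nonneg.2 hxy)]
  have h1 := (holderTwo_le_iff hm0).1 hf x hx' y hy' hne
  have h2 := (holderTwo_le_iff hm0).1 hf' x hx' y hy' hne
  have h3 := (holderTwo_le_iff hδ).1 hd x hx' y hy' hne
  rw [e, ← sq_rpow (sub_nonneg.2 hxy)] at h1 h2 h3
  exact near_of_bounds (by positivity) hδ h1 h2 h3 hm hA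

namespace Data

variable {n : ℕ}

/-- The data at time `s`. -/
def slice (D : Data n) (v : ℝ → ℝ → Vec n) (s : ℝ) : Slice n where
  X := D.X s
  XX := D.XX s
  Ψ := D.Ψ s
  Ψ' := D.Ψ' s
  R := D.R s
  w x := D.U s x + v s x

lemma slice_u (D : Data n) (v : ℝ → ℝ → Vec n) (s : ℝ) : (D.slice v s).u = D.u v s := by
  funext x
  simp only [slice, Slice.u, Data.u]
  abel

/-- The data, the solutions, and a bound `δ` for their distances. -/
structure Setup (α β T : ℝ) (M K L : ℝ≥0) (δ : ℝ) (g : Vec n → Mat n) (D D₂ : Data n)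
    (v w : ℝ → ℝ → Vec n) : Prop where
  hα : 1 / 3 < α
  hαβ : α < β
  hβ : β < 1 / 2
  hT : 0 < T
  hT1 : T ≤ 1
  hδ : 0 ≤ δ
  hg : C3Bound L g
  adm : D.Admissible α β T
  bdd : D.BoundedBy α β T M
  adm₂ : D₂.Admissible α β T
  bdd₂ : D₂.BoundedBy α β T M
  hv : v ∈ c1Ball T K
  hw : w ∈ c1Ball T K
  hD : Data.dist α β T D D₂ ≤ ENNReal.ofReal δ
  hvw : supTime T c1Norm (v - w) ≤ ENNReal.ofReal δ

/-- A bound for all quantities in the spatial estimates. -/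
def bigConst (M K L : ℝ≥0) : ℝ := 5 + L + 4 * M + K

section Bounded

variable {α β T : ℝ} {M : ℝ≥0} {D : Data n}

lemma BoundedBy.time (h : D.BoundedBy α β T M) {t : ℝ} (ht : t ∈ Icc 0 T) :
    holderNorm α (D.X t) ≤ ENNReal.ofReal M ∧ holderTwo (2 * α) (D.XX t) ≤ ENNReal.ofReal M ∧
    holderNorm α (D.Ψ t) ≤ ENNReal.ofReal M ∧ holderNorm α (D.Ψ' t) ≤ ENNReal.ofReal M ∧
    holderTwo (2 * α) (D.R t) ≤ ENNReal.ofReal M := by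
  rw [ENNReal.ofReal_coe_nnreal]
  have h1 := (le_iSup₂ (f := fun t (_ : t ∈ Icc 0 T) =>
    holderNorm α (D.X t) + holderTwo (2 * α) (D.XX t)) t ht).trans h.rough
  have h2 := (le_iSup₂ (f := fun t (_ : t ∈ Icc 0 T) =>
    holderNorm α (D.Ψ t) + holderNorm α (D.Ψ' t) + holderTwo (2 * α) (D.R t)) t ht).trans h.controlled
  exact ⟨le_self_add.trans h1, le_add_self.trans h1, (le_self_add.trans le_self_add).trans h2,
    (le_add_self.trans le_self_add).trans h2, le_add_self.trans h2⟩

lemma time_of_dist {D₂ : Data n} {c : ℝ≥0∞} (h : Data.dist α β T D D₂ ≤ c) {t : ℝ}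
    (ht : t ∈ Icc 0 T) :
    holderNorm α (D.X t - D₂.X t) ≤ c ∧ holderTwo (2 * α) (D.XX t - D₂.XX t) ≤ c ∧
    holderNorm α (D.Ψ t - D₂.Ψ t) ≤ c ∧ holderNorm α (D.Ψ' t - D₂.Ψ' t) ≤ c ∧
    holderTwo (2 * α) (D.R t - D₂.R t) ≤ c ∧ holderNorm β (D.u₀ - D₂.u₀) ≤ c := by
  unfold Data.dist at h
  have h6 := le_add_self.trans h
  have h' := le_self_add.trans h
  have h5 := le_add_self.trans h'
  have h' := le_self_add.trans h'
  have h4 := le_add_self.trans h'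
  have h' := le_self_add.trans h'
  have h3 := le_add_self.trans h'
  have h' := le_self_add.trans h'
  exact ⟨le_of_supTime (le_self_add.trans h') ht, le_of_supTime (le_add_self.trans h') ht,
    le_of_supTime h3 ht, le_of_supTime h4 ht, le_of_supTime h5 ht, h6⟩

lemma Admissible.perHolder (h : D.Admissible α β T) (hb : D.BoundedBy α β T M) (hβ : 0 < β) :
    PerHolder β (M : ℝ) D.u₀ :=
  PerHolder.of_holderNorm M.coe_nonneg hβ h.u₀_periodic (by
    rw [ENNReal.ofReal_coe_nnreal]; exact hb.initial)

lemma U_eq (h : D.Admissible α β T) (hb : D.BoundedBy α β T M) (hβ : 0 < β) {s : ℝ} (hs : 0 < s) :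
    D.U s = heat s (per D.u₀) := by
  funext x
  rw [U, heatSemigroup, if_neg hs.ne', integral_heatKernel_smul hs ((h.perHolder hb hβ).bddMeas hβ)]

lemma Admissible.isRough (h : D.Admissible α β T) (v : ℝ → ℝ → Vec n) {s : ℝ} (hs : s ∈ Icc 0 T) :
    (D.slice v s).IsRough :=
  ⟨h.chen s hs, h.controlled s hs⟩

end Bounded

namespace Setup

variable {α β T δ : ℝ} {M K L : ℝ≥0} {g : Vec n → Mat n} {D D₂ : Data n} {v w : ℝ → ℝ → Vec n}

lemma one_le_bigConst : 1 ≤ bigConst M K L := by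
  have := M.coe_nonneg
  have := K.coe_nonneg
  have := L.coe_nonneg
  unfold bigConst; linarith

lemma L_le_bigConst : (L : ℝ) ≤ bigConst M K L := by
  have := M.coe_nonneg
  have := K.coe_nonneg
  unfold bigConst; linarith

lemma perHolder_sub (h : Setup α β T M K L δ g D D₂ v w) :
    PerHolder β δ (fun x => D.u₀ x - D₂.u₀ x) := by
  have hβ : 0 < β := by linarith [h.hα, h.hαβ]
  have ht : (0 : ℝ) ∈ Icc 0 T := ⟨le_rfl, h.hT.le⟩
  exact PerHolder.of_holderNorm h.hδ hβ (by rw [h.adm.u₀_periodic, h.adm₂.u₀_periodic])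
    (time_of_dist h.hD ht).2.2.2.2.2

lemma v_le (h : Setup α β T M K L δ g D D₂ v w) {s : ℝ} (hs : s ∈ Icc 0 T) :
    c1Norm (v s) ≤ ENNReal.ofReal K ∧ c1Norm (w s) ≤ ENNReal.ofReal K ∧
      c1Norm (v s - w s) ≤ ENNReal.ofReal δ := by
  rw [ENNReal.ofReal_coe_nnreal]
  exact ⟨le_of_supTime h.hv.2 hs, le_of_supTime h.hw.2 hs, le_of_supTime h.hvw hs⟩

/-- The data satisfy their bounds uniformly in time and v is Lipschitz in space. The only singular
entry is the 2α-Hölder bound of U(s). By linearity the difference of the two functions U is the heat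
flow of the difference of the initial values, so it obeys the same bounds with δ in place of M. -/
lemma close (h : Setup α β T M K L δ g D D₂ v w) {s : ℝ} (hs : s ∈ Ioc 0 T) :
    Slice.Close α (bigConst M K L) (s ^ (-((2 * α - β) / 2))) δ (D.slice v s) (D₂.slice w s) := by
  obtain ⟨hα, hαβ, hβ, hT, hT1, hδ⟩ := h.1, h.2, h.3, h.4, h.5, h.6
  have hs' : s ∈ Icc 0 T := ⟨hs.1.le, hs.2⟩
  have hβ0 : 0 < β := by linarith
  have hα0 : 0 < α := by linarith
  have hM := M.coe_nonneg
  have hK := K.coe_nonneg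
  have hL := L.coe_nonneg
  have hA : bigConst M K L = 5 + L + 4 * M + K := rfl
  set A := bigConst M K L
  have hA1 : 1 ≤ A := by linarith
  have hMA : (M : ℝ) ≤ A := by linarith
  obtain ⟨b1, b2, b3, b4, b5⟩ := h.bdd.time hs'
  obtain ⟨c1, c2, c3, c4, c5⟩ := h.bdd₂.time hs'
  obtain ⟨d1, d2, d3, d4, d5, d6⟩ := time_of_dist h.hD hs'
  obtain ⟨e1, e2, e3⟩ := h.v_le hs'
  have p1 := h.adm.perHolder h.bdd hβ0
  have p2 := h.adm₂.perHolder h.bdd₂ hβ0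
  have p3 := h.perHolder_sub
  have hv := h.hv.1.mem s hs'
  have hw := h.hw.1.mem s hs'
  have hvw : ContDiffOn ℝ 1 (v s - w s) (Icc 0 1) := hv.sub hw
  have eU : ∀ x, D.U s x - D₂.U s x = heat s (per fun x => D.u₀ x - D₂.u₀ x) x := fun x => by
    rw [U_eq h.adm h.bdd hβ0 hs.1, U_eq h.adm₂ h.bdd₂ hβ0 hs.1,
      ← heat_sub (p1.bddMeas hβ0) (p2.bddMeas hβ0)]
    rfl
  set B := s ^ (-((2 * α - β) / 2)) with hB
  have hB1 : 1 ≤ B := Real.one_le_rpow_of_pos_of_le_one_of_nonpos hs.1 (hs.2.trans hT1) (by linarith)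
  have eUi : ∀ x y, incr (D.U s) x y - incr (D₂.U s) x y =
      heat s (per fun x => D.u₀ x - D₂.u₀ x) y - heat s (per fun x => D.u₀ x - D₂.u₀ x) x :=
    fun x y => by
      rw [← eU, ← eU]; simp only [incr]; abel
  have evi : ∀ x y, incr (v s) x y - incr (w s) x y = incr (v s - w s) x y := fun x y => by
    simp only [incr, Pi.sub_apply]; abel
  have hU1 : ∀ x y, 0 ≤ x → x ≤ y → y ≤ 1 →
      Near δ ((2 * M + 2) * (y - x) ^ α) (incr (D.U s) x y) (incr (D₂.U s) x y) := by
    intro x y hx hxy hy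
    have h0 : 0 ≤ y - x := sub_nonneg.2 hxy
    have hp : (y - x) ^ β ≤ (y - x) ^ α := by
      rcases h0.eq_or_lt with h1 | h1
      · rw [← h1, Real.zero_rpow hβ0.ne', Real.zero_rpow hα0.ne']
      · exact Real.rpow_le_rpow_of_exponent_ge h1 (by linarith) hαβ.le
    have hl : ∀ {a : ℝ} {f : ℝ → Vec n}, PerHolder β a f →
        ‖heat s (per f) y - heat s (per f) x‖ ≤ 2 * a * (y - x) ^ α := fun {a f} hf => by
      have := hf.norm_heat_sub_le hβ0 s y x
      rw [abs_of_nonneg h0] at this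
      have := hf.nonneg
      exact ‹‖_‖ ≤ _›.trans (by gcongr)
    have g1 := hl p1
    have g2 := hl p2
    have g3 := hl p3
    rw [← eUi] at g3
    rw [← U_eq h.adm h.bdd hβ0 hs.1] at g1
    rw [← U_eq h.adm₂ h.bdd₂ hβ0 hs.1] at g2
    have hs0 : 0 ≤ (y - x) ^ α := Real.rpow_nonneg h0 _
    refine ⟨g1.trans (by gcongr; linarith), g2.trans (by gcongr; linarith), g3.trans ?_⟩
    calc 2 * δ * (y - x) ^ α = 2 * (y - x) ^ α * δ := by ring
      _ ≤ _ := by gcongr; linarith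
  have hU2 : ∀ x y, 0 ≤ x → x ≤ y → y ≤ 1 →
      Near δ ((4 * M + 4) * (B * ((y - x) ^ α) ^ 2)) (incr (D.U s) x y) (incr (D₂.U s) x y) := by
    intro x y hx hxy hy
    have hl : ∀ {a : ℝ} {f : ℝ → Vec n}, PerHolder β a f →
        ‖heat s (per f) y - heat s (per f) x‖ ≤ 4 * a * (B * ((y - x) ^ α) ^ 2) := fun {a f} hf => by
      rw [← mul_assoc]
      exact hf.norm_heat_sub_le_two hβ0 (by linarith) (by linarith) (by linarith) hs.1 hxy
    have g1 := hl p1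
    have g2 := hl p2
    have g3 := hl p3
    rw [← eUi] at g3
    rw [← U_eq h.adm h.bdd hβ0 hs.1] at g1
    rw [← U_eq h.adm₂ h.bdd₂ hβ0 hs.1] at g2
    have hs0 : 0 ≤ B * ((y - x) ^ α) ^ 2 := by positivity
    set S := B * ((y - x) ^ α) ^ 2
    refine ⟨g1.trans (by gcongr; linarith), g2.trans (by gcongr; linarith), g3.trans ?_⟩
    calc 4 * δ * S = 4 * S * δ := by ring
      _ ≤ _ := by gcongr; linarith
  have hv1 : ∀ (x y : ℝ) (S : ℝ), 0 ≤ x → x ≤ y → y ≤ 1 → y - x ≤ S →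
      Near δ ((K + 1) * S) (incr (v s) x y) (incr (w s) x y) := by
    intro x y S hx hxy hy hS
    have hx' : x ∈ Icc (0 : ℝ) 1 := ⟨hx, hxy.trans hy⟩
    have hy' : y ∈ Icc (0 : ℝ) 1 := ⟨hx.trans hxy, hy⟩
    have h0 : 0 ≤ y - x := sub_nonneg.2 hxy
    have g1 := incr_le_of_c1Norm hK hv e1 hx' hy'
    have g2 := incr_le_of_c1Norm hK hw e2 hx' hy'
    have g3 := incr_le_of_c1Norm hδ hvw e3 hx' hy'
    rw [abs_of_nonneg h0] at g1 g2 g3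
    rw [← evi] at g3
    exact near_of_bounds (h0.trans hS) hδ (g1.trans (by gcongr)) (g2.trans (by gcongr))
      (g3.trans (by gcongr)) (by linarith) (by linarith)
  have ew : ∀ (D : Data n) (v : ℝ → ℝ → Vec n) (x y : ℝ), incr (D.slice v s).w x y =
      incr (D.U s) x y + incr (v s) x y := fun D v x y => by
    simp only [slice, incr]; abel
  refine ⟨h.adm.isRough v hs', h.adm₂.isRough w hs', near_incr hα0 hM hδ hMA hA1 b1 c1 d1,
    near_two hM hδ hMA hA1 (h.adm.XX_mem.mem s hs') (h.adm₂.XX_mem.mem s hs') b2 c2 d2,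
    near_incr hα0 hM hδ hMA hA1 b3 c3 d3, fun x hx hx1 => ?_,
    near_incr hα0 hM hδ hMA hA1 b4 c4 d4, fun x hx hx1 => ?_,
    near_two hM hδ hMA hA1 (h.adm.R_mem.mem s hs') (h.adm₂.R_mem.mem s hs') b5 c5 d5,
    fun x y hx hxy hy => ?_, fun x y hx hxy hy => ?_, fun x hx hx1 => ?_⟩
  · refine (norm_le_of_holderNorm hδ d3 x ⟨hx, hx1⟩).trans ?_
    exact le_mul_of_one_le_left hδ hA1
  · have := near_of_bounds (h := 1) zero_le_one hδ
      ((norm_le_of_holderNorm hM b4 x ⟨hx, hx1⟩).trans_eq (mul_one _).symm)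
      ((norm_le_of_holderNorm hM c4 x ⟨hx, hx1⟩).trans_eq (mul_one _).symm)
      ((norm_le_of_holderNorm hδ d4 x ⟨hx, hx1⟩).trans_eq (mul_one _).symm) hMA hA1
    rwa [mul_one] at this
  · rw [ew, ew]
    have h0 : 0 ≤ y - x := sub_nonneg.2 hxy
    have hS : y - x ≤ (y - x) ^ α := by
      rcases h0.eq_or_lt with h1 | h1
      · rw [← h1, Real.zero_rpow hα0.ne']
      · simpa using Real.rpow_le_rpow_of_exponent_ge h1 (by linarith) (by linarith : α ≤ 1)
    refine ((hU1 x y hx hxy hy).add (hv1 x y _ hx hxy hy hS)).mono hδ ?_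
    rw [← add_mul]
    have hs0 : 0 ≤ (y - x) ^ α := Real.rpow_nonneg h0 _
    gcongr
    linarith
  · rw [ew, ew]
    have h0 : 0 ≤ y - x := sub_nonneg.2 hxy
    have hS : y - x ≤ B * ((y - x) ^ α) ^ 2 := by
      rw [sq_rpow h0]
      have : y - x ≤ (y - x) ^ (2 * α) := by
        rcases h0.eq_or_lt with h1 | h1
        · rw [← h1, Real.zero_rpow (by linarith)]
        · simpa using Real.rpow_le_rpow_of_exponent_ge h1 (by linarith) (by linarith : 2 * α ≤ 1)
      have h2 : 0 ≤ (y - x) ^ (2 * α) := Real.rpow_nonneg h0 _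
      nlinarith
    -- The sum (4M+4) + (K+1) is what dictates the size of `bigConst`, up to the summand L.
    refine ((hU2 x y hx hxy hy).add (hv1 x y _ hx hxy hy hS)).mono hδ ?_
    rw [← add_mul, mul_assoc]
    have hs0 : 0 ≤ B * ((y - x) ^ α) ^ 2 := by positivity
    gcongr
    linarith
  · have g1 : ‖D.U s x - D₂.U s x‖ ≤ δ := by
      rw [eU]; exact norm_heat_le (p3.bddMeas hβ0).bound s x
    have g2 := norm_le_of_c1Norm hδ e3 x ⟨hx, hx1⟩
    simp only [slice]
    rw [add_sub_add_comm]
    refine (norm_add_le_of_le g1 g2).trans ?_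
    nlinarith

end Setup

end Data

end Slices

/-! ### Sources given by Stieltjes integrals against the heat kernel -/

section Stieltjes

variable {E : Type*} [NormedAddCommGroup E] [NormedSpace ℝ E]

/-- The Stieltjes integral of the periodic heat kernel against `J s`. -/
def stieltjesQ (J : ℝ → ℝ → E) (r s x : ℝ) : E :=
  heatD r (per fun y => J s y - y • J s 1) x + J s 1

lemma stronglyMeasurable_per {J : ℝ → ℝ → E} (hJ : StronglyMeasurable (Function.uncurry J)) :
    StronglyMeasurable (Function.uncurry fun s => per (J s)) :=
  hJ.comp_measurable (g := fun q : ℝ × ℝ => (q.1, Int.fract q.2)) (by fun_prop)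

/-- `J s` vanishes at `0` and has `p`-Hölder constant at most `C s^{-σ}` on `[0,1]`. -/
structure StieltjesFamily (T p σ C : ℝ) (J : ℝ → ℝ → E) : Prop where
  meas : StronglyMeasurable (Function.uncurry J)
  zero : ∀ s ∈ Ioo 0 T, J s 0 = 0
  holder : ∀ s ∈ Ioo 0 T, ∀ x y, 0 ≤ x → x ≤ y → y ≤ 1 →
    ‖J s y - J s x‖ ≤ C * s ^ (-σ) * (y - x) ^ p

namespace StieltjesFamily

variable {T p σ C : ℝ} {J : ℝ → ℝ → E}

lemma norm_le (h : StieltjesFamily T p σ C J) (hC : 0 ≤ C) (hp : 0 ≤ p) {s : ℝ}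
    (hs : s ∈ Ioo 0 T) {y : ℝ} (hy : y ∈ Icc (0 : ℝ) 1) : ‖J s y‖ ≤ C * s ^ (-σ) := by
  have h1 := h.holder s hs 0 y le_rfl hy.1 hy.2
  rw [h.zero s hs, sub_zero, sub_zero] at h1
  have := hs.1.le
  exact h1.trans (mul_le_of_le_one_right (by positivity) (Real.rpow_le_one hy.1 hy.2 hp))

lemma perHolder (h : StieltjesFamily T p σ C J) (hC : 0 ≤ C) (hp : 0 < p) (hp1 : p ≤ 1) {s : ℝ}
    (hs : s ∈ Ioo 0 T) : PerHolder p (2 * (C * s ^ (-σ))) (fun y => J s y - y • J s 1) := by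
  have hs0 := hs.1.le
  have hc : 0 ≤ C * s ^ (-σ) := by positivity
  have h1 := h.norm_le hC hp.le hs (y := 1) (by simp)
  refine ⟨by positivity, by simp [h.zero s hs], fun y hy => ?_, fun x hx y hy => ?_⟩
  · refine (norm_sub_le_of_le (h.norm_le hC hp.le hs hy) (?_ : _ ≤ C * s ^ (-σ))).trans
      (le_of_eq (by ring))
    rw [norm_smul, Real.norm_of_nonneg hy.1]
    nlinarith [hy.2, norm_nonneg (J s 1)]
  · wlog hxy : x ≤ y generalizing x y
    · rw [norm_sub_rev, abs_sub_comm]; exact this y hy x hx (le_of_not_ge hxy)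
    have h0 : 0 ≤ y - x := sub_nonneg.2 hxy
    rw [norm_sub_rev, abs_sub_comm, abs_of_nonneg h0]
    have e : J s y - y • J s 1 - (J s x - x • J s 1) = (J s y - J s x) - (y - x) • J s 1 := by
      module
    have h2 : y - x ≤ (y - x) ^ p := by
      rcases h0.eq_or_lt with h' | h'
      · rw [← h', Real.zero_rpow hp.ne']
      · simpa using Real.rpow_le_rpow_of_exponent_ge h' (by linarith [hy.2, hx.1]) hp1
    rw [e]
    refine (norm_sub_le_of_le (h.holder s hs x y hx.1 hxy hy.2)
      (?_ : _ ≤ C * s ^ (-σ) * (y - x) ^ p)).trans (le_of_eq (by ring))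
    rw [norm_smul, Real.norm_of_nonneg h0, mul_comm]
    gcongr

variable [CompleteSpace E]

/-- `J s` minus its linear part is periodic and p-Hölder with doubled constant, so the smoothed
derivative is of size r^{(p-1)/2}. The constant `J s 1` is preserved by the heat flow, and hence the
semigroup property holds for the sum. -/
lemma source (h : StieltjesFamily T p σ C J) (hC : 0 ≤ C) (hp : 0 < p) (hp1 : p ≤ 1) :
    Source T ((p - 1) / 2) (-σ) (9 * C) (stieltjesQ J) := by
  refine ⟨?_, fun r s x hr hr1 hs hsT => ?_, fun r k s x hr hk hrk hs hsT => ?_⟩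
  · have m1 : StronglyMeasurable fun z : ℝ × ℝ × ℝ => J z.2.1 1 :=
      h.meas.comp_measurable (g := fun z : ℝ × ℝ × ℝ => (z.2.1, 1)) (by fun_prop)
    refine StronglyMeasurable.add (stronglyMeasurable_heatD (β := ℝ × ℝ × ℝ)
      (f := fun z => per fun y => J z.2.1 y - y • J z.2.1 1) ?_ (by fun_prop) (by fun_prop)) m1
    have m2 : StronglyMeasurable (Function.uncurry fun s y => J s y - y • J s 1) := by
      refine h.meas.sub (StronglyMeasurable.smul (f := fun q : ℝ × ℝ => q.2)
        measurable_snd.stronglyMeasurable ?_)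
      exact h.meas.comp_measurable (g := fun q : ℝ × ℝ => (q.1, 1)) (by fun_prop)
    exact (stronglyMeasurable_per m2).comp_measurable
      (g := fun q : (ℝ × ℝ × ℝ) × ℝ => (q.1.2.1, q.2)) (by fun_prop)
  · have hP := h.perHolder hC hp hp1 ⟨hs, hsT⟩
    refine (norm_add_le_of_le (hP.norm_heatD_le hp hp1 hr x)
      (h.norm_le hC hp.le ⟨hs, hsT⟩ (by simp))).trans ?_
    -- As r ≤ 1, the constant term is absorbed into the singular one, and the factors 4 · 2 and 1
    -- add up to 9.
    have h1 : 1 ≤ r ^ ((p - 1) / 2) :=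
      Real.one_le_rpow_of_pos_of_le_one_of_nonpos hr hr1 (by linarith)
    have hc : 0 ≤ C * s ^ (-σ) := by positivity
    nlinarith [mul_le_mul_of_nonneg_left h1 hc]
  · have hP := h.perHolder hC hp hp1 ⟨hs, hsT⟩
    have hB := hP.bddMeas hp
    unfold stieltjesQ
    rw [heat_add_const (hB.heatD hr), heat_heatD hr hk hB]

lemma stieltjesQ_sub {C' : ℝ} {J' : ℝ → ℝ → E} (h : StieltjesFamily T p σ C J)
    (h' : StieltjesFamily T p σ C' J') (hC : 0 ≤ C) (hC' : 0 ≤ C') (hp : 0 < p) (hp1 : p ≤ 1)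
    {s : ℝ} (hs : s ∈ Ioo 0 T) (r x : ℝ) :
    stieltjesQ (fun s y => J s y - J' s y) r s x = stieltjesQ J r s x - stieltjesQ J' r s x := by
  have h1 := heatD_sub ((h.perHolder hC hp hp1 hs).bddMeas hp)
    ((h'.perHolder hC' hp hp1 hs).bddMeas hp) r x
  unfold stieltjesQ
  rw [add_sub_add_comm, ← h1]
  congr 2
  funext y
  simp only [per]
  module

end StieltjesFamily

/-- Additivity reduces increments of the primitive to the sewing on [x,y]. The factor c is present
only in the defect; 1 ≤ c lets it multiply the germ as well. -/
lemma norm_sew_sub_le [CompleteSpace E] {ε p C c : ℝ} (hε : 0 < ε) (hp1 : p ≤ 1) (hc : 1 ≤ c)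
    (hC : 0 ≤ C) {Ξ : ℝ → ℝ → E} (h : IsGerm ε (C * c) Ξ)
    (hb : ∀ x y, 0 ≤ x → x ≤ y → y ≤ 1 → ‖Ξ x y‖ ≤ C * (y - x) ^ p) {x y : ℝ} (hx : 0 ≤ x)
    (hxy : x ≤ y) (hy : y ≤ 1) :
    ‖sew Ξ 0 y - sew Ξ 0 x‖ ≤ C * (1 + sewConst ε) * c * (y - x) ^ p := by
  have h1 := h.sew_add hε le_rfl hx hxy hy
  have hs := sewConst_nonneg hε
  rw [← h1, add_sub_cancel_left]
  refine (h.norm_sew_le hε hp1 hb hx hxy hy).trans ?_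
  have : 0 ≤ (y - x) ^ p := Real.rpow_nonneg (sub_nonneg.2 hxy) _
  gcongr
  nlinarith

end Stieltjes

/-! ### Convolution of bounds -/

section Bounds

variable {E : Type*} [NormedAddCommGroup E] [NormedSpace ℝ E]

lemma DuhamelBounds.add {T κ B B' : ℝ} {N ND N' ND' : ℝ → ℝ → E} (h : DuhamelBounds T κ B N ND)
    (h' : DuhamelBounds T κ B' N' ND') :
    DuhamelBounds T κ (B + B') (fun t x => N t x + N' t x) (fun t x => ND t x + ND' t x) := by
  refine ⟨fun t ht x => (h.deriv t ht x).add (h'.deriv t ht x), fun t ht x => ?_, fun t ht x => ?_,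
    fun s hs t ht x => ?_, fun s hs t ht x => ?_, fun t ht x y => ?_⟩
  · rw [add_mul]; exact norm_add_le_of_le (h.norm_le t ht x) (h'.norm_le t ht x)
  · rw [add_mul]; exact norm_add_le_of_le (h.norm_deriv_le t ht x) (h'.norm_deriv_le t ht x)
  · rw [add_mul, add_sub_add_comm]
    exact norm_add_le_of_le (h.time s hs t ht x) (h'.time s hs t ht x)
  · rw [add_mul, add_sub_add_comm]
    exact norm_add_le_of_le (h.time_deriv s hs t ht x) (h'.time_deriv s hs t ht x)
  · rw [add_mul, add_sub_add_comm]
    exact norm_add_le_of_le (h.space_deriv t ht x y) (h'.space_deriv t ht x y)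

lemma duhamelConst_nonneg {p σ : ℝ} (hp1 : p ≤ 1) (hσ : 0 ≤ σ) (hσp : σ < p / 2) :
    0 ≤ duhamelConst p σ := by
  have k1 := betaConst_nonneg (a := p / 2 - 1) (b := -σ) (by linarith) (by linarith)
  have k2 := betaConst_nonneg (a := p / 2 - 1 - (p / 2 - σ) / 2) (b := -σ) (by linarith) (by linarith)
  have k3 := betaConst_nonneg (a := (p - 1) / 2) (b := -σ) (by linarith) (by linarith)
  unfold duhamelConst
  positivity

lemma duhamel_sub {T a b C C' : ℝ} {q q' : ℝ → ℝ → ℝ → E} (h : Source T a b C q)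
    (h' : Source T a b C' q') (hT : T ≤ 1) (hC : 0 ≤ C) (hC' : 0 ≤ C') (ha : -1 < a)
    (hb : -1 < b) (ha0 : a ≤ 0) (hb0 : b ≤ 0) {d : ℝ → ℝ → ℝ → E}
    (hd : ∀ r, ∀ s ∈ Ioo 0 T, ∀ x, d r s x = q r s x - q' r s x) {t : ℝ} (ht : t ∈ Icc 0 T)
    (x : ℝ) : duhamel d t x = duhamel q t x - duhamel q' t x := by
  rw [duhamel, duhamel, duhamel, ← intervalIntegral.integral_sub
    (h.intervalIntegrable hT hC ha hb ha0 hb0 ht.1 ht.2 x)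
    (h'.intervalIntegrable hT hC' ha hb ha0 hb0 ht.1 ht.2 x)]
  refine intervalIntegral.integral_congr_ae ?_
  have : ∀ᵐ s : ℝ, s ≠ t := by simp [ae_iff]
  filter_upwards [this] with s hs hs'
  rw [uIoc_of_le ht.1] at hs'
  exact hd _ s ⟨hs'.1, (lt_of_le_of_ne hs'.2 hs).trans_le ht.2⟩ x

end Bounds

/-! ### The two sources -/

section Sources

namespace Slice

variable {n : ℕ} {α A B δ L : ℝ} {P Q : Slice n} {g : Vec n → Mat n}

lemma germ_self_of_near {x : ℝ} (hα : 0 < α)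
    (h : Near δ (A * (x - x) ^ α) (P.germ g x x) (Q.germ g x x)) :
    P.germ g x x = 0 ∧ Q.germ g x x = 0 := by
  have e : A * (x - x) ^ α = 0 := by rw [sub_self, Real.zero_rpow hα.ne', mul_zero]
  exact ⟨norm_le_zero_iff.1 (e ▸ h.left), norm_le_zero_iff.1 (e ▸ h.right)⟩

namespace Close

/-- The exponent ε = (3α-1)/2 is the one with 1 + 2ε = 3α. The difference of two germs is again a
germ, with δ in its constant, so sewing applies to it directly. -/
lemma isGerm (h : Close α A B δ P Q) (hg : C3Bound L g) (hL : 0 ≤ L) (hLA : L ≤ A) (hA : 1 ≤ A)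
    (hB : 1 ≤ B) (hδ : 0 ≤ δ) (hα : 0 < α) :
    IsGerm ((3 * α - 1) / 2) (germConst n A * B) (P.germ g) ∧
    IsGerm ((3 * α - 1) / 2) (germConst n A * B) (Q.germ g) ∧
    IsGerm ((3 * α - 1) / 2) (germConst n A * δ * B) (fun x y => P.germ g x y - Q.germ g x y) := by
  have hd : ∀ x, 0 ≤ x → x ≤ 1 → P.germ g x x = 0 ∧ Q.germ g x x = 0 := fun x hx hx1 =>
    germ_self_of_near hα (h.germ_near hg hL hLA hA hδ hα.le hx le_rfl hx1)
  have e : ∀ x z : ℝ, x ≤ z → ((z - x) ^ α) ^ 3 = (z - x) ^ (1 + 2 * ((3 * α - 1) / 2)) :=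
    fun x z hxz => by
      rw [← Real.rpow_natCast, ← Real.rpow_mul (sub_nonneg.2 hxz)]
      congr 1; push_cast; ring
  have hn : ∀ x y z : ℝ, 0 ≤ x → x ≤ y → y ≤ z → z ≤ 1 → _ := fun x y z hx hxy hyz hz =>
    h.defect_near hg hL hLA hA hB hδ hα.le hx hxy hyz hz
  refine ⟨⟨fun x hx hx1 => (hd x hx hx1).1, fun x y z hx hxy hyz hz => ?_⟩,
    ⟨fun x hx hx1 => (hd x hx hx1).2, fun x y z hx hxy hyz hz => ?_⟩,
    ⟨fun x hx hx1 => by rw [(hd x hx hx1).1, (hd x hx hx1).2, sub_zero],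
      fun x y z hx hxy hyz hz => ?_⟩⟩
  · rw [← e x z (hxy.trans hyz)]; exact (hn x y z hx hxy hyz hz).left
  · rw [← e x z (hxy.trans hyz)]; exact (hn x y z hx hxy hyz hz).right
  · rw [← e x z (hxy.trans hyz)]
    have := (hn x y z hx hxy hyz hz).diff
    convert this using 1
    · congr 1; abel
    · ring

end Close

end Slice

namespace Data

variable {n : ℕ}

/-- The rough integral `∫₀^y g(u(s)) dΨ(s)`, for `0 < s < T`. -/
def roughJ (D : Data n) (g : Vec n → Mat n) (T : ℝ) (v : ℝ → ℝ → Vec n) (s y : ℝ) : Vec n :=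
  if s ∈ Ioo 0 T then sew ((D.slice v s).germ g) 0 (clamp 0 1 y) else 0

/-- The drift, for `0 < s < T`. -/
def driftJ (D : Data n) (g : Vec n → Mat n) (T : ℝ) (v : ℝ → ℝ → Vec n) (s y : ℝ) : Vec n :=
  if s ∈ Ioo 0 T then D.drift g v s (clamp 0 1 y) else 0

/-- The heat flow of the drift. -/
def driftQ (D : Data n) (g : Vec n → Mat n) (T : ℝ) (v : ℝ → ℝ → Vec n) (r s x : ℝ) : Vec n :=
  heat r (per (D.driftJ g T v s)) x

/-! ### Joint measurability in time and space of the drift and of the rough primitive. -/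

section Measurability

lemma stronglyMeasurable_ite_Ioo {E : Type*} [NormedAddCommGroup E] {T : ℝ} {f f' : ℝ × ℝ → E}
    (hf : StronglyMeasurable f) (e : ∀ q : ℝ × ℝ, q.1 ∈ Ioo 0 T → f' q = f q) :
    StronglyMeasurable fun q : ℝ × ℝ => if q.1 ∈ Ioo 0 T then f' q else 0 := by
  have h : (fun q : ℝ × ℝ => if q.1 ∈ Ioo 0 T then f' q else 0) =
      fun q => if q.1 ∈ Ioo 0 T then f q else 0 := by
    funext q
    split_ifs with hs
    exacts [e q hs, rfl]
  rw [h]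
  exact StronglyMeasurable.ite (measurable_fst measurableSet_Ioo) hf stronglyMeasurable_const

/-- Sewing is a pointwise limit of finite sums of germs. The nodes are continuous in y because the
dyadic grid is fixed and only clamped to [0,y]. -/
lemma stronglyMeasurable_sew {E : Type*} [NormedAddCommGroup E] [CompleteSpace E] {T ε : ℝ}
    {Ξ : ℝ → ℝ → ℝ → E} (hε : 0 < ε) (hΞ : ∀ s ∈ Ioo 0 T, ∃ c, IsGerm ε c (Ξ s))
    (hm : ∀ a b : ℝ → ℝ, Continuous a → Continuous b → (∀ y, a y ∈ Icc (0 : ℝ) 1) →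
      (∀ y, b y ∈ Icc (0 : ℝ) 1) →
      StronglyMeasurable fun q : ℝ × ℝ => if q.1 ∈ Ioo 0 T then Ξ q.1 (a q.2) (b q.2) else 0) :
    StronglyMeasurable fun q : ℝ × ℝ =>
      if q.1 ∈ Ioo 0 T then sew (Ξ q.1) 0 (clamp 0 1 q.2) else 0 := by
  have hcl : ∀ (y : ℝ) (c : ℝ), clamp 0 (clamp 0 1 y) c ∈ Icc (0 : ℝ) 1 := fun y c =>
    ⟨le_clamp _ _ _, (clamp_le (clamp_mem y).1 c).trans (clamp_mem y).2⟩
  have hcc : ∀ c : ℝ, Continuous fun y => clamp 0 (clamp 0 1 y) c := fun c => by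
    unfold clamp; fun_prop
  have hs : ∀ m : ℕ, StronglyMeasurable fun q : ℝ × ℝ => ∑ k ∈ Finset.range (2 ^ m),
      if q.1 ∈ Ioo 0 T then Ξ q.1
        (clamp 0 (clamp 0 1 q.2) (k / 2 ^ m)) (clamp 0 (clamp 0 1 q.2) ((k + 1) / 2 ^ m)) else 0 :=
    fun m => Finset.stronglyMeasurable_fun_sum _ fun k _ =>
      hm _ _ (hcc _) (hcc _) (fun y => hcl y _) fun y => hcl y _
  refine stronglyMeasurable_of_tendsto atTop hs (tendsto_pi_nhds.2 fun q => ?_)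
  by_cases hs : q.1 ∈ Ioo 0 T
  · obtain ⟨c, hc⟩ := hΞ q.1 hs
    have := hc.tendsto_sewSum hε le_rfl (clamp_mem q.2).1 (clamp_mem q.2).2
    simp only [if_pos hs]
    exact this
  · simp only [if_neg hs, Finset.sum_const_zero]
    exact tendsto_const_nhds

variable {α β T : ℝ} {M : ℝ≥0} {L : ℝ} {D : Data n} {v : ℝ → ℝ → Vec n} {g : Vec n → Mat n}

/-- Clamping time and space extends Ψ and v to continuous functions on the plane. For the heat flow
of the initial value, joint measurability is all that is used. -/
lemma stronglyMeasurable_u (h : D.Admissible α β T) (hb : D.BoundedBy α β T M) (hα : 0 < α)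
    (hβ : 0 < β) (hT : 0 ≤ T) (hv : C1Path T v) :
    StronglyMeasurable fun q : ℝ × ℝ => heat q.1 (per D.u₀) (clamp 0 1 q.2) +
      D.Ψ (clamp 0 T q.1) (clamp 0 1 q.2) + v (clamp 0 T q.1) (clamp 0 1 q.2) := by
  have m1 : StronglyMeasurable fun q : ℝ × ℝ => heat q.1 (per D.u₀) (clamp 0 1 q.2) :=
    stronglyMeasurable_heat (β := ℝ × ℝ) (f := fun _ => per D.u₀)
      (((h.perHolder hb hβ).bddMeas hβ).meas.comp_measurable measurable_snd) measurable_fst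
      ((continuous_clamp _ _).measurable.comp measurable_snd)
  exact (m1.add (continuous_clampPath hT (h.Ψ_mem.continuousOn hα)).stronglyMeasurable).add
    (continuous_clampPath hT hv.continuousOn).stronglyMeasurable

lemma u_eq (h : D.Admissible α β T) (hb : D.BoundedBy α β T M) (hβ : 0 < β) {s : ℝ}
    (hs : s ∈ Ioo 0 T) (x : ℝ) : D.u v s x = heat s (per D.u₀) x + D.Ψ s x + v s x := by
  rw [u, U_eq h hb hβ hs.1]

lemma dx_add_U (h : D.Admissible α β T) (hb : D.BoundedBy α β T M) (hβ : 0 < β) {s : ℝ}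
    (hs : 0 < s) (hv : ContDiffOn ℝ 1 (v s) (Icc 0 1)) {y : ℝ} (hy : y ∈ Icc (0 : ℝ) 1) :
    derivWithin (fun z => v s z + D.U s z) (Icc (0 : ℝ) 1) y =
      dx (v s) y + heatD s (per D.u₀) y := by
  have h1 := (hv.differentiableOn one_ne_zero y hy).hasDerivWithinAt
  have h2 := (hasDerivAt_heat hs ((h.perHolder hb hβ).bddMeas hβ) y).hasDerivWithinAt (s := Icc 0 1)
  rw [U_eq h hb hβ hs]
  exact (h1.add h2).derivWithin (uniqueDiffOn_unit y hy)

lemma drift_eq (h : D.Admissible α β T) (hb : D.BoundedBy α β T M) (hβ : 0 < β) {s : ℝ}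
    (hs : s ∈ Ioo 0 T) (hv : ContDiffOn ℝ 1 (v s) (Icc 0 1)) {y : ℝ} (hy : y ∈ Icc (0 : ℝ) 1) :
    D.drift g v s y = g (D.u v s y) (dx (v s) y + heatD s (per D.u₀) y) := by
  rw [drift, dx_add_U h hb hβ hs.1 hv hy]

lemma stronglyMeasurable_driftJ (h : D.Admissible α β T) (hb : D.BoundedBy α β T M) (hα : 0 < α)
    (hβ : 0 < β) (hT : 0 ≤ T) (hv : C1Path T v) (hg : C3Bound L g) :
    StronglyMeasurable (Function.uncurry (D.driftJ g T v)) := by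
  have hgc : Continuous g := continuous_iff_continuousAt.2 fun x => (hg.d1 x).continuousAt
  have m1 : StronglyMeasurable fun q : ℝ × ℝ => heatD q.1 (per D.u₀) (clamp 0 1 q.2) :=
    stronglyMeasurable_heatD (β := ℝ × ℝ) (f := fun _ => per D.u₀)
      (((h.perHolder hb hβ).bddMeas hβ).meas.comp_measurable measurable_snd) measurable_fst
      ((continuous_clamp _ _).measurable.comp measurable_snd)
  have m2 := (continuous_clampPath hT (f := fun t => dx (v t)) hv.continuousOn_dx).stronglyMeasurable
  have hΦ : Continuous fun z : Vec n × Vec n => g z.1 z.2 := by fun_prop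
  have m3 := hΦ.comp_stronglyMeasurable
    ((stronglyMeasurable_u h hb hα hβ hT hv).prodMk (m2.add m1))
  refine stronglyMeasurable_ite_Ioo m3 fun q hs => ?_
  rw [drift_eq h hb hβ hs (hv.mem _ (Ioo_subset_Icc_self hs)) (clamp_mem _), u_eq h hb hβ hs,
    Pi.add_apply, clamp_of_mem' (Ioo_subset_Icc_self hs)]

/-- The germ of the rough integral, continuous in the data. -/
def germMap (g : Vec n → Mat n) (z : Vec n × (Vec n × Vec n) × Mat n × Tens n) : Vec n :=
  g z.1 (z.2.1.2 - z.2.1.1) + contract z.2.2.2 ((fderiv ℝ g z.1).comp z.2.2.1) z.2.2.1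

lemma continuous_germMap (hg : C3Bound L g) : Continuous (germMap g) := by
  have hgc : Continuous g := continuous_iff_continuousAt.2 fun x => (hg.d1 x).continuousAt
  have hgc' : Continuous (fderiv ℝ g) := continuous_iff_continuousAt.2 fun x => (hg.d2 x).continuousAt
  unfold germMap contract
  fun_prop

lemma stronglyMeasurable_germ (h : D.Admissible α β T) (hb : D.BoundedBy α β T M) (hα : 0 < α)
    (hβ : 0 < β) (hT : 0 ≤ T) (hv : C1Path T v) (hg : C3Bound L g) {a b : ℝ → ℝ}
    (ha : Continuous a) (hb' : Continuous b) (ha1 : ∀ y, a y ∈ Icc (0 : ℝ) 1)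
    (hb1 : ∀ y, b y ∈ Icc (0 : ℝ) 1) :
    StronglyMeasurable fun q : ℝ × ℝ =>
      if q.1 ∈ Ioo 0 T then (D.slice v q.1).germ g (a q.2) (b q.2) else 0 := by
  have hXX : Continuous fun z : ℝ × ℝ × ℝ => D.XX (clamp 0 T z.1) (clamp 0 1 z.2.1) (clamp 0 1 z.2.2) :=
    (h.XX_mem.continuousOn (by positivity)).comp_continuous
      (f := fun z : ℝ × ℝ × ℝ => (clamp 0 T z.1, clamp 0 1 z.2.1, clamp 0 1 z.2.2))
      (((continuous_clamp _ _).comp continuous_fst).prodMk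
        (((continuous_clamp _ _).comp (continuous_fst.comp continuous_snd)).prodMk
        ((continuous_clamp _ _).comp (continuous_snd.comp continuous_snd))))
      fun _ => ⟨⟨le_clamp _ _ _, clamp_le hT _⟩, clamp_mem _, clamp_mem _⟩
  have m1 := (stronglyMeasurable_u h hb hα hβ hT hv).comp_measurable
    (g := fun q : ℝ × ℝ => (q.1, a q.2)) (by fun_prop)
  have cΨ := continuous_clampPath hT (h.Ψ_mem.continuousOn hα)
  have cΨ' := continuous_clampPath hT (h.Ψ'_mem.continuousOn hα)
  have m2 := (cΨ.comp (g := fun z : ℝ × ℝ => D.Ψ (clamp 0 T z.1) (clamp 0 1 z.2))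
    (f := fun q : ℝ × ℝ => (q.1, a q.2)) (by fun_prop)).stronglyMeasurable
  have m3 := (cΨ.comp (g := fun z : ℝ × ℝ => D.Ψ (clamp 0 T z.1) (clamp 0 1 z.2))
    (f := fun q : ℝ × ℝ => (q.1, b q.2)) (by fun_prop)).stronglyMeasurable
  have m4 := (cΨ'.comp (g := fun z : ℝ × ℝ => D.Ψ' (clamp 0 T z.1) (clamp 0 1 z.2))
    (f := fun q : ℝ × ℝ => (q.1, a q.2)) (by fun_prop)).stronglyMeasurable
  have m5 := (hXX.comp (f := fun q : ℝ × ℝ => (q.1, a q.2, b q.2)) (by fun_prop)).stronglyMeasurable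
  refine stronglyMeasurable_ite_Ioo ((continuous_germMap hg).comp_stronglyMeasurable
    (m1.prodMk ((m2.prodMk m3).prodMk (m4.prodMk m5)))) fun q hs => ?_
  rw [Slice.germ_eq, Slice.Y', slice_u, u_eq h hb hβ hs]
  simp only [Function.comp_apply, clamp_of_mem (ha1 _), clamp_of_mem (hb1 _),
    clamp_of_mem' (Ioo_subset_Icc_self hs)]
  rfl

lemma stronglyMeasurable_roughJ (h : D.Admissible α β T) (hb : D.BoundedBy α β T M) (hα : 0 < α)
    (hβ : 0 < β) (hT : 0 ≤ T) (hv : C1Path T v) (hg : C3Bound L g) {ε : ℝ} (hε : 0 < ε)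
    (hΞ : ∀ s ∈ Ioo 0 T, ∃ c, IsGerm ε c ((D.slice v s).germ g)) :
    StronglyMeasurable (Function.uncurry (D.roughJ g T v)) :=
  stronglyMeasurable_sew (Ξ := fun s => (D.slice v s).germ g) hε hΞ fun _ _ ha hb' ha1 hb1 =>
    stronglyMeasurable_germ h hb hα hβ hT hv hg ha hb' ha1 hb1

end Measurability

end Data

end Sources

/-! ### Estimates for the fixed point map -/

section MapEstimates

/-! ### Heat flows of bounded families as sources. -/

section HeatSource

variable {E : Type*} [NormedAddCommGroup E] [NormedSpace ℝ E]

/-- `J s` is bounded by `C s^{-σ}`. -/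
structure BoundedFamily (T σ C : ℝ) (J : ℝ → ℝ → E) : Prop where
  meas : StronglyMeasurable (Function.uncurry J)
  bound : ∀ s ∈ Ioo 0 T, ∀ y, ‖J s y‖ ≤ C * s ^ (-σ)

namespace BoundedFamily

variable {T σ C : ℝ} {J : ℝ → ℝ → E}

lemma bddMeas (h : BoundedFamily T σ C J) {s : ℝ} (hs : s ∈ Ioo 0 T) :
    BddMeas (C * s ^ (-σ)) (per (J s)) :=
  ⟨(stronglyMeasurable_per h.meas).comp_measurable (g := fun x : ℝ => (s, x)) (by fun_prop),
    fun _ => h.bound s hs _⟩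

/-- The heat flow loses nothing in r. The weaker bound with r^{(p-1)/2}, legitimate for r ≤ 1,
leaves p free; it is later tuned so that the drift gains the same power of T as the rough term. -/
lemma source (h : BoundedFamily T σ C J) (hC : 0 ≤ C) {p : ℝ} (hp1 : p ≤ 1) :
    Source T ((p - 1) / 2) (-σ) C (fun r s => heat r (per (J s))) := by
  refine ⟨?_, fun r s x hr hr1 hs hsT => ?_, fun r k s x hr hk _ hs hsT =>
    heat_heat hr.le hk.le (h.bddMeas ⟨hs, hsT⟩) x⟩
  · exact stronglyMeasurable_heat (β := ℝ × ℝ × ℝ) (f := fun z => per (J z.2.1))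
      ((stronglyMeasurable_per h.meas).comp_measurable
        (g := fun q : (ℝ × ℝ × ℝ) × ℝ => (q.1.2.1, q.2)) (by fun_prop)) (by fun_prop) (by fun_prop)
  · refine (norm_heat_le (h.bddMeas ⟨hs, hsT⟩).bound r x).trans ?_
    have h1 : 1 ≤ r ^ ((p - 1) / 2) :=
      Real.one_le_rpow_of_pos_of_le_one_of_nonpos hr hr1 (by linarith)
    gcongr
    exact le_mul_of_one_le_right hC h1

end BoundedFamily

end HeatSource

/-- The constant in the stability of the rough integral. -/
def roughConst (n : ℕ) (α A : ℝ) : ℝ := Slice.Close.germConst n A * (1 + sewConst ((3 * α - 1) / 2))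

lemma germConst_nonneg (n : ℕ) (A : ℝ) : 0 ≤ Slice.Close.germConst n A := by
  unfold Slice.Close.germConst; positivity

lemma roughConst_nonneg (n : ℕ) {α : ℝ} (hα : 1 / 3 < α) (A : ℝ) : 0 ≤ roughConst n α A := by
  have := sewConst_nonneg (ε := (3 * α - 1) / 2) (by linarith)
  have := germConst_nonneg n A
  unfold roughConst; positivity

namespace Data.Setup

variable {n : ℕ} {α β T δ : ℝ} {M K L : ℝ≥0} {g : Vec n → Mat n} {D D₂ : Data n}
  {v w : ℝ → ℝ → Vec n}

lemma isGerm (h : Setup α β T M K L δ g D D₂ v w) {s : ℝ} (hs : s ∈ Ioo 0 T) :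
    IsGerm ((3 * α - 1) / 2) (Slice.Close.germConst n (bigConst M K L) * s ^ (-((2 * α - β) / 2)))
      ((D.slice v s).germ g) ∧
    IsGerm ((3 * α - 1) / 2) (Slice.Close.germConst n (bigConst M K L) * s ^ (-((2 * α - β) / 2)))
      ((D₂.slice w s).germ g) ∧
    IsGerm ((3 * α - 1) / 2) (Slice.Close.germConst n (bigConst M K L) * δ * s ^ (-((2 * α - β) / 2)))
      (fun x y => (D.slice v s).germ g x y - (D₂.slice w s).germ g x y) := by
  obtain ⟨hα, hαβ, hβ, hT, hT1, hδ⟩ := h.1, h.2, h.3, h.4, h.5, h.6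
  exact (h.close ⟨hs.1, hs.2.le⟩).isGerm h.hg L.coe_nonneg L_le_bigConst one_le_bigConst
    (Real.one_le_rpow_of_pos_of_le_one_of_nonpos hs.1 (hs.2.le.trans hT1) (by linarith)) hδ
    (by linarith)

/-- Additivity of sewing turns the estimate on [x,y] into α-Hölder continuity of the primitive. The
third family is the sewing of the difference of the germs, by linearity of sewing. -/
lemma roughFamily (h : Setup α β T M K L δ g D D₂ v w) :
    StieltjesFamily T α ((2 * α - β) / 2) (roughConst n α (bigConst M K L)) (D.roughJ g T v) ∧
    StieltjesFamily T α ((2 * α - β) / 2) (roughConst n α (bigConst M K L)) (D₂.roughJ g T w) ∧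
    StieltjesFamily T α ((2 * α - β) / 2) (roughConst n α (bigConst M K L) * δ)
      (fun s y => D.roughJ g T v s y - D₂.roughJ g T w s y) := by
  obtain ⟨hα, hαβ, hβ, hT, hT1, hδ⟩ := h.1, h.2, h.3, h.4, h.5, h.6
  have hα0 : 0 < α := by linarith
  have hε : 0 < (3 * α - 1) / 2 := by linarith
  have hA1 : 1 ≤ bigConst M K L := one_le_bigConst
  have hA0 : 0 ≤ bigConst M K L := by linarith
  have hG := germConst_nonneg n (bigConst M K L)
  have m1 := stronglyMeasurable_roughJ h.adm h.bdd hα0 (by linarith) hT.le h.hv.1 h.hg hε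
    fun s hs => ⟨_, (h.isGerm hs).1⟩
  have m2 := stronglyMeasurable_roughJ h.adm₂ h.bdd₂ hα0 (by linarith) hT.le h.hw.1 h.hg hε
    fun s hs => ⟨_, (h.isGerm hs).2.1⟩
  have hB : ∀ s ∈ Ioo 0 T, 1 ≤ s ^ (-((2 * α - β) / 2)) := fun s hs =>
    Real.one_le_rpow_of_pos_of_le_one_of_nonpos hs.1 (hs.2.le.trans hT1) (by linarith)
  have hnear : ∀ s ∈ Ioo 0 T, ∀ x y : ℝ, 0 ≤ x → x ≤ y → y ≤ 1 → _ := fun s hs x y hx hxy hy =>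
    (h.close ⟨hs.1, hs.2.le⟩).germ_near h.hg L.coe_nonneg L_le_bigConst hA1 hδ hα0.le hx hxy hy
  have e1 : ∀ s ∈ Ioo 0 T, ∀ y ∈ Icc (0 : ℝ) 1,
      D.roughJ g T v s y = sew ((D.slice v s).germ g) 0 y := fun s hs y hy => by
    rw [roughJ, if_pos hs, clamp_of_mem hy]
  have e2 : ∀ s ∈ Ioo 0 T, ∀ y ∈ Icc (0 : ℝ) 1,
      D₂.roughJ g T w s y = sew ((D₂.slice w s).germ g) 0 y := fun s hs y hy => by
    rw [roughJ, if_pos hs, clamp_of_mem hy]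
  have e3 : ∀ s ∈ Ioo 0 T, ∀ y ∈ Icc (0 : ℝ) 1,
      D.roughJ g T v s y - D₂.roughJ g T w s y =
        sew (fun x y => (D.slice v s).germ g x y - (D₂.slice w s).germ g x y) 0 y :=
    fun s hs y hy => by
      rw [e1 s hs y hy, e2 s hs y hy,
        sew_sub hε (h.isGerm hs).1 (h.isGerm hs).2.1 le_rfl hy.1 hy.2]
  have z : (0 : ℝ) ∈ Icc (0 : ℝ) 1 := by simp
  refine ⟨⟨m1, fun s hs => ?_, fun s hs x y hx hxy hy => ?_⟩,
    ⟨m2, fun s hs => ?_, fun s hs x y hx hxy hy => ?_⟩,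
    ⟨m1.sub m2, fun s hs => ?_, fun s hs x y hx hxy hy => ?_⟩⟩
  · rw [e1 s hs 0 z]; exact (h.isGerm hs).1.sew_self hε le_rfl zero_le_one
  · rw [e1 s hs y ⟨hx.trans hxy, hy⟩, e1 s hs x ⟨hx, hxy.trans hy⟩]
    exact norm_sew_sub_le hε (by linarith) (hB s hs) hG (h.isGerm hs).1
      (fun x y hx hxy hy => (hnear s hs x y hx hxy hy).left) hx hxy hy
  · rw [e2 s hs 0 z]; exact (h.isGerm hs).2.1.sew_self hε le_rfl zero_le_one
  · rw [e2 s hs y ⟨hx.trans hxy, hy⟩, e2 s hs x ⟨hx, hxy.trans hy⟩]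
    exact norm_sew_sub_le hε (by linarith) (hB s hs) hG (h.isGerm hs).2.1
      (fun x y hx hxy hy => (hnear s hs x y hx hxy hy).right) hx hxy hy
  · rw [e3 s hs 0 z]; exact (h.isGerm hs).2.2.sew_self hε le_rfl zero_le_one
  · rw [e3 s hs y ⟨hx.trans hxy, hy⟩, e3 s hs x ⟨hx, hxy.trans hy⟩]
    refine (norm_sew_sub_le (p := α) hε (by linarith) (hB s hs) (by positivity) (h.isGerm hs).2.2
      (fun x y hx hxy hy => (hnear s hs x y hx hxy hy).diff.trans_eq (by ring)) hx hxy hy).trans_eq ?_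
    rw [roughConst]; ring

/-- ∂ₓv is bounded, and ∂ₓU(s) is of size s^{-(1-β)/2} because the initial value is periodic and
β-Hölder. The coefficient g(u) contributes no singularity. -/
lemma drift_near (h : Setup α β T M K L δ g D D₂ v w) {s : ℝ} (hs : s ∈ Ioo 0 T) {y : ℝ}
    (hy : y ∈ Icc (0 : ℝ) 1) :
    Near δ (4 * bigConst M K L ^ 3 * s ^ (-((1 - β) / 2))) (D.drift g v s y) (D₂.drift g w s y) := by
  obtain ⟨hα, hαβ, hβ, hT, hT1, hδ⟩ := h.1, h.2, h.3, h.4, h.5, h.6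
  have hβ0 : 0 < β := by linarith
  have hs' : s ∈ Icc 0 T := Ioo_subset_Icc_self hs
  have hM := M.coe_nonneg
  have hK := K.coe_nonneg
  have hL := L.coe_nonneg
  have hA : bigConst M K L = 5 + L + 4 * M + K := rfl
  have hLA : (L : ℝ) ≤ bigConst M K L := L_le_bigConst
  set A := bigConst M K L
  have hA1 : 1 ≤ A := by linarith
  have p1 := h.adm.perHolder h.bdd hβ0
  have p2 := h.adm₂.perHolder h.bdd₂ hβ0
  have hv := h.hv.1.mem s hs'
  have hw := h.hw.1.mem s hs'
  obtain ⟨e1, e2, e3⟩ := h.v_le hs'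
  have hB1 : 1 ≤ s ^ (-((1 - β) / 2)) :=
    Real.one_le_rpow_of_pos_of_le_one_of_nonpos hs.1 (hs.2.le.trans hT1) (by linarith)
  have g1 := p1.norm_heatD_le hβ0 (by linarith) hs.1 y
  have g2 := p2.norm_heatD_le hβ0 (by linarith) hs.1 y
  have g3 := h.perHolder_sub.norm_heatD_le hβ0 (by linarith) hs.1 y
  have g4 : heatD s (per fun x => D.u₀ x - D₂.u₀ x) y = heatD s (per D.u₀) y - heatD s (per D₂.u₀) y :=
    heatD_sub (p1.bddMeas hβ0) (p2.bddMeas hβ0) s y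
  rw [g4] at g3
  rw [show (β - 1) / 2 = -((1 - β) / 2) by ring] at g1 g2 g3
  have f1 := norm_dx_le_of_c1Norm hK e1 y hy
  have f2 := norm_dx_le_of_c1Norm hK e2 y hy
  have f3 := norm_dx_le_of_c1Norm hδ e3 y hy
  rw [dx_sub hv hw hy] at f3
  rw [drift_eq h.adm h.bdd hβ0 hs hv hy, drift_eq h.adm₂ h.bdd₂ hβ0 hs hw hy]
  set B := s ^ (-((1 - β) / 2))
  have n2 : Near δ (A * B) (dx (v s) y + heatD s (per D.u₀) y)
      (dx (w s) y + heatD s (per D₂.u₀) y) := by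
    refine ⟨(norm_add_le_of_le f1 g1).trans ?_, (norm_add_le_of_le f2 g2).trans ?_, ?_⟩
    · nlinarith
    · nlinarith
    · rw [add_sub_add_comm]
      refine (norm_add_le_of_le f3 g3).trans ?_
      have : δ ≤ B * δ := le_mul_of_one_le_left hδ hB1
      have : 0 ≤ B * δ := by positivity
      nlinarith
  have n1 := (h.close ⟨hs.1, hs.2.le⟩).g_near h.hg hL hLA hA1 hy.1 hy.2
  rw [slice_u, slice_u] at n1
  exact (n1.apply hδ n2).mono hδ (le_of_eq (by ring))

lemma driftFamily (h : Setup α β T M K L δ g D D₂ v w) :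
    BoundedFamily T ((1 - β) / 2) (4 * bigConst M K L ^ 3) (D.driftJ g T v) ∧
    BoundedFamily T ((1 - β) / 2) (4 * bigConst M K L ^ 3) (D₂.driftJ g T w) ∧
    BoundedFamily T ((1 - β) / 2) (4 * bigConst M K L ^ 3 * δ)
      (fun s y => D.driftJ g T v s y - D₂.driftJ g T w s y) := by
  obtain ⟨hα, hαβ, hβ, hT, hT1, hδ⟩ := h.1, h.2, h.3, h.4, h.5, h.6
  have m1 := stronglyMeasurable_driftJ h.adm h.bdd (by linarith) (by linarith) hT.le h.hv.1 h.hg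
  have m2 := stronglyMeasurable_driftJ h.adm₂ h.bdd₂ (by linarith) (by linarith) hT.le h.hw.1 h.hg
  have e1 : ∀ s ∈ Ioo 0 T, ∀ y, D.driftJ g T v s y = D.drift g v s (clamp 0 1 y) :=
    fun s hs y => if_pos hs
  have e2 : ∀ s ∈ Ioo 0 T, ∀ y, D₂.driftJ g T w s y = D₂.drift g w s (clamp 0 1 y) :=
    fun s hs y => if_pos hs
  refine ⟨⟨m1, fun s hs y => ?_⟩, ⟨m2, fun s hs y => ?_⟩, ⟨m1.sub m2, fun s hs y => ?_⟩⟩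
  · rw [e1 s hs]; exact (h.drift_near hs (clamp_mem y)).left
  · rw [e2 s hs]; exact (h.drift_near hs (clamp_mem y)).right
  · rw [e1 s hs, e2 s hs]; exact (h.drift_near hs (clamp_mem y)).diff.trans_eq (by ring)

end Data.Setup

end MapEstimates

/-! ### Representation of the fixed point map -/

section Representation

variable {n : ℕ}

lemma DuhamelBounds.congr {E : Type*} [NormedAddCommGroup E] [NormedSpace ℝ E] {T κ B : ℝ}
    {N ND N' ND' : ℝ → ℝ → E} (h : DuhamelBounds T κ B N ND)
    (hN : ∀ t ∈ Icc 0 T, ∀ x, N t x = N' t x)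
    (hD : ∀ t ∈ Icc 0 T, ∀ x, HasDerivAt (N' t) (ND' t x) x) : DuhamelBounds T κ B N' ND' := by
  have e : ∀ t ∈ Icc 0 T, ∀ x, ND t x = ND' t x := fun t ht x =>
    (h.deriv t ht x).unique (by rw [funext (hN t ht)]; exact hD t ht x)
  refine ⟨hD, fun t ht x => ?_, fun t ht x => ?_, fun s hs t ht x => ?_, fun s hs t ht x => ?_,
    fun t ht x y => ?_⟩
  · rw [← hN t ht]; exact h.norm_le t ht x
  · rw [← e t ht]; exact h.norm_deriv_le t ht x
  · rw [← hN t ht, ← hN s hs]; exact h.time s hs t ht x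
  · rw [← e t ht, ← e s hs]; exact h.time_deriv s hs t ht x
  · rw [← e t ht, ← e t ht]; exact h.space_deriv t ht x y

namespace Data

/-- The fixed point map, in terms of the two sources. -/
def sol (D : Data n) (g : Vec n → Mat n) (T : ℝ) (v : ℝ → ℝ → Vec n) (t x : ℝ) : Vec n :=
  duhamel (D.driftQ g T v) t x + duhamel (stieltjesQ (D.roughJ g T v)) t x

/-- The spatial derivative of `Data.sol`. -/
def solD (D : Data n) (g : Vec n → Mat n) (T : ℝ) (v : ℝ → ℝ → Vec n) (t x : ℝ) : Vec n :=
  duhamel (sourceD (D.driftQ g T v)) t x + duhamel (sourceD (stieltjesQ (D.roughJ g T v))) t x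

/-- The constant in the bounds on the fixed point map. -/
def solConst (n : ℕ) (α β A : ℝ) : ℝ :=
  duhamelConst (1 - α) ((1 - β) / 2) * (4 * A ^ 3) +
    duhamelConst α ((2 * α - β) / 2) * (9 * roughConst n α A)

lemma solConst_nonneg (n : ℕ) {α β A : ℝ} (hα : 1 / 3 < α) (hαβ : α < β) (hβ : β < 1 / 2)
    (hA : 0 ≤ A) : 0 ≤ solConst n α β A := by
  have h1 := duhamelConst_nonneg (p := 1 - α) (σ := (1 - β) / 2) (by linarith) (by linarith)
    (by linarith)
  have h2 := duhamelConst_nonneg (p := α) (σ := (2 * α - β) / 2) (by linarith) (by linarith)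
    (by linarith)
  have h3 := roughConst_nonneg n hα A
  unfold solConst
  positivity

namespace Setup

variable {α β T δ : ℝ} {M K L : ℝ≥0} {g : Vec n → Mat n} {D D₂ : Data n} {v w : ℝ → ℝ → Vec n}

lemma source_drift (h : Setup α β T M K L δ g D D₂ v w) :
    Source T ((1 - α - 1) / 2) (-((1 - β) / 2)) (4 * bigConst M K L ^ 3) (D.driftQ g T v) ∧
    Source T ((1 - α - 1) / 2) (-((1 - β) / 2)) (4 * bigConst M K L ^ 3) (D₂.driftQ g T w) ∧
    Source T ((1 - α - 1) / 2) (-((1 - β) / 2)) (4 * bigConst M K L ^ 3 * δ)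
      (fun r s => heat r (per fun y => D.driftJ g T v s y - D₂.driftJ g T w s y)) := by
  have hA : 1 ≤ bigConst M K L := one_le_bigConst
  have hδ := h.hδ
  have hα := h.hα
  exact ⟨h.driftFamily.1.source (by positivity) (by linarith),
    h.driftFamily.2.1.source (by positivity) (by linarith),
    h.driftFamily.2.2.source (by positivity) (by linarith)⟩

lemma source_rough (h : Setup α β T M K L δ g D D₂ v w) :
    Source T ((α - 1) / 2) (-((2 * α - β) / 2)) (9 * roughConst n α (bigConst M K L))
      (stieltjesQ (D.roughJ g T v)) ∧
    Source T ((α - 1) / 2) (-((2 * α - β) / 2)) (9 * roughConst n α (bigConst M K L))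
      (stieltjesQ (D₂.roughJ g T w)) ∧
    Source T ((α - 1) / 2) (-((2 * α - β) / 2)) (9 * (roughConst n α (bigConst M K L) * δ))
      (stieltjesQ fun s y => D.roughJ g T v s y - D₂.roughJ g T w s y) := by
  have hR := roughConst_nonneg n h.hα (bigConst M K L)
  have hδ := h.hδ
  have hα := h.hα
  have hαβ := h.hαβ
  have hβ := h.hβ
  exact ⟨h.roughFamily.1.source hR (by linarith) (by linarith),
    h.roughFamily.2.1.source hR (by linarith) (by linarith),
    h.roughFamily.2.2.source (by positivity) (by linarith) (by linarith)⟩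

/-- The exponents match: (1-α)/2 - (1-β)/2 and α/2 - (2α-β)/2 both equal (β-α)/2. The requirement σ
< p/2 is α < β in either case. -/
lemma bounds_of_sources (h : Setup α β T M K L δ g D D₂ v w) {C C' : ℝ} (hC : 0 ≤ C) (hC' : 0 ≤ C')
    {q q' : ℝ → ℝ → ℝ → Vec n} (hq : Source T ((1 - α - 1) / 2) (-((1 - β) / 2)) C q)
    (hq' : Source T ((α - 1) / 2) (-((2 * α - β) / 2)) C' q') :
    DuhamelBounds T ((β - α) / 2)
      (duhamelConst (1 - α) ((1 - β) / 2) * C + duhamelConst α ((2 * α - β) / 2) * C')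
      (fun t x => duhamel q t x + duhamel q' t x)
      (fun t x => duhamel (sourceD q) t x + duhamel (sourceD q') t x) := by
  obtain ⟨hα, hαβ, hβ, hT, hT1, hδ⟩ := h.1, h.2, h.3, h.4, h.5, h.6
  have b1 := hq.duhamelBounds hT1 hC (by linarith) (by linarith) (by linarith)
  have b2 := hq'.duhamelBounds hT1 hC' (by linarith) (by linarith) (by linarith)
  rw [show (1 - α) / 2 - (1 - β) / 2 = (β - α) / 2 by ring] at b1
  rw [show α / 2 - (2 * α - β) / 2 = (β - α) / 2 by ring] at b2
  exact b1.add b2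

lemma bounds (h : Setup α β T M K L δ g D D₂ v w) :
    DuhamelBounds T ((β - α) / 2) (solConst n α β (bigConst M K L)) (D.sol g T v) (D.solD g T v) ∧
    DuhamelBounds T ((β - α) / 2) (solConst n α β (bigConst M K L)) (D₂.sol g T w)
      (D₂.solD g T w) := by
  have hA : 1 ≤ bigConst M K L := one_le_bigConst
  have hR := roughConst_nonneg n h.hα (bigConst M K L)
  exact ⟨h.bounds_of_sources (by positivity) (by positivity) h.source_drift.1 h.source_rough.1,
    h.bounds_of_sources (by positivity) (by positivity) h.source_drift.2.1 h.source_rough.2.1⟩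

/-- The difference of the images is the time convolution of the differences of the sources. These
are sources themselves with constants proportional to δ, so no separate difference estimate is
needed. -/
lemma bounds_sub (h : Setup α β T M K L δ g D D₂ v w) :
    DuhamelBounds T ((β - α) / 2) (solConst n α β (bigConst M K L) * δ)
      (fun t x => D.sol g T v t x - D₂.sol g T w t x)
      (fun t x => D.solD g T v t x - D₂.solD g T w t x) := by
  obtain ⟨hα, hαβ, hβ, hT, hT1, hδ⟩ := h.1, h.2, h.3, h.4, h.5, h.6
  have hA : 1 ≤ bigConst M K L := one_le_bigConst
  have hR := roughConst_nonneg n h.hα (bigConst M K L)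
  have b := h.bounds_of_sources (by positivity) (by positivity) h.source_drift.2.2 h.source_rough.2.2
  rw [show solConst n α β (bigConst M K L) * δ =
    duhamelConst (1 - α) ((1 - β) / 2) * (4 * bigConst M K L ^ 3 * δ) +
      duhamelConst α ((2 * α - β) / 2) * (9 * (roughConst n α (bigConst M K L) * δ)) by
    rw [solConst]; ring]
  refine b.congr (fun t ht x => ?_) fun t ht x =>
    (h.bounds.1.deriv t ht x).sub (h.bounds.2.deriv t ht x)
  rw [duhamel_sub (d := fun r s => heat r (per fun y => D.driftJ g T v s y - D₂.driftJ g T w s y))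
    h.source_drift.1 h.source_drift.2.1 hT1 (by positivity) (by positivity)
    (by linarith) (by linarith) (by linarith) (by linarith) (fun r s hs x =>
      heat_sub (h.driftFamily.1.bddMeas hs) (h.driftFamily.2.1.bddMeas hs) r x) ht,
    duhamel_sub h.source_rough.1 h.source_rough.2.1 hT1 (by positivity) (by positivity)
    (by linarith) (by linarith) (by linarith) (by linarith) (fun r s hs x =>
      h.roughFamily.1.stieltjesQ_sub h.roughFamily.2.1 hR hR (by linarith) (by linarith) hs r x) ht,
    sol, sol]
  abel

/-- The kernel contributes nothing to the derivative with respect to X, so it factors out of the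
second-order approximation at the left endpoint. What remains is the germ of ∫ g(u) dΨ, close to the
increments of its sewing by order 1 + ε, and the Riemann–Stieltjes lemma applies. -/
lemma isRoughIntegral (h : Setup α β T M K L δ g D D₂ v w) {s : ℝ} (hs : s ∈ Ioo 0 T) {r : ℝ}
    (hr : 0 < r) (x : ℝ) :
    IsRoughIntegral (D.XX s) (D.integrand g v r s x) (D.integrand' g v r s x) (D.Ψ s) (D.Ψ' s)
      (stieltjesQ (D.roughJ g T v) r s x) := by
  obtain ⟨hα, hαβ, hβ, hT, hT1, hδ⟩ := h.1, h.2, h.3, h.4, h.5, h.6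
  have hε : 0 < (3 * α - 1) / 2 := by linarith
  have hα0 : 0 < α := by linarith
  have hJ := h.roughFamily.1
  have hG := (h.isGerm hs).1
  have hIc : ContinuousOn (D.roughJ g T v s) (Icc 0 1) := by
    refine continuousOn_of_incr_le (c := roughConst n α (bigConst M K L) * s ^ (-((2 * α - β) / 2)))
      hα0 fun x hx y hy => ?_
    wlog hxy : x ≤ y generalizing x y
    · have := this y hy x hx (le_of_not_ge hxy)
      rwa [incr, norm_sub_rev, abs_sub_comm] at this
    have := hJ.holder s hs x y hx.1 hxy hy.2
    rwa [incr, abs_sub_comm, abs_of_nonneg (sub_nonneg.2 hxy)]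
  have e : ∀ y ∈ Icc (0 : ℝ) 1, D.roughJ g T v s y = sew ((D.slice v s).germ g) 0 y :=
    fun y hy => by rw [roughJ, if_pos hs, clamp_of_mem hy]
  have hΞ : ∀ x y, 0 ≤ x → x ≤ y → y ≤ 1 →
      ‖(D.slice v s).germ g x y - (D.roughJ g T v s y - D.roughJ g T v s x)‖ ≤
        Slice.Close.germConst n (bigConst M K L) * s ^ (-((2 * α - β) / 2)) *
          sewConst ((3 * α - 1) / 2) * (y - x) ^ (1 + (3 * α - 1) / 2) :=
    fun x y hx hxy hy => by
      rw [e y ⟨hx.trans hxy, hy⟩, e x ⟨hx, hxy.trans hy⟩, ← hG.sew_add hε le_rfl hx hxy hy,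
        add_sub_cancel_left]
      exact hG.norm_sub_sew_le hε hx hxy hy
  intro η hη
  have hφ : ∀ y, HasDerivAt (fun y => heatKernel r (x - y)) (-heatKernelD r (x - y)) y := fun y => by
    simpa using (hasDerivAt_heatKernel hr (x - y)).comp_const_sub x y
  obtain ⟨d, hd, H⟩ := riemann_stieltjes hφ
    ((continuous_heatKernelD hr).comp (by fun_prop)).neg hα0 hε (hJ.holder s hs) hIc hΞ hη
  refine ⟨d, hd, fun m p hp => ?_⟩
  have := H m p hp
  rw [heat_stieltjes hr hIc (hJ.zero s hs)] at this
  have e2 : ∀ a b, secondOrder (D.XX s) (D.integrand g v r s x) (D.integrand' g v r s x) (D.Ψ s)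
      (D.Ψ' s) a b = heatKernel r (x - a) • (D.slice v s).germ g a b := fun a b => by
    simp only [Slice.germ, Slice.Y', slice_u, secondOrder, integrand, integrand', smul_add,
      Finset.smul_sum, smul_apply, smul_comm (heatKernel r (x - a))]
    rfl
  simp only [e2]
  exact this

end Setup

end Data

end Representation

/-! ### The integrals in the fixed point map exist -/

section WellDefined

variable {n : ℕ}

/-- Half of the heat time already gives a bounded measurable derivative; flowing for the other half
makes it differentiable. -/
lemma continuous_heatD {E : Type*} [NormedAddCommGroup E] [NormedSpace ℝ E] {r B : ℝ} (hr : 0 < r)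
    {F : ℝ → E} (hF : BddMeas B F) : Continuous (heatD r F) := by
  have e : heatD r F = heat (r / 2) (heatD (r / 2) F) := by
    funext x
    rw [heat_heatD (half_pos hr) (half_pos hr) hF, add_halves]
  rw [e]
  exact continuous_iff_continuousAt.2 fun x =>
    (hasDerivAt_heat (half_pos hr) (hF.heatD (half_pos hr)) x).continuousAt

lemma contDiff_heat {E : Type*} [NormedAddCommGroup E] [NormedSpace ℝ E] {r B : ℝ} (hr : 0 < r)
    {F : ℝ → E} (hF : BddMeas B F) : ContDiff ℝ 1 (heat r F) := by
  refine contDiff_one_iff_deriv.2 ⟨fun x => (hasDerivAt_heat hr hF x).differentiableAt, ?_⟩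
  rw [funext fun x => (hasDerivAt_heat hr hF x).deriv]
  exact continuous_heatD hr hF

namespace Data.Setup

variable {α β T δ : ℝ} {M K L : ℝ≥0} {g : Vec n → Mat n} {D D₂ : Data n} {v w : ℝ → ℝ → Vec n}

lemma initial_bddMeas (h : Setup α β T M K L δ g D D₂ v w) : BddMeas (M : ℝ) (per D.u₀) := by
  have hβ : 0 < β := by linarith [h.hα, h.hαβ]
  exact (h.adm.perHolder h.bdd hβ).bddMeas hβ

lemma continuousOn_drift (h : Setup α β T M K L δ g D D₂ v w) {s : ℝ} (hs : s ∈ Ioo 0 T) :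
    ContinuousOn (D.drift g v s) (Icc 0 1) := by
  have hα0 : 0 < α := by linarith [h.hα]
  have hβ0 : 0 < β := by linarith [h.hαβ]
  have hs' : s ∈ Icc 0 T := Ioo_subset_Icc_self hs
  have hv := h.hv.1.mem s hs'
  have hgc : Continuous g := continuous_iff_continuousAt.2 fun x => (h.hg.d1 x).continuousAt
  have hu : ContinuousOn (D.u v s) (Icc 0 1) := by
    rw [funext (u_eq (v := v) h.adm h.bdd hβ0 hs)]
    exact ((contDiff_heat hs.1 h.initial_bddMeas).continuous.continuousOn.add
      (continuousOn_of_holderNorm hα0 (h.adm.Ψ_mem.mem s hs'))).add hv.continuousOn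
  refine ContinuousOn.congr ?_ fun y hy => drift_eq h.adm h.bdd hβ0 hs hv hy
  exact (hgc.comp_continuousOn hu).clm_apply ((continuousOn_dx hv).add
    (continuous_heatD hs.1 h.initial_bddMeas).continuousOn)

lemma heatSemigroup_drift (h : Setup α β T M K L δ g D D₂ v w) {s : ℝ} (hs : s ∈ Ioo 0 T) {r : ℝ}
    (hr : 0 < r) (x : ℝ) : heatSemigroup r (D.drift g v s) x = D.driftQ g T v r s x := by
  have e : per (D.driftJ g T v s) = per (D.drift g v s) := by
    funext y
    rw [per, per, driftJ, if_pos hs, clamp_of_mem (fract_mem y)]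
  rw [heatSemigroup, if_neg hr.ne', driftQ, e]
  exact integral_heatKernel_smul hr (e ▸ h.driftFamily.1.bddMeas hs) x

lemma roughTerm_eq (h : Setup α β T M K L δ g D D₂ v w) {s : ℝ} (hs : s ∈ Ioo 0 T) {r : ℝ}
    (hr : 0 < r) (x : ℝ) : D.roughTerm g v r s x = stieltjesQ (D.roughJ g T v) r s x :=
  (h.isRoughIntegral hs hr x).roughIntegral_eq

lemma ae_time_eq {E : Type*} {t : ℝ} (ht : t ∈ Icc 0 T) {f f' : ℝ → E}
    (h : ∀ s ∈ Ioo 0 T, s < t → f s = f' s) :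
    ∀ᵐ s : ℝ, s ∈ uIoc 0 t → f s = f' s := by
  have : ∀ᵐ s : ℝ, s ≠ t := by simp [ae_iff]
  filter_upwards [this] with s hs hs'
  rw [uIoc_of_le ht.1] at hs'
  have hlt := lt_of_le_of_ne hs'.2 hs
  exact h s ⟨hs'.1, hlt.trans_le ht.2⟩ hlt

/-- The integrands agree for 0 < s < t. The endpoints, where the kernel or ∂ₓU may be singular, do
not affect the time integrals. -/
lemma G_eq (h : Setup α β T M K L δ g D D₂ v w) {t : ℝ} (ht : t ∈ Icc 0 T) (x : ℝ) :
    D.G g v t x = D.sol g T v t x := by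
  rw [G, sol, duhamel, duhamel]
  congr 1
  · exact intervalIntegral.integral_congr_ae (ae_time_eq ht fun s hs hst =>
      h.heatSemigroup_drift hs (sub_pos.2 hst) x)
  · exact intervalIntegral.integral_congr_ae (ae_time_eq ht fun s hs hst =>
      h.roughTerm_eq hs (sub_pos.2 hst) x)

lemma wellDefined (h : Setup α β T M K L δ g D D₂ v w) : D.WellDefined g T v := by
  obtain ⟨hα, hαβ, hβ, hT, hT1, hδ⟩ := h.1, h.2, h.3, h.4, h.5, h.6
  have hA : 1 ≤ bigConst M K L := one_le_bigConst
  have hR := roughConst_nonneg n hα (bigConst M K L)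
  refine ⟨fun s hs => ?_, fun t ht x _ s hs => ?_, fun t ht x _ s hs => ?_, fun t ht x _ => ?_,
    fun t ht x _ => ?_⟩
  · rw [U_eq h.adm h.bdd (by linarith) hs.1]
    exact (contDiff_heat hs.1 h.initial_bddMeas).contDiffOn
  · have hk : Continuous fun y => heatKernel (t - s) (x - y) :=
      (continuous_heatKernel (sub_pos.2 hs.2)).comp (by fun_prop)
    refine ContinuousOn.intervalIntegrable ?_
    rw [uIcc_of_le zero_le_one]
    exact hk.continuousOn.smul (h.continuousOn_drift ⟨hs.1, hs.2.trans_le ht.2⟩)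
  · exact ⟨_, h.isRoughIntegral ⟨hs.1, hs.2.trans_le ht.2⟩ (sub_pos.2 hs.2) x⟩
  · refine (h.source_drift.1.intervalIntegrable hT1 (by positivity) (by linarith) (by linarith)
      (by linarith) (by linarith) ht.1 ht.2 x).congr_ae ?_
    refine (ae_restrict_iff' measurableSet_uIoc).2 (ae_time_eq ht fun s hs hst => ?_)
    exact (h.heatSemigroup_drift hs (sub_pos.2 hst) x).symm
  · refine (h.source_rough.1.intervalIntegrable hT1 (by positivity) (by linarith) (by linarith)
      (by linarith) (by linarith) ht.1 ht.2 x).congr_ae ?_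
    refine (ae_restrict_iff' measurableSet_uIoc).2 (ae_time_eq ht fun s hs hst => ?_)
    exact (h.roughTerm_eq hs (sub_pos.2 hst) x).symm

end Data.Setup

end WellDefined

/-! ### The fixed point -/

section FixedPoint

/-! ### From bounds on time convolutions to C¹ paths, and passage to limits. -/

section Limits

variable {E : Type*} [NormedAddCommGroup E] [NormedSpace ℝ E] {T κ B : ℝ} {N ND f : ℝ → ℝ → E}

lemma C1Path.congr (h : C1Path T N) (hf : ∀ t ∈ Icc 0 T, f t = N t) : C1Path T f := by
  refine ⟨fun t ht => hf t ht ▸ h.mem t ht, fun t ht => ?_⟩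
  refine (h.continuous t ht).congr' ?_
  filter_upwards [self_mem_nhdsWithin] with s hs
  rw [hf s hs, hf t ht]

lemma supTime_le_iff {V : Type*} {N : V → ℝ≥0∞} {f : ℝ → V} {c : ℝ≥0∞} :
    supTime T N f ≤ c ↔ ∀ t ∈ Icc 0 T, N (f t) ≤ c := by
  simp only [supTime, iSup_le_iff]

lemma dx_congr {f f' : ℝ → E} (h : ∀ x ∈ Icc (0 : ℝ) 1, f x = f' x) {x : ℝ}
    (hx : x ∈ Icc (0 : ℝ) 1) : dx f x = dx f' x :=
  derivWithin_congr h (h x hx)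

lemma dx_eq {f : ℝ → E} {f' : E} {x : ℝ} (h : HasDerivAt f f' x) (hx : x ∈ Icc (0 : ℝ) 1) :
    dx f x = f' :=
  h.hasDerivWithinAt.derivWithin (uniqueDiffOn_unit x hx)

lemma c1Norm_zero : c1Norm (0 : ℝ → E) = 0 := by
  have h := c1Norm_le (f := (0 : ℝ → E)) le_rfl le_rfl (by simp) fun x hx => by
    rw [dx_eq (f := 0) (f' := 0) (hasDerivAt_const x (0 : E)) hx, norm_zero]
  simpa using h

namespace DuhamelBounds

lemma nonneg (h : DuhamelBounds T κ B N ND) (hT : 0 < T) : 0 ≤ B := by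
  have h1 := (norm_nonneg _).trans (h.norm_le 0 ⟨le_rfl, hT.le⟩ 0)
  exact nonneg_of_mul_nonneg_left h1 (Real.rpow_pos_of_pos hT κ)

lemma supTime_le (h : DuhamelBounds T κ B N ND) (hT : 0 < T)
    (hf : ∀ t ∈ Icc 0 T, ∀ x ∈ Icc (0 : ℝ) 1, f t x = N t x) :
    supTime T c1Norm f ≤ ENNReal.ofReal (2 * (B * T ^ κ)) := by
  have hB := h.nonneg hT
  have hc : 0 ≤ B * T ^ κ := by positivity
  refine supTime_le_iff.2 fun t ht => ?_
  rw [two_mul]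
  refine c1Norm_le hc hc (fun x hx => ?_) fun x hx => ?_
  · rw [hf t ht x hx]; exact h.norm_le t ht x
  · rw [dx_congr (hf t ht) hx, dx_eq (h.deriv t ht x) hx]; exact h.norm_deriv_le t ht x

lemma c1Path (h : DuhamelBounds T κ B N ND) (hT : 0 < T) (hκ : 0 < κ) : C1Path T N := by
  have hB := h.nonneg hT
  refine ⟨fun t ht => ContDiff.contDiffOn ?_, fun t ht => ?_⟩
  · refine contDiff_one_iff_deriv.2 ⟨fun x => (h.deriv t ht x).differentiableAt, ?_⟩
    rw [funext fun x => (h.deriv t ht x).deriv]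
    refine continuous_iff_continuousAt.2 fun x => ?_
    rw [ContinuousAt, tendsto_iff_norm_sub_tendsto_zero]
    refine squeeze_zero (fun _ => norm_nonneg _) (fun y => h.space_deriv t ht y x) ?_
    have : ContinuousAt (fun y => B * |y - x| ^ κ) x :=
      continuousAt_const.mul (ContinuousAt.rpow_const (by fun_prop) (Or.inr hκ.le))
    simpa [ContinuousAt, Real.zero_rpow hκ.ne'] using this
  · have h1 : Tendsto (fun s => ENNReal.ofReal
        (B * |s - t| ^ (1 / 2 : ℝ) + B * |s - t| ^ (κ / 2))) (𝓝 t) (𝓝 0) := by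
      have c1 : ContinuousAt (fun s => |s - t| ^ (1 / 2 : ℝ)) t :=
        ContinuousAt.rpow_const (by fun_prop) (Or.inr (by norm_num))
      have c2 : ContinuousAt (fun s => |s - t| ^ (κ / 2)) t :=
        ContinuousAt.rpow_const (by fun_prop) (Or.inr (by linarith))
      have := ENNReal.continuous_ofReal.continuousAt.comp
        ((continuousAt_const (y := B)).mul c1 |>.add ((continuousAt_const (y := B)).mul c2))
      have hκ2 : κ / 2 ≠ 0 := by linarith
      simpa [ContinuousAt, Function.comp_def, Real.zero_rpow hκ2] using this
    refine tendsto_of_tendsto_of_tendsto_of_le_of_le' tendsto_const_nhds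
      (h1.mono_left nhdsWithin_le_nhds) (Eventually.of_forall fun _ => zero_le) ?_
    filter_upwards [self_mem_nhdsWithin] with s hs
    refine c1Norm_le (by positivity) (by positivity) (fun x _ => h.time t ht s hs x) fun x hx => ?_
    rw [dx_eq ((h.deriv s hs x).sub (h.deriv t ht x)) hx]
    exact h.time_deriv t ht s hs x

lemma mem_c1Ball (h : DuhamelBounds T κ B N ND) (hT : 0 < T) (hκ : 0 < κ) {K : ℝ≥0}
    (hK : 2 * (B * T ^ κ) ≤ K) (hf : ∀ t ∈ Icc 0 T, f t = N t) : f ∈ c1Ball T K := by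
  refine ⟨(h.c1Path hT hκ).congr hf, (h.supTime_le hT fun t ht x _ => by rw [hf t ht]).trans ?_⟩
  rw [← ENNReal.ofReal_coe_nnreal]
  exact ENNReal.ofReal_le_ofReal hK

/-- All bounds are pointwise inequalities and pass to limits. The derivatives converge uniformly, so
the limit of the derivatives is the derivative of the limit. -/
lemma exists_limit [CompleteSpace E] {N ND : ℕ → ℝ → ℝ → E} {b : ℕ → ℝ} {c : ℝ}
    (h : ∀ k, DuhamelBounds T κ B (N k) (ND k))
    (hs : ∀ k, DuhamelBounds T κ (b k) (fun t x => N (k + 1) t x - N k t x)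
      (fun t x => ND (k + 1) t x - ND k t x))
    (hb : ∀ k, b k * T ^ κ ≤ c / 2 / 2 ^ k) :
    ∃ N' ND' : ℝ → ℝ → E, DuhamelBounds T κ B N' ND' ∧ ∀ k, ∀ t ∈ Icc 0 T, ∀ x,
      ‖N' t x - N k t x‖ ≤ c / 2 ^ k ∧ ‖ND' t x - ND k t x‖ ≤ c / 2 ^ k := by
  have d1 : ∀ t ∈ Icc 0 T, ∀ x k, dist (N k t x) (N (k + 1) t x) ≤ c / 2 / 2 ^ k :=
    fun t ht x k => by
      rw [dist_comm, dist_eq_norm]; exact ((hs k).norm_le t ht x).trans (hb k)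
  have d2 : ∀ t ∈ Icc 0 T, ∀ x k, dist (ND k t x) (ND (k + 1) t x) ≤ c / 2 / 2 ^ k :=
    fun t ht x k => by
      rw [dist_comm, dist_eq_norm]; exact ((hs k).norm_deriv_le t ht x).trans (hb k)
  set N' : ℝ → ℝ → E := fun t x => limUnder atTop fun k => N k t x
  set ND' : ℝ → ℝ → E := fun t x => limUnder atTop fun k => ND k t x
  have t1 : ∀ t ∈ Icc 0 T, ∀ x, Tendsto (fun k => N k t x) atTop (𝓝 (N' t x)) := fun t ht x =>
    (cauchySeq_of_le_geometric_two (d1 t ht x)).tendsto_limUnder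
  have t2 : ∀ t ∈ Icc 0 T, ∀ x, Tendsto (fun k => ND k t x) atTop (𝓝 (ND' t x)) := fun t ht x =>
    (cauchySeq_of_le_geometric_two (d2 t ht x)).tendsto_limUnder
  have e1 : ∀ k, ∀ t ∈ Icc 0 T, ∀ x, ‖N' t x - N k t x‖ ≤ c / 2 ^ k := fun k t ht x => by
    rw [← dist_eq_norm, dist_comm]
    exact dist_le_of_le_geometric_two_of_tendsto (d1 t ht x) (t1 t ht x) k
  have e2 : ∀ k, ∀ t ∈ Icc 0 T, ∀ x, ‖ND' t x - ND k t x‖ ≤ c / 2 ^ k := fun k t ht x => by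
    rw [← dist_eq_norm, dist_comm]
    exact dist_le_of_le_geometric_two_of_tendsto (d2 t ht x) (t2 t ht x) k
  refine ⟨N', ND', ⟨fun t ht x => ?_, fun t ht x => ?_, fun t ht x => ?_, fun s hs t ht x => ?_,
    fun s hs t ht x => ?_, fun t ht x y => ?_⟩, fun k t ht x => ⟨e1 k t ht x, e2 k t ht x⟩⟩
  · refine hasDerivAt_of_tendstoUniformly (l := atTop) (f := fun k => N k t) (f' := fun k => ND k t)
      ?_ (Eventually.of_forall fun k x => (h k).deriv t ht x) (fun x => t1 t ht x) x
    refine Metric.tendstoUniformly_iff.2 fun ε hε => ?_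
    have h0 : Tendsto (fun k : ℕ => c / 2 ^ k) atTop (𝓝 0) := by
      have := (tendsto_pow_atTop_nhds_zero_of_lt_one (r := (1 / 2 : ℝ)) (by norm_num)
        (by norm_num)).const_mul c
      simpa [div_eq_mul_inv] using this
    filter_upwards [h0.eventually (gt_mem_nhds hε)] with k hk x
    rw [dist_eq_norm]
    exact (e2 k t ht x).trans_lt hk
  · exact le_of_tendsto (t1 t ht x).norm (Eventually.of_forall fun k => (h k).norm_le t ht x)
  · exact le_of_tendsto (t2 t ht x).norm (Eventually.of_forall fun k => (h k).norm_deriv_le t ht x)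
  · exact le_of_tendsto ((t1 t ht x).sub (t1 s hs x)).norm
      (Eventually.of_forall fun k => (h k).time s hs t ht x)
  · exact le_of_tendsto ((t2 t ht x).sub (t2 s hs x)).norm
      (Eventually.of_forall fun k => (h k).time_deriv s hs t ht x)
  · exact le_of_tendsto ((t2 t ht x).sub (t2 t ht y)).norm
      (Eventually.of_forall fun k => (h k).space_deriv t ht x y)

end DuhamelBounds

lemma zero_mem_c1Ball (T : ℝ) (K : ℝ≥0) : (0 : ℝ → ℝ → E) ∈ c1Ball T K := by
  refine ⟨⟨fun t _ => contDiffOn_const, fun t _ => ?_⟩, supTime_le_iff.2 fun t _ => ?_⟩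
  · simp only [Pi.zero_apply, sub_zero, c1Norm_zero]
    exact tendsto_const_nhds
  · rw [Pi.zero_apply, c1Norm_zero]; exact zero_le

lemma supTime_sub_le {K : ℝ≥0} {v w : ℝ → ℝ → E} (hv : v ∈ c1Ball T K) (hw : w ∈ c1Ball T K) :
    supTime T c1Norm (v - w) ≤ ENNReal.ofReal (4 * K) := by
  refine supTime_le_iff.2 fun t ht => ?_
  have hv' := le_of_supTime hv.2 ht
  have hw' := le_of_supTime hw.2 ht
  rw [← ENNReal.ofReal_coe_nnreal] at hv' hw'
  have hK := K.coe_nonneg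
  -- One K for each of v and w, in the sup norm and in the derivative.
  rw [show (4 : ℝ) * K = (K + K) + (K + K) by ring]
  refine c1Norm_le (by positivity) (by positivity) (fun x hx => ?_) fun x hx => ?_
  · exact norm_sub_le_of_le (norm_le_of_c1Norm hK hv' x hx) (norm_le_of_c1Norm hK hw' x hx)
  · rw [Pi.sub_apply, dx_sub (hv.1.mem t ht) (hw.1.mem t ht) hx]
    exact norm_sub_le_of_le (norm_dx_le_of_c1Norm hK hv' x hx) (norm_dx_le_of_c1Norm hK hw' x hx)

end Limits

end FixedPoint

/-! ### Contraction and stability -/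

section Contraction

namespace Data

variable {n : ℕ} {α β T δ : ℝ} {M K L : ℝ≥0} {g : Vec n → Mat n} {D D₂ : Data n}
  {v w : ℝ → ℝ → Vec n}

lemma dist_self (α β T : ℝ) (D : Data n) : Data.dist α β T D D = 0 := by
  simp [Data.dist, supTime, holderNorm, supNorm, holderTwo, incr]

/-- The hypotheses on one set of data. -/
structure Single (α β T : ℝ) (M K L : ℝ≥0) (g : Vec n → Mat n) (D : Data n) : Prop where
  hα : 1 / 3 < α
  hαβ : α < β
  hβ : β < 1 / 2
  hT : 0 < T
  hT1 : T ≤ 1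
  small : 2 * (solConst n α β (bigConst M K L) * T ^ ((β - α) / 2)) ≤ min (K : ℝ) (1 / 2)
  hg : C3Bound L g
  adm : D.Admissible α β T
  bdd : D.BoundedBy α β T M

namespace Single

lemma setup (h : Single α β T M K L g D) (h₂ : Single α β T M K L g D₂) (hv : v ∈ c1Ball T K)
    (hw : w ∈ c1Ball T K) (hδ : 0 ≤ δ) (hD : Data.dist α β T D D₂ ≤ ENNReal.ofReal δ)
    (hvw : supTime T c1Norm (v - w) ≤ ENNReal.ofReal δ) : Setup α β T M K L δ g D D₂ v w :=
  ⟨h.hα, h.hαβ, h.hβ, h.hT, h.hT1, hδ, h.hg, h.adm, h.bdd, h₂.adm, h₂.bdd, hv, hw, hD, hvw⟩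

lemma setup_self (h : Single α β T M K L g D) (hv : v ∈ c1Ball T K)
    (hw : w ∈ c1Ball T K) (hδ : 0 ≤ δ)
    (hvw : supTime T c1Norm (v - w) ≤ ENNReal.ofReal δ) : Setup α β T M K L δ g D D v w :=
  h.setup h hv hw hδ (by rw [dist_self]; exact zero_le) hvw

/-- Serves the statements about a single argument: identities and bounds that do not involve δ. The
value 4K is merely a convenient admissible one. -/
lemma setup_diag (h : Single α β T M K L g D) (hv : v ∈ c1Ball T K) :
    Setup α β T M K L (4 * K) g D D v v :=
  h.setup_self hv hv (by positivity) (supTime_sub_le hv hv)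

lemma κ_pos (h : Single α β T M K L g D) : 0 < (β - α) / 2 := by linarith [h.hαβ]

lemma sol_mem (h : Single α β T M K L g D) (hv : v ∈ c1Ball T K) : D.sol g T v ∈ c1Ball T K :=
  (h.setup_diag hv).bounds.1.mem_c1Ball h.hT h.κ_pos (h.small.trans (min_le_left _ _))
    fun _ _ => rfl

lemma mapsTo (h : Single α β T M K L g D) : MapsTo (D.G g) (c1Ball T K) (c1Ball T K) := fun _ hv =>
  (h.setup_diag hv).bounds.1.mem_c1Ball h.hT h.κ_pos (h.small.trans (min_le_left _ _))
    fun _ ht => funext fun x => (h.setup_diag hv).G_eq ht x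

lemma mul_small (h : Single α β T M K L g D) (hδ : 0 ≤ δ) :
    2 * (solConst n α β (bigConst M K L) * δ * T ^ ((β - α) / 2)) ≤ δ / 2 := by
  have := mul_le_mul_of_nonneg_right (h.small.trans (min_le_right _ _)) hδ
  linarith

lemma supTime_sol_sub_le (h : Single α β T M K L g D) (hS : Setup α β T M K L δ g D D₂ v w)
    {f : ℝ → ℝ → Vec n} (hf : ∀ t ∈ Icc 0 T, ∀ x ∈ Icc (0 : ℝ) 1,
      f t x = D.sol g T v t x - D₂.sol g T w t x) :
    supTime T c1Norm f ≤ ENNReal.ofReal (δ / 2) :=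
  (hS.bounds_sub.supTime_le h.hT hf).trans (ENNReal.ofReal_le_ofReal (h.mul_small hS.hδ))

/-- The difference estimate with equal data and δ = ‖v - w‖. The smallness of T turns the constant
into 1/2. -/
lemma contraction (h : Single α β T M K L g D) (hv : v ∈ c1Ball T K) (hw : w ∈ c1Ball T K) :
    supTime T c1Norm (D.G g v - D.G g w) ≤ ((1 / 2 : ℝ≥0) : ℝ≥0∞) * supTime T c1Norm (v - w) := by
  obtain ⟨δ, hδ⟩ : ∃ δ : ℝ≥0, supTime T c1Norm (v - w) = δ :=
    ⟨_, (ENNReal.coe_toNNReal ((supTime_sub_le hv hw).trans_lt ENNReal.ofReal_lt_top).ne).symm⟩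
  have hS := h.setup_self (δ := δ) hv hw δ.coe_nonneg
    (by rw [hδ, ENNReal.ofReal_coe_nnreal])
  refine (h.supTime_sol_sub_le hS fun t ht x _ => ?_).trans ?_
  · simp only [Pi.sub_apply]
    rw [(h.setup_diag hv).G_eq ht, (h.setup_diag hw).G_eq ht]
  · rw [hδ, ← ENNReal.coe_mul, ← ENNReal.ofReal_coe_nnreal]
    exact ENNReal.ofReal_le_ofReal (le_of_eq (by push_cast; ring))

lemma sol_eq_of_isFixed (h : Single α β T M K L g D) (hv : v ∈ c1Ball T K) (hf : D.IsFixed g T v)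
    {t x : ℝ} (ht : t ∈ Icc 0 T) (hx : x ∈ Icc (0 : ℝ) 1) : D.sol g T v t x = v t x := by
  rw [← (h.setup_diag hv).G_eq ht, hf t ht x hx]

/-- The difference estimate gives ‖v - w‖ ≤ δ'/2, where δ' is the maximum of the data distance bound
δ and ‖v - w‖. If the maximum is ‖v - w‖, then this norm vanishes; in both cases ‖v - w‖ ≤ δ.
Uniqueness is the case δ = 0. -/
lemma fixed_sub_le (h : Single α β T M K L g D) (h₂ : Single α β T M K L g D₂)
    (hv : v ∈ c1Ball T K) (hw : w ∈ c1Ball T K) (hf : D.IsFixed g T v) (hf₂ : D₂.IsFixed g T w)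
    (hδ : 0 ≤ δ) (hD : Data.dist α β T D D₂ ≤ ENNReal.ofReal δ) :
    supTime T c1Norm (v - w) ≤ ENNReal.ofReal δ := by
  obtain ⟨d, hd⟩ : ∃ d : ℝ≥0, supTime T c1Norm (v - w) = d :=
    ⟨_, (ENNReal.coe_toNNReal ((supTime_sub_le hv hw).trans_lt ENNReal.ofReal_lt_top).ne).symm⟩
  have hS := h.setup h₂ (δ := max δ d) hv hw (hδ.trans (le_max_left _ _))
    (hD.trans (ENNReal.ofReal_le_ofReal (le_max_left _ _)))
    (by rw [hd, ← ENNReal.ofReal_coe_nnreal]; exact ENNReal.ofReal_le_ofReal (le_max_right _ _))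
  have := h.supTime_sol_sub_le hS (f := v - w) fun t ht x hx => by
    rw [h.sol_eq_of_isFixed hv hf ht hx, h₂.sol_eq_of_isFixed hw hf₂ ht hx]; rfl
  rw [hd, ← ENNReal.ofReal_coe_nnreal] at this ⊢
  have h0 : 0 ≤ max δ d := hδ.trans (le_max_left _ _)
  have h1 := (ENNReal.ofReal_le_ofReal_iff (by positivity)).1 this
  refine ENNReal.ofReal_le_ofReal ?_
  rcases max_cases δ (d : ℝ) with h' | h' <;> linarith [d.coe_nonneg]

lemma fixed_unique (h : Single α β T M K L g D) (hv : v ∈ c1Ball T K) (hw : w ∈ c1Ball T K)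
    (hf : D.IsFixed g T v) (hf₂ : D.IsFixed g T w) {t x : ℝ} (ht : t ∈ Icc 0 T)
    (hx : x ∈ Icc (0 : ℝ) 1) : w t x = v t x := by
  have h1 := h.fixed_sub_le h hw hv hf₂ hf le_rfl (by rw [dist_self]; exact zero_le)
  have h2 := norm_le_of_c1Norm le_rfl (le_of_supTime h1 ht) x hx
  exact sub_eq_zero.1 (norm_le_zero_iff.1 h2)

/-- The C¹ bound is already known, so the difference of the two fixed points is a difference of
images with distances at most δ; its 1/2-Hölder modulus in time is part of the bounds on time
convolutions. -/
lemma timeHolder_le (h : Single α β T M K L g D) (h₂ : Single α β T M K L g D₂)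
    (hv : v ∈ c1Ball T K) (hw : w ∈ c1Ball T K) (hf : D.IsFixed g T v) (hf₂ : D₂.IsFixed g T w)
    (hδ : 0 ≤ δ) (hD : Data.dist α β T D D₂ ≤ ENNReal.ofReal δ) :
    timeHolderHalfNorm T (v - w) ≤
      ENNReal.ofReal (δ + solConst n α β (bigConst M K L) * δ) := by
  have h1 := h.fixed_sub_le h₂ hv hw hf hf₂ hδ hD
  have hS := h.setup h₂ hv hw hδ hD h1
  have hC := hS.bounds_sub.nonneg h.hT
  rw [ENNReal.ofReal_add hδ hC]
  refine add_le_add (supTime_le_iff.2 fun t ht => le_self_add.trans (le_of_supTime h1 ht)) ?_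
  simp only [iSup_le_iff]
  intro s hs t ht hst
  have hp : 0 < |t - s| ^ (1 / 2 : ℝ) :=
    Real.rpow_pos_of_pos (abs_pos.2 (sub_ne_zero.2 (Ne.symm hst))) _
  rw [ENNReal.div_le_iff (by simpa using hp) ENNReal.ofReal_ne_top, ← ENNReal.ofReal_mul hC,
    supNorm_le_iff (by positivity)]
  intro x hx
  have := hS.bounds_sub.time s hs t ht x
  rwa [h.sol_eq_of_isFixed hv hf ht hx, h₂.sol_eq_of_isFixed hw hf₂ ht hx,
    h.sol_eq_of_isFixed hv hf hs hx, h₂.sol_eq_of_isFixed hw hf₂ hs hx] at this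

/-- Picard iterates. -/
def picard (D : Data n) (g : Vec n → Mat n) (T : ℝ) : ℕ → ℝ → ℝ → Vec n
  | 0 => 0
  | k + 1 => D.sol g T (picard D g T k)

lemma picard_mem (h : Single α β T M K L g D) (k : ℕ) : picard D g T k ∈ c1Ball T K := by
  induction k with
  | zero => exact zero_mem_c1Ball T K
  | succ k ih => exact h.sol_mem ih

/-- Consecutive iterates start at distance at most 4K, and every step halves it. -/
lemma picard_setup (h : Single α β T M K L g D) (k : ℕ) :
    Setup α β T M K L (4 * K / 2 ^ k) g D D (picard D g T (k + 1)) (picard D g T k) := by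
  refine h.setup_self (h.picard_mem _) (h.picard_mem _) (by positivity) ?_
  induction k with
  | zero => simpa using supTime_sub_le (h.picard_mem 1) (h.picard_mem 0)
  | succ k ih =>
    have hS := h.setup_self (h.picard_mem (k + 1)) (h.picard_mem k) (by positivity) ih
    refine (h.supTime_sol_sub_le hS fun t _ x _ => rfl).trans (ENNReal.ofReal_le_ofReal ?_)
    rw [pow_succ, div_div]

/-- The iterates converge in C¹, uniformly in time, and the limit inherits the bounds that place it
in the ball. It is fixed because the map is Lipschitz there: applied to the limit and to an iterate,
it gives values that differ by O(2^{-k}). -/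
lemma exists_fixed (h : Single α β T M K L g D) : ∃ v ∈ c1Ball T K, D.IsFixed g T v := by
  have hK := K.coe_nonneg
  obtain ⟨N, ND, hN, hlim⟩ := DuhamelBounds.exists_limit (c := 8 * K)
    (N := fun k => D.sol g T (picard D g T k)) (ND := fun k => D.solD g T (picard D g T k))
    (fun k => (h.setup_diag (h.picard_mem k)).bounds.1) (fun k => (h.picard_setup k).bounds_sub)
    (fun k => by
      have hd : 0 ≤ 4 * (K : ℝ) / 2 ^ k := by positivity
      have := h.mul_small hd
      rw [show (8 : ℝ) * K / 2 / 2 ^ k = 4 * K / 2 ^ k by ring]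
      linarith)
  have hNm : N ∈ c1Ball T K := hN.mem_c1Ball h.hT h.κ_pos (h.small.trans (min_le_left _ _))
    fun _ _ => rfl
  refine ⟨N, hNm, fun t ht x hx => ?_⟩
  rw [(h.setup_diag hNm).G_eq ht]
  -- Of the constant 24K, the part 16K bounds the distance from the limit to iterate k+1 in C¹ (8K
  -- each for function and derivative), which the map does not increase. The other 8K bounds the
  -- distance from the limit to iterate k+2.
  have hd : ∀ k : ℕ, ‖D.sol g T N t x - N t x‖ ≤ 24 * K / 2 ^ k := fun k => by
    have hp : 0 ≤ 16 * (K : ℝ) / 2 ^ k := by positivity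
    have hsup : supTime T c1Norm (N - picard D g T (k + 1)) ≤ ENNReal.ofReal (16 * K / 2 ^ k) := by
      refine supTime_le_iff.2 fun s hs => ?_
      rw [show (16 : ℝ) * K / 2 ^ k = 8 * K / 2 ^ k + 8 * K / 2 ^ k by ring]
      refine c1Norm_le (by positivity) (by positivity) (fun y _ => (hlim k s hs y).1) fun y hy => ?_
      rw [Pi.sub_apply, dx_sub (hNm.1.mem s hs) ((h.picard_mem (k + 1)).1.mem s hs) hy,
        dx_eq (hN.deriv s hs y) hy,
        dx_eq (f := picard D g T (k + 1) s)
          ((h.setup_diag (h.picard_mem k)).bounds.1.deriv s hs y) hy]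
      exact (hlim k s hs y).2
    have hS := h.setup_self hNm (h.picard_mem (k + 1)) hp hsup
    have h1 := hS.bounds_sub.norm_le t ht x
    have h2 := h.mul_small hp
    have h3 := (hlim (k + 1) t ht x).1
    have e : D.sol g T N t x - N t x = (D.sol g T N t x - D.sol g T (picard D g T (k + 1)) t x) -
        (N t x - D.sol g T (picard D g T (k + 1)) t x) := by abel
    rw [e]
    refine (norm_sub_le_of_le h1 h3).trans ?_
    have h4 : 8 * (K : ℝ) / 2 ^ (k + 1) ≤ 8 * K / 2 ^ k := by
      gcongr
      · norm_num
      · omega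
    have h5 : 24 * (K : ℝ) / 2 ^ k = 16 * K / 2 ^ k + 8 * K / 2 ^ k := by ring
    linarith
  have h0 : Tendsto (fun k : ℕ => 24 * (K : ℝ) / 2 ^ k) atTop (𝓝 0) := by
    have := (tendsto_pow_atTop_nhds_zero_of_lt_one (r := (1 / 2 : ℝ)) (by norm_num)
      (by norm_num)).const_mul (24 * (K : ℝ))
    simpa [div_eq_mul_inv] using this
  exact sub_eq_zero.1 (norm_le_zero_iff.1 (ge_of_tendsto' h0 hd))

end Single

lemma exists_small {C η κ : ℝ} (hC : 0 ≤ C) (hη : 0 < η) (hκ : 0 < κ) :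
    ∃ T₀ : ℝ, 0 < T₀ ∧ T₀ ≤ 1 ∧ ∀ T, 0 < T → T ≤ T₀ → 2 * (C * T ^ κ) ≤ η := by
  have hc : 0 < η / (2 * C + 1) := by positivity
  -- The summand 1 in the denominator covers C = 0; the cap at 1 is needed because smoothing times
  -- are at most 1.
  refine ⟨min 1 ((η / (2 * C + 1)) ^ κ⁻¹), by positivity, min_le_left _ _, fun T hT hT0 => ?_⟩
  have h1 : T ^ κ ≤ η / (2 * C + 1) := by
    have := Real.rpow_le_rpow hT.le (hT0.trans (min_le_right _ _)) hκ.le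
    rwa [← Real.rpow_mul hc.le, inv_mul_cancel₀ hκ.ne', Real.rpow_one] at this
  rw [le_div_iff₀ (by positivity)] at h1
  have := Real.rpow_pos_of_pos hT κ
  linarith

end Data

end Contraction

end

end RoughBurgers

theorem mainTheorem7 (n : ℕ) (α β : ℝ) (hα : 1 / 3 < α) (hαβ : α < β) (hβ : β < 1 / 2)
    (K M L : ℝ≥0) (hK : 0 < K) :
    ∃ Tmax : ℝ, 0 < Tmax ∧ ∀ T : ℝ, 0 < T → T ≤ Tmax →
      (∀ (g : Vec n → Mat n) (D : Data n), ContDiff ℝ 3 g → c3Norm g ≤ L →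
        D.Admissible α β T → D.BoundedBy α β T M →
        (∀ v ∈ c1Ball T K, D.WellDefined g T v) ∧
        MapsTo (D.G g) (c1Ball T K) (c1Ball T K) ∧
        (∃ q : ℝ≥0, q < 1 ∧ ∀ v ∈ c1Ball T K, ∀ w ∈ c1Ball T K,
          supTime T c1Norm (D.G g v - D.G g w) ≤ q * supTime T c1Norm (v - w)) ∧
        (∃ v ∈ c1Ball T K, D.IsFixed g T v ∧
          ∀ w ∈ c1Ball T K, D.IsFixed g T w →
            ∀ t ∈ Icc (0 : ℝ) T, ∀ x ∈ Icc (0 : ℝ) 1, w t x = v t x)) ∧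
      (∃ C : ℝ≥0, ∀ (g : Vec n → Mat n) (D D₂ : Data n), ContDiff ℝ 3 g → c3Norm g ≤ L →
        D.Admissible α β T → D.BoundedBy α β T M →
        D₂.Admissible α β T → D₂.BoundedBy α β T M →
        ∀ v ∈ c1Ball T K, ∀ w ∈ c1Ball T K, D.IsFixed g T v → D₂.IsFixed g T w →
          supTime T c1Norm (v - w) ≤ C * Data.dist α β T D D₂ ∧
          timeHolderHalfNorm T (v - w) ≤ C * Data.dist α β T D D₂) := by
  have hη : 0 < min (K : ℝ) (1 / 2) := lt_min hK (by norm_num)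
  have hA : 1 ≤ Data.bigConst M K L := Data.Setup.one_le_bigConst
  have hC := Data.solConst_nonneg n hα hαβ hβ (zero_le_one.trans hA)
  obtain ⟨T₀, hT₀, hT₀1, hsmall⟩ := Data.exists_small hC hη (κ := (β - α) / 2) (by linarith)
  refine ⟨T₀, hT₀, fun T hT hTT => ?_⟩
  have single : ∀ (g : Vec n → Mat n) (D : Data n), ContDiff ℝ 3 g → c3Norm g ≤ L →
      D.Admissible α β T → D.BoundedBy α β T M → Data.Single α β T M K L g D :=
    fun g D hg hL hD hM => ⟨hα, hαβ, hβ, hT, hTT.trans hT₀1, hsmall T hT hTT,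
      C3Bound.of_c3Norm hg hL, hD, hM⟩
  refine ⟨fun g D hg hL hD hM => ?_, ?_⟩
  · have h := single g D hg hL hD hM
    obtain ⟨v, hv, hf⟩ := h.exists_fixed
    exact ⟨fun v hv => (h.setup_diag hv).wellDefined, h.mapsTo,
      ⟨1 / 2, by rw [← NNReal.coe_lt_coe]; norm_num, fun v hv w hw => h.contraction hv hw⟩,
      v, hv, hf, fun w hw hfw t ht x hx => h.fixed_unique hv hw hf hfw ht hx⟩
  -- The 1 is the Lipschitz constant of the fixed point in C¹, the other summand that of its time
  -- modulus. A positive constant also makes the case of infinite distance trivial.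
  · refine ⟨1 + (Data.solConst n α β (Data.bigConst M K L)).toNNReal,
      fun g D D₂ hg hL hD hM hD₂ hM₂ v hv w hw hf hf₂ => ?_⟩
    have h := single g D hg hL hD hM
    have h₂ := single g D₂ hg hL hD₂ hM₂
    rcases eq_or_ne (Data.dist α β T D D₂) ⊤ with htop | htop
    · rw [htop, ENNReal.mul_top (by simp)]
      exact ⟨le_top, le_top⟩
    obtain ⟨δ, hδ⟩ : ∃ δ : ℝ≥0, Data.dist α β T D D₂ = δ := ⟨_, (ENNReal.coe_toNNReal htop).symm⟩
    have hd : Data.dist α β T D D₂ ≤ ENNReal.ofReal δ := by rw [hδ, ENNReal.ofReal_coe_nnreal]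
    have e : ((1 + (Data.solConst n α β (Data.bigConst M K L)).toNNReal : ℝ≥0) : ℝ≥0∞) * δ =
        ENNReal.ofReal (δ + Data.solConst n α β (Data.bigConst M K L) * δ) := by
      rw [← ENNReal.coe_mul, ← ENNReal.ofReal_coe_nnreal]
      congr 1
      push_cast
      rw [Real.coe_toNNReal _ hC]
      ring
    rw [hδ, e]
    refine ⟨(h.fixed_sub_le h₂ hv hw hf hf₂ δ.coe_nonneg hd).trans (ENNReal.ofReal_le_ofReal ?_),
      h.timeHolder_le h₂ hv hw hf hf₂ δ.coe_nonneg hd⟩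
    have := δ.coe_nonneg
    have : 0 ≤ Data.solConst n α β (Data.bigConst M K L) * δ := by positivity
    linarith
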